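/- **Setting.** Let $\mathcal A\subseteq\mathbb M_{d_{\mathcal A}}$ be a unital $*$-subalgebra, let $\omega$ be a translation invariant state on the chain with one-site algebra $\mathcal A$, and let $\omega_N$ be its marginal on $N$ consecutive sites (identified with its density matrix in $\mathcal A^{\otimes N}$). Assume that $\omega$ is $C^*$-finitely correlated with memory algebra $\mathbb M_{d_{\mathcal B}}$: there are a completely positive unital map $\mathcal E:\mathcal A\otimes\mathbb M_{d_{\mathcal B}}\to\mathbb M_{d_{\mathcal B}}$ and a state $\rho$ on $\mathbb M_{d_{\mathcal B}}$ with $\rho\circ\mathcal E_{\mathbb 1}=\rho$ and $\omega(A_1\otimes\cdots\otimes A_n)=\rho(\mathcal E_{A_1}\cdots\mathcal E_{A_n}(\mathbb 1))$ for all $n$ and all $A_i\in\mathcal A$, where $\mathcal E_A(B)=\mathcal E(A\otimes B)$. Let $\Omega$ be the map sending an observable $X$ of the sites $i>0$ to the functional $Y\mapsto\omega(Y\otimes X)$ on the observables of the sites $i\le 0$, let $m$ be its (finite) rank, and let $t_1^*,t_2^*\ge 0$ be such that the restriction of $\Omega$ sending $\mathcal A_{[1,t_2^*]}$ to functionals on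 $\mathcal A_{[-t_1^*,0]}$ still has rank $m$. For an integer $s\ge\max\{t_2^*,t_1^*+1\}$ let $\sigma_m(\Omega)$ be the $m$-th (smallest nonzero) singular value, with respect to the Hilbert–Schmidt norms, of the restriction of $\Omega$ sending $\mathcal A_{[1,s]}$ to functionals on $\mathcal A_{[1-s,0]}$. **Algorithm.** Fix self-adjoint Hilbert–Schmidt orthonormal bases $\{Z_k\}$ of $\mathcal A$, $\{X_i\}$ of $\mathcal A_{[1,s]}$ and $\{Y_j\}$ of $\mathcal A_{[1-s,0]}$. The input is $n$ copies of $\omega$, the integer $s$, a threshold $\eta$ and a length $t\ge 1$. (1) Any tomography subroutine measures $n$ copies of $\omega_{2s+1}$ and returns estimates $\hat\omega_s,\hat\omega_{2s},\hat\omega_{2s+1}$. (2) Set $\widehat{\Omega(\mathbb 1)}_j=\hat\omega_s(Y_j)$, $\widehat{\tau\Omega}_i=\hat\omega_s(X_i)$, $\hat\Omega_{ji}=\hat\omega_{2s}(Y_j\otimes X_i)$ and $(\hat\Omega_{Z_k})_{ji}=\hat\omega_{2s+1}(Y_j\otimes Z_k\otimes X_i)$. (3) Let the columns of $\hat U$ be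 the left singular vectors of $\hat\Omega$ with singular value at least $\eta$. (4) With $^+$ the Moore–Penrose pseudoinverse, set $\hat e=\hat U^\dagger\widehat{\Omega(\mathbb 1)}$, $\hat\rho=\widehat{\tau\Omega}\,(\hat U^\dagger\hat\Omega)^+$ and $\hat{\mathbb K}_{Z_k}=\hat U^\dagger\hat\Omega_{Z_k}(\hat U^\dagger\hat\Omega)^+$. (5) Output the linear functional $\hat\omega_t$ on $\mathcal A^{\otimes t}$ (not necessarily positive) with $\hat\omega_t(Z_{k_1}\otimes\cdots\otimes Z_{k_t})=\hat\rho\,\hat{\mathbb K}_{Z_{k_1}}\cdots\hat{\mathbb K}_{Z_{k_t}}\hat e$. **Theorem.** Let $0<\epsilon<1$ and let $\delta$ be a failure probability. Put $$\varepsilon=\frac{\epsilon\,\sigma_m(\Omega)^3}{20\,t\,d_{\mathcal B}\sqrt{d_{\mathcal A}}}$$ and assume $\sigma_m(\Omega)/2\ge\eta\ge 2\varepsilon$. If $n$ copies are enough for the tomography subroutine to learn $\omega_s$, $\omega_{2s}$ and $\omega_{2s+1}$, each within Hilbert–Schmidt distance $\varepsilon$, with probability at least $1-\delta$, then with probability at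 least $1-\delta$ the output of the algorithm satisfies $$d_{\mathrm{Tr}}(\hat\omega_t,\omega_t)=\tfrac12\|\hat\omega_t-\omega_t\|_1\le\epsilon ,$$ where $\|\cdot\|_1$ is the norm of functionals dual to the operator norm on $\mathcal A^{\otimes t}$. -/

import Mathlib

open scoped Matrix Kronecker ComplexOrder

noncomputable section

namespace FCS

/-! ### Tensor products of matrices -/

/-- `M 0 ⊗ M 1 ⊗ ⋯ ⊗ M (n-1)`, as a matrix indexed by configurations `Fin n → ι`. -/
def piKron {n : ℕ} {ι : Type*} (M : Fin n → Matrix ι ι ℂ) :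
    Matrix (Fin n → ι) (Fin n → ι) ℂ :=
  Matrix.of fun i j => ∏ k, M k (i k) (j k)

/-- `Y ⊗ X` for an operator `Y` on `a` sites followed, to its right, by an operator `X` on `b`
sites. -/
def join {d a b : ℕ} (Y : Matrix (Fin a → Fin d) (Fin a → Fin d) ℂ)
    (X : Matrix (Fin b → Fin d) (Fin b → Fin d) ℂ) :
    Matrix (Fin (a + b) → Fin d) (Fin (a + b) → Fin d) ℂ :=
  Matrix.of fun i j =>
    Y (fun k => i (Fin.castAdd b k)) (fun k => j (Fin.castAdd b k)) *
      X (fun k => i (Fin.natAdd a k)) (fun k => j (Fin.natAdd a k))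

/-- The Hilbert-Schmidt norm of a matrix. -/
def hsNorm {ι κ : Type*} [Fintype ι] [Fintype κ] (M : Matrix ι κ ℂ) : ℝ :=
  Real.sqrt (∑ i, ∑ j, ‖M i j‖ ^ 2)

/-! ### Translation invariant states on the chain

The one-site algebra is a unital `*`-subalgebra `A` of the `d × d` matrices. -/

/-- The algebra of a block of `N` consecutive sites, `A ⊗ ⋯ ⊗ A` (`N` factors). -/
def blockAlg {d : ℕ} (A : StarSubalgebra ℂ (Matrix (Fin d) (Fin d) ℂ)) (N : ℕ) :
    Submodule ℂ (Matrix (Fin N → Fin d) (Fin N → Fin d) ℂ) :=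
  Submodule.span ℂ (Set.range fun a : Fin N → A =>
    piKron fun k => (a k : Matrix (Fin d) (Fin d) ℂ))

/-- A translation invariant state on the chain algebra of `A`, given by its marginals: for every
`N` the density matrix, in the algebra of a block of `N` sites, of the restriction of the state to
such a block. The marginals are consistent when a site is dropped on the right or on the left. -/
structure TIState {d : ℕ} (A : StarSubalgebra ℂ (Matrix (Fin d) (Fin d) ℂ)) where
  density : ∀ N : ℕ, Matrix (Fin N → Fin d) (Fin N → Fin d) ℂ
  mem : ∀ N, density N ∈ blockAlg A N
  posSemidef : ∀ N, (density N).PosSemidef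
  trace_one : ∀ N, (density N).trace = 1
  drop_right : ∀ (N : ℕ) (i j : Fin N → Fin d),
    ∑ k : Fin d, density (N + 1) (Fin.snoc i k) (Fin.snoc j k) = density N i j
  drop_left : ∀ (N : ℕ) (i j : Fin N → Fin d),
    ∑ k : Fin d, density (N + 1) (Fin.cons k i) (Fin.cons k j) = density N i j

/-- The value `ω(X)` of the state on an operator `X` on `N` consecutive sites. -/
def TIState.eval {d : ℕ} {A : StarSubalgebra ℂ (Matrix (Fin d) (Fin d) ℂ)} (ω : TIState A)
    {N : ℕ} (X : Matrix (Fin N → Fin d) (Fin N → Fin d) ℂ) : ℂ :=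
  (ω.density N * X).trace

/-- The rank `m` of `Ω`: the dimension of the space generated by the functionals
`Ψ_X : Y ↦ ω(Y ⊗ X)` on the left half chain, where `X` is a local observable on the right half
chain. A functional on the left half chain is recorded through its restrictions to the blocks of
`a` sites next to the cut. -/
def TIState.rank {d : ℕ} {A : StarSubalgebra ℂ (Matrix (Fin d) (Fin d) ℂ)}
    (ω : TIState A) : ℕ :=
  Module.finrank ℂ (Submodule.span ℂ
    {Ψ : (a : ℕ) → blockAlg A a → ℂ |
      ∃ (b : ℕ) (X : blockAlg A b), Ψ = fun _ Y => ω.eval (join Y.1 X.1)})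

/-- The rank of the restriction of `Ω` that sends observables of the first `b` sites on the right
of the cut to functionals on the observables of the last `a` sites on the left of the cut. -/
def TIState.blockRank {d : ℕ} {A : StarSubalgebra ℂ (Matrix (Fin d) (Fin d) ℂ)}
    (ω : TIState A) (a b : ℕ) : ℕ :=
  Module.finrank ℂ (Submodule.span ℂ
    (Set.range fun (X : blockAlg A b) (Y : blockAlg A a) => ω.eval (join Y.1 X.1)))

/-! ### `C*`-realizations with memory algebra `M_D` -/

/-- The algebra `A ⊗ M_D`, inside the matrices indexed by `Fin d × Fin D`. -/
def memAlg {d : ℕ} (A : StarSubalgebra ℂ (Matrix (Fin d) (Fin d) ℂ)) (D : ℕ) :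
    Submodule ℂ (Matrix (Fin d × Fin D) (Fin d × Fin D) ℂ) :=
  Submodule.span ℂ
    {M | ∃ a ∈ A, ∃ b : Matrix (Fin D) (Fin D) ℂ, M = a ⊗ₖ b}

/-- The elementary tensor `a ⊗ b` as an element of `A ⊗ M_D`. -/
def memTmul {d : ℕ} {A : StarSubalgebra ℂ (Matrix (Fin d) (Fin d) ℂ)} {D : ℕ}
    (a : A) (b : Matrix (Fin D) (Fin D) ℂ) : memAlg A D :=
  ⟨(a : Matrix (Fin d) (Fin d) ℂ) ⊗ₖ b, Submodule.subset_span ⟨a, a.2, b, rfl⟩⟩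

/-- Complete positivity of a linear map `A ⊗ M_D → M_D`: all amplifications preserve
positive semidefiniteness. -/
def IsCP {d : ℕ} {A : StarSubalgebra ℂ (Matrix (Fin d) (Fin d) ℂ)} {D : ℕ}
    (E : memAlg A D →ₗ[ℂ] Matrix (Fin D) (Fin D) ℂ) : Prop :=
  ∀ (k : ℕ) (X : Fin k → Fin k → memAlg A D),
    (Matrix.of fun p q : Fin k × (Fin d × Fin D) => (X p.1 q.1).1 p.2 q.2).PosSemidef →
      (Matrix.of fun p q : Fin k × Fin D => E (X p.1 q.1) p.2 q.2).PosSemidef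

/-- A `C*`-realization `(M_D, 1, E, ρ)` of the translation invariant state `ω`. -/
structure CStarRealization {d : ℕ} {A : StarSubalgebra ℂ (Matrix (Fin d) (Fin d) ℂ)}
    (ω : TIState A) (D : ℕ) where
  /-- the completely positive unital map `A ⊗ M_D → M_D` -/
  E : memAlg A D →ₗ[ℂ] Matrix (Fin D) (Fin D) ℂ
  /-- the density matrix of the state on the memory -/
  ρ : Matrix (Fin D) (Fin D) ℂ
  isCP : IsCP E
  unital : E (memTmul 1 1) = 1
  ρ_posSemidef : ρ.PosSemidef
  ρ_trace : ρ.trace = 1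
  ρ_invariant : ∀ b : Matrix (Fin D) (Fin D) ℂ,
    (ρ * E (memTmul 1 b)).trace = (ρ * b).trace
  /-- `ω(a₁ ⊗ ⋯ ⊗ aₙ) = ρ(E_{a₁} ⋯ E_{aₙ}(1))`, where `E_a(b) = E(a ⊗ b)` -/
  realizes : ∀ (N : ℕ) (a : Fin N → A),
    ω.eval (piKron fun k => (a k : Matrix (Fin d) (Fin d) ℂ)) =
      (ρ * (List.ofFn a).foldr (fun x b => E (memTmul x b)) 1).trace

/-! ### Measurement procedures -/

/-- A positive operator valued measure with outcomes in `Out`. -/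
structure POVM (ι : Type*) [Fintype ι] [DecidableEq ι] (Out : Type*) [MeasurableSpace Out] where
  effect : Set Out → Matrix ι ι ℂ
  posSemidef : ∀ S, MeasurableSet S → (effect S).PosSemidef
  effect_univ : effect Set.univ = 1
  hasSum : ∀ f : ℕ → Set Out, (∀ k, MeasurableSet (f k)) →
    Pairwise (Function.onFun Disjoint f) →
      HasSum (fun k => effect (f k)) (effect (⋃ k, f k))

/-- A procedure that measures `n` copies of a marginal on `N` sites (collectively, by an arbitrary
measurement on the `n` copies) and computes a result in `β` from the outcome. -/
structure Procedure (d N n : ℕ) (β : Type*) where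
  Out : Type
  [meas : MeasurableSpace Out]
  povm : POVM (Fin n → (Fin N → Fin d)) Out
  result : Out → β

attribute [instance] Procedure.meas

/-- On `n` copies of the marginal of `ω`, the result of the procedure satisfies `good`
with probability at least `1 - δ`. -/
def Procedure.Succeeds {d N n : ℕ} {β : Type*} {A : StarSubalgebra ℂ (Matrix (Fin d) (Fin d) ℂ)}
    (P : Procedure d N n β) (ω : TIState A) (δ : ℝ) (good : β → Prop) : Prop :=
  ∃ S : Set P.Out, MeasurableSet S ∧ (∀ o ∈ S, good (P.result o)) ∧
    1 - δ ≤ ((piKron (fun _ : Fin n => ω.density N) * P.povm.effect S).trace).re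

/-- Estimates of the marginals on `s`, `2s` and `2s+1` consecutive sites. -/
structure Estimates (d s : ℕ) where
  est1 : Matrix (Fin s → Fin d) (Fin s → Fin d) ℂ
  est2 : Matrix (Fin (s + s) → Fin d) (Fin (s + s) → Fin d) ℂ
  est3 : Matrix (Fin (s + 1 + s) → Fin d) (Fin (s + 1 + s) → Fin d) ℂ

/-- The three estimates have precision `p` in Hilbert-Schmidt distance. -/
def Estimates.Within {d s : ℕ} {A : StarSubalgebra ℂ (Matrix (Fin d) (Fin d) ℂ)}
    (W : Estimates d s) (ω : TIState A) (p : ℝ) : Prop :=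
  hsNorm (W.est1 - ω.density s) ≤ p ∧ hsNorm (W.est2 - ω.density (s + s)) ≤ p ∧
    hsNorm (W.est3 - ω.density (s + 1 + s)) ≤ p

/-! ### The spectral reconstruction algorithm -/

/-- `X` is a basis of the space `S` consisting of self-adjoint matrices with
`Tr (X i * X j) = δ_{ij}`. -/
structure IsSelfAdjointONB {ι κ : Type*} [Fintype ι] [DecidableEq κ]
    (S : Submodule ℂ (Matrix ι ι ℂ)) (X : κ → Matrix ι ι ℂ) : Prop where
  selfAdjoint : ∀ i, (X i).IsHermitian
  orthonormal : ∀ i j, (X i * X j).trace = if i = j then 1 else 0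
  span : Submodule.span ℂ (Set.range X) = S

/-- The matrix of `Ω` in the bases `X` (right block) and `Y` (left block), for the functional
with density `W` on the joint block: its entries are `W(Y_j ⊗ X_i)`. -/
def omegaMat {d s : ℕ} {κ ι : Type*} (Y : κ → Matrix (Fin s → Fin d) (Fin s → Fin d) ℂ)
    (X : ι → Matrix (Fin s → Fin d) (Fin s → Fin d) ℂ)
    (W : Matrix (Fin (s + s) → Fin d) (Fin (s + s) → Fin d) ℂ) : Matrix κ ι ℂ :=
  Matrix.of fun j i => (W * join (Y j) (X i)).trace

/-- The matrix of `Ω_z`: its entries are `W(Y_j ⊗ z ⊗ X_i)`. -/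
def omegaMatAt {d s : ℕ} {κ ι : Type*} (Y : κ → Matrix (Fin s → Fin d) (Fin s → Fin d) ℂ)
    (X : ι → Matrix (Fin s → Fin d) (Fin s → Fin d) ℂ)
    (W : Matrix (Fin (s + 1 + s) → Fin d) (Fin (s + 1 + s) → Fin d) ℂ)
    (z : Matrix (Fin d) (Fin d) ℂ) : Matrix κ ι ℂ :=
  Matrix.of fun j i => (W * join (join (Y j) (piKron fun _ : Fin 1 => z)) (X i)).trace

/-- `P` is the Moore-Penrose pseudoinverse of `M`. -/
def IsPseudoinverse {κ ι : Type*} [Fintype κ] [Fintype ι] (M : Matrix κ ι ℂ)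
    (P : Matrix ι κ ℂ) : Prop :=
  M * P * M = M ∧ P * M * P = P ∧ (M * P).IsHermitian ∧ (P * M).IsHermitian

/-- The Moore-Penrose pseudoinverse. -/
def pinv {κ ι : Type*} [Fintype κ] [Fintype ι] (M : Matrix κ ι ℂ) : Matrix ι κ ℂ :=
  Classical.epsilon (IsPseudoinverse M)

/-- Indices `j` of the left singular vectors of `M` (the vectors of an orthonormal eigenbasis of
`M Mᴴ`) whose singular value (the square root of the eigenvalue) is at least `η`. -/
abbrev LargeSV {κ ι : Type*} [Fintype κ] [DecidableEq κ] [Fintype ι] (M : Matrix κ ι ℂ)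
    (η : ℝ) : Type _ :=
  {j : κ // η ≤ Real.sqrt ((Matrix.isHermitian_mul_conjTranspose_self M).eigenvalues j)}

/-- The truncated matrix `Û` of left singular vectors of `M` with singular value at least `η`. -/
def truncU {κ ι : Type*} [Fintype κ] [DecidableEq κ] [Fintype ι] (M : Matrix κ ι ℂ)
    (η : ℝ) : Matrix κ (LargeSV M η) ℂ :=
  Matrix.of fun i j =>
    ((Matrix.isHermitian_mul_conjTranspose_self M).eigenvectorUnitary : Matrix κ κ ℂ) i j.1

/-- The spectral reconstruction: from estimates `W` of the marginals on `s`, `2s`, `2s+1` sites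
and the threshold `η`, the density (in the algebra of `t` sites) of the functional determined by
`ω̂(Z_{k₁} ⊗ ⋯ ⊗ Z_{kₜ}) = ρ̂ K̂_{k₁} ⋯ K̂_{kₜ} ê`, with
`ê = Ûᴴ Ω(1)^`, `ρ̂ = (τΩ)^ (Ûᴴ Ω̂)⁺` and `K̂_k = Ûᴴ Ω̂_{Z_k} (Ûᴴ Ω̂)⁺`. For self-adjoint estimates
`Ω̂` is a real matrix, `Û` can be taken real, and `Ûᴴ` is the transpose of `Û`; the result does not
depend on the choice of the singular vectors. -/
def reconstruct {d s : ℕ} {ζ κ ι : Type} [Fintype ζ] [Fintype κ] [DecidableEq κ] [Fintype ι]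
    (Z : ζ → Matrix (Fin d) (Fin d) ℂ) (Y : κ → Matrix (Fin s → Fin d) (Fin s → Fin d) ℂ)
    (X : ι → Matrix (Fin s → Fin d) (Fin s → Fin d) ℂ) (η : ℝ) (t : ℕ)
    (W : Estimates d s) : Matrix (Fin t → Fin d) (Fin t → Fin d) ℂ :=
  let Ωh : Matrix κ ι ℂ := omegaMat Y X W.est2
  let Uh : Matrix κ (LargeSV Ωh η) ℂ := truncU Ωh η
  let P : Matrix ι (LargeSV Ωh η) ℂ := pinv (Uhᴴ * Ωh)
  let e : LargeSV Ωh η → ℂ := Uhᴴ *ᵥ fun j => (W.est1 * Y j).trace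
  let ρ : LargeSV Ωh η → ℂ := (fun i => (W.est1 * X i).trace) ᵥ* P
  let K : ζ → Matrix (LargeSV Ωh η) (LargeSV Ωh η) ℂ :=
    fun k => Uhᴴ * omegaMatAt Y X W.est3 (Z k) * P
  ∑ k : Fin t → ζ, (ρ ⬝ᵥ ((List.ofFn fun l => K (k l)).prod *ᵥ e)) • piKron fun l => Z (k l)

/-- The learning algorithm: run a tomography subroutine on `n` copies of the marginal on
`2s+1` sites, then apply the spectral reconstruction with threshold `η`. -/
def learnFCS {d s n : ℕ} {ζ κ ι : Type} [Fintype ζ] [Fintype κ] [DecidableEq κ] [Fintype ι]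
    (Z : ζ → Matrix (Fin d) (Fin d) ℂ) (Y : κ → Matrix (Fin s → Fin d) (Fin s → Fin d) ℂ)
    (X : ι → Matrix (Fin s → Fin d) (Fin s → Fin d) ℂ)
    (T : Procedure d (s + 1 + s) n (Estimates d s)) (η : ℝ) (t : ℕ) :
    Procedure d (s + 1 + s) n (Matrix (Fin t → Fin d) (Fin t → Fin d) ℂ) where
  Out := T.Out
  povm := T.povm
  result := fun o => reconstruct Z Y X η t (T.result o)

/-! ### The quantities in the guarantee -/

/-- `σ_m(Ω)`, the smallest nonzero singular value of `Ω`, restricted to blocks of `s` sites on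
either side of the cut, where `m` is the rank of `Ω` (`singularValues` is indexed from zero and
decreasing). -/
def sigmaMin {d s : ℕ} {A : StarSubalgebra ℂ (Matrix (Fin d) (Fin d) ℂ)} {κ ι : Type}
    [Fintype κ] [Fintype ι] [DecidableEq ι]
    (Y : κ → Matrix (Fin s → Fin d) (Fin s → Fin d) ℂ)
    (X : ι → Matrix (Fin s → Fin d) (Fin s → Fin d) ℂ) (ω : TIState A) : ℝ :=
  (Matrix.toEuclideanLin (omegaMat Y X (ω.density (s + s)))).singularValues (ω.rank - 1)

/-- The trace distance between the functionals with densities `M` and `M'` on the algebra of `t`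
sites: one half of the norm dual to the operator norm. -/
def traceDist {d t : ℕ} (A : StarSubalgebra ℂ (Matrix (Fin d) (Fin d) ℂ))
    (M M' : Matrix (Fin t → Fin d) (Fin t → Fin d) ℂ) : ℝ :=
  (1 / 2) * sSup {r : ℝ | ∃ B ∈ blockAlg A t,
    ‖Matrix.toEuclideanCLM (𝕜 := ℂ) B‖ ≤ 1 ∧ r = ‖((M - M') * B).trace‖}

end FCS

end

/-! Send an observable `V` of a right block to its memory vector `q(V) = Uᴴ (ω(Y_j ⊗ V))_j`, where
`U` holds the retained left singular vectors of the estimated matrix. If `Uᴴ Ω` has a right inverse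
`R` and `U` has exactly `m` columns, `q` identifies the space of left functionals with `ℂ^m`, so `V`
enters every correlation only through `q(V)` (`eval_join_congr`). Hence the exact operators `K_k =
Uᴴ Ω_{Z_k} R` satisfy `q(Z_k ⊗ V) = K_k q(V)`, and with the row `τΩ R` and the column `Uᴴ Ω(1)` they
reproduce `ω` (`implementsShift_memDensity`, `sum_smul_memDensity_eq`, `sum_smul_rowDensity_eq`).
The output of the algorithm is a perturbation of this realization in the same coordinates, so
singular vectors never have to be aligned.

That `U` has `m` columns and that `R` exists is singular value perturbation (`truncU_spec`): the
singular values of the estimate are below `η` or at least `3σ/4`. This also bounds `R` and its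
distance to the pseudoinverse used by the algorithm.

The main point is that errors must not grow exponentially in `t`. A row `Φ` of functionals is
measured by the norm of `∑ Φ_j ⊗ q_j` with arbitrarily many further sites on the right
(`JointlyBounded`). Appending a site with the exact `K` only regroups sites and keeps the bound
(`JointlyBounded.appendSite_shift`); the exact row starts at `1` because it yields the state itself.
An error `D` in the operators multiplies the norm by at most `Δ = √d ‖D‖ √m ‖R‖`, with `‖D‖`
Hilbert–Schmidt, because each unit vector of the memory is `q(L)` for an observable `L` of
controlled norm (`JointlyBounded.appendSite_le`). The total error is `(1 + x)(1 + Δ)^t (1 + y) - 1`,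
with `x`, `y` from the row and the column (`norm_trace_rowDensity_sub_le`).

The factor `√d` comes from contracting one site with an orthonormal basis
(`norm_trace_site_memDensity_le`), and `√m ≤ d_B` from the realization
(`CStarRealization.finite_and_rank_le`). The chosen precision makes `x + tΔ + y ≤ 7ε/10`. -/

noncomputable section
namespace FCS

/-! ### Operator norm, Hilbert–Schmidt norm and density matrices -/

section Norms
open scoped Matrix.Norms.L2Operator MatrixOrder

variable {ι κ l : Type*} [Fintype ι] [Fintype κ] [Fintype l]

lemma hsNorm_nonneg (M : Matrix ι κ ℂ) : 0 ≤ hsNorm M := Real.sqrt_nonneg _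

lemma hsNorm_sq (M : Matrix ι κ ℂ) : hsNorm M ^ 2 = ∑ i, ∑ j, ‖M i j‖ ^ 2 :=
  Real.sq_sqrt (Finset.sum_nonneg fun _ _ => Finset.sum_nonneg fun _ _ => sq_nonneg _)

lemma hsNorm_eq_norm (M : Matrix ι κ ℂ) :
    hsNorm M = ‖(WithLp.toLp 2 (fun x : ι × κ => M x.1 x.2) : EuclideanSpace ℂ (ι × κ))‖ := by
  rw [EuclideanSpace.norm_eq, hsNorm, Fintype.sum_prod_type]

lemma hsNorm_le_of_sq {M : Matrix ι κ ℂ} {c : ℝ} (hc : 0 ≤ c)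
    (h : ∑ i, ∑ j, ‖M i j‖ ^ 2 ≤ c ^ 2) : hsNorm M ≤ c := by
  rw [← hsNorm_sq] at h
  exact le_of_sq_le_sq h hc

lemma hsNorm_add_le (M N : Matrix ι κ ℂ) : hsNorm (M + N) ≤ hsNorm M + hsNorm N := by
  simp only [hsNorm_eq_norm]
  exact norm_add_le (WithLp.toLp 2 fun x : ι × κ => M x.1 x.2 : EuclideanSpace ℂ (ι × κ))
    (WithLp.toLp 2 fun x : ι × κ => N x.1 x.2)

lemma hsNorm_conjTranspose (M : Matrix ι κ ℂ) : hsNorm Mᴴ = hsNorm M := by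
  simp only [hsNorm, Matrix.conjTranspose_apply, norm_star]
  rw [Finset.sum_comm]

lemma sum_sq_mulVec_le [DecidableEq κ] (A : Matrix ι κ ℂ) (v : κ → ℂ) :
    ∑ i, ‖(A *ᵥ v) i‖ ^ 2 ≤ ‖A‖ ^ 2 * ∑ j, ‖v j‖ ^ 2 := by
  have h := A.l2_opNorm_mulVec (WithLp.toLp 2 v)
  have h2 := pow_le_pow_left₀ (norm_nonneg _) h 2
  rw [mul_pow, EuclideanSpace.norm_sq_eq, EuclideanSpace.norm_sq_eq] at h2
  exact h2

lemma opNorm_le_of_sum_sq [DecidableEq κ] {A : Matrix ι κ ℂ} {c : ℝ} (hc : 0 ≤ c)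
    (h : ∀ v : κ → ℂ, ∑ i, ‖(A *ᵥ v) i‖ ^ 2 ≤ c ^ 2 * ∑ j, ‖v j‖ ^ 2) : ‖A‖ ≤ c := by
  rw [Matrix.l2_opNorm_def]
  refine ContinuousLinearMap.opNorm_le_bound _ hc fun x => ?_
  refine le_of_sq_le_sq ?_ (by positivity)
  rw [mul_pow, EuclideanSpace.norm_sq_eq, EuclideanSpace.norm_sq_eq]
  exact h x

lemma hsNorm_mul_le_left [DecidableEq κ] (A : Matrix ι κ ℂ) (B : Matrix κ l ℂ) :
    hsNorm (A * B) ≤ ‖A‖ * hsNorm B := by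
  refine hsNorm_le_of_sq (mul_nonneg (norm_nonneg _) (hsNorm_nonneg _)) ?_
  rw [mul_pow, hsNorm_sq, Finset.sum_comm, Finset.sum_comm (f := fun i j => ‖B i j‖ ^ 2),
    Finset.mul_sum]
  exact Finset.sum_le_sum fun j _ => sum_sq_mulVec_le A fun i => B i j

lemma hsNorm_mul_le_right [DecidableEq κ] [DecidableEq l] (A : Matrix ι κ ℂ) (B : Matrix κ l ℂ) :
    hsNorm (A * B) ≤ hsNorm A * ‖B‖ := by
  rw [← hsNorm_conjTranspose, Matrix.conjTranspose_mul, mul_comm, ← hsNorm_conjTranspose A,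
    ← Matrix.l2_opNorm_conjTranspose B]
  exact hsNorm_mul_le_left _ _

lemma sum_mul_sq_le (u v : ι → ℂ) :
    ‖∑ i, u i * v i‖ ^ 2 ≤ (∑ i, ‖u i‖ ^ 2) * ∑ i, ‖v i‖ ^ 2 := by
  refine (pow_le_pow_left₀ (norm_nonneg _) (norm_sum_le _ _) 2).trans ?_
  simp only [norm_mul]
  exact Finset.sum_mul_sq_le_sq_mul_sq _ _ _

lemma opNorm_le_hsNorm [DecidableEq κ] (A : Matrix ι κ ℂ) : ‖A‖ ≤ hsNorm A := by
  refine opNorm_le_of_sum_sq (hsNorm_nonneg _) fun v => ?_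
  rw [hsNorm_sq, Finset.sum_mul]
  exact Finset.sum_le_sum fun i _ => sum_mul_sq_le (fun j => A i j) v

lemma norm_trace_mul_le (A : Matrix ι κ ℂ) (B : Matrix κ ι ℂ) :
    ‖(A * B).trace‖ ≤ hsNorm A * hsNorm B := by
  refine le_of_sq_le_sq ?_ (mul_nonneg (hsNorm_nonneg _) (hsNorm_nonneg _))
  have h := sum_mul_sq_le (fun x : ι × κ => A x.1 x.2) (fun x => B x.2 x.1)
  rw [mul_pow, hsNorm_sq, hsNorm_sq, Finset.sum_comm (f := fun i j => ‖B i j‖ ^ 2)]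
  simpa only [Fintype.sum_prod_type, Matrix.trace, Matrix.diag, Matrix.mul_apply] using h

/-- `√card` bounds the ratio of the Hilbert-Schmidt and the operator norm. -/
lemma hsNorm_le_sqrt_card [DecidableEq κ] (A : Matrix ι κ ℂ) :
    hsNorm A ≤ Real.sqrt (Fintype.card κ) * ‖A‖ := by
  have h := hsNorm_mul_le_left A (1 : Matrix κ κ ℂ)
  have h1 : hsNorm (1 : Matrix κ κ ℂ) = Real.sqrt (Fintype.card κ) := by
    rw [hsNorm]
    congr 1
    simp [Matrix.one_apply, apply_ite]
  rwa [Matrix.mul_one, h1, mul_comm] at h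

/-- Self-duality of `ℓ²`: testing on `u = star v` gives `S ≤ c √S` for the sum of squares `S`, and
`√S` is cancelled. -/
lemma sum_sq_le_of_forall {v : ι → ℂ} {c : ℝ}
    (h : ∀ u : ι → ℂ, ‖∑ i, u i * v i‖ ≤ c * Real.sqrt (∑ i, ‖u i‖ ^ 2)) :
    ∑ i, ‖v i‖ ^ 2 ≤ c ^ 2 := by
  set S := ∑ i, ‖v i‖ ^ 2 with hS
  have hS0 : 0 ≤ S := Finset.sum_nonneg fun _ _ => sq_nonneg _
  have h1 := h fun i => star (v i)
  have h2 : ∑ i, star (v i) * v i = (S : ℂ) := by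
    rw [hS]; push_cast
    exact Finset.sum_congr rfl fun i _ => by
      rw [← Complex.conj_mul']; rfl
  rw [h2] at h1
  simp only [norm_star, Complex.norm_real, Real.norm_of_nonneg hS0] at h1
  rw [← hS] at h1
  rcases hS0.eq_or_lt with h0 | h0
  · rw [← h0]; positivity
  · have h3 : 0 < Real.sqrt S := Real.sqrt_pos.2 h0
    have h4 : Real.sqrt S ≤ c := by
      have : Real.sqrt S * Real.sqrt S ≤ c * Real.sqrt S := by rwa [Real.mul_self_sqrt hS0]
      exact le_of_mul_le_mul_right this h3
    calc S = Real.sqrt S ^ 2 := (Real.sq_sqrt hS0).symm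
      _ ≤ c ^ 2 := pow_le_pow_left₀ h3.le h4 2

lemma opNorm_submatrix_equiv_le [DecidableEq ι] [DecidableEq κ] (e : κ ≃ ι) (M : Matrix ι ι ℂ) :
    ‖M.submatrix e e‖ ≤ ‖M‖ := by
  refine opNorm_le_of_sum_sq (norm_nonneg _) fun v => ?_
  have h := sum_sq_mulVec_le M (v ∘ e.symm)
  rw [← e.sum_comp, ← e.sum_comp] at h
  refine le_trans (le_of_eq ?_) (h.trans (le_of_eq ?_))
  · refine Finset.sum_congr rfl fun i _ => ?_
    congr 2
    simp only [Matrix.mulVec, dotProduct]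
    rw [← e.sum_comp]
    simp
  · simp

lemma opNorm_submatrix_equiv [DecidableEq ι] [DecidableEq κ] (e : κ ≃ ι) (M : Matrix ι ι ℂ) :
    ‖M.submatrix e e‖ = ‖M‖ := by
  refine le_antisymm (opNorm_submatrix_equiv_le e M) ?_
  simpa using opNorm_submatrix_equiv_le e.symm (M.submatrix e e)

lemma opNorm_kronecker_one_le [DecidableEq ι] [DecidableEq κ] (A : Matrix ι ι ℂ) :
    ‖A ⊗ₖ (1 : Matrix κ κ ℂ)‖ ≤ ‖A‖ := by
  refine opNorm_le_of_sum_sq (norm_nonneg _) fun v => ?_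
  rw [Fintype.sum_prod_type_right, Fintype.sum_prod_type_right, Finset.mul_sum]
  refine Finset.sum_le_sum fun y _ => ?_
  refine le_trans (le_of_eq ?_) (sum_sq_mulVec_le A fun x => v (x, y))
  refine Finset.sum_congr rfl fun i _ => ?_
  congr 2
  simp [Matrix.mulVec, dotProduct, Fintype.sum_prod_type, Matrix.one_apply]

lemma opNorm_one_kronecker_le [DecidableEq ι] [DecidableEq κ] (A : Matrix ι ι ℂ) :
    ‖(1 : Matrix κ κ ℂ) ⊗ₖ A‖ ≤ ‖A‖ := by
  refine opNorm_le_of_sum_sq (norm_nonneg _) fun v => ?_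
  rw [Fintype.sum_prod_type, Fintype.sum_prod_type, Finset.mul_sum]
  refine Finset.sum_le_sum fun y _ => ?_
  refine le_trans (le_of_eq ?_) (sum_sq_mulVec_le A fun x => v (y, x))
  refine Finset.sum_congr rfl fun i _ => ?_
  congr 2
  simp [Matrix.mulVec, dotProduct, Fintype.sum_prod_type, Matrix.one_apply]

lemma opNorm_kronecker_le [DecidableEq ι] [DecidableEq κ] (A : Matrix ι ι ℂ) (B : Matrix κ κ ℂ) :
    ‖A ⊗ₖ B‖ ≤ ‖A‖ * ‖B‖ := by
  have h : A ⊗ₖ B = (A ⊗ₖ (1 : Matrix κ κ ℂ)) * ((1 : Matrix ι ι ℂ) ⊗ₖ B) := by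
    rw [← Matrix.mul_kronecker_mul, mul_one, one_mul]
  rw [h]
  exact (Matrix.l2_opNorm_mul _ _).trans (mul_le_mul (opNorm_kronecker_one_le A)
    (opNorm_one_kronecker_le B) (norm_nonneg _) (norm_nonneg _))

/-- Bessel's inequality in the Hilbert-Schmidt inner product. -/
lemma sum_sq_trace_le [DecidableEq l] {B : l → Matrix ι ι ℂ}
    (hB : ∀ i j, ((B i)ᴴ * B j).trace = if i = j then 1 else 0) (W : Matrix ι ι ℂ) :
    ∑ a, ‖((B a)ᴴ * W).trace‖ ^ 2 ≤ ∑ i, ∑ j, ‖W i j‖ ^ 2 := by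
  classical
  let vec : Matrix ι ι ℂ → EuclideanSpace ℂ (ι × ι) := fun M => WithLp.toLp 2 fun x => M x.1 x.2
  have hin : ∀ M N : Matrix ι ι ℂ, inner ℂ (vec M) (vec N) = (Mᴴ * N).trace := by
    intro M N
    simp only [vec, PiLp.inner_apply, RCLike.inner_apply, Matrix.trace, Matrix.diag,
      Matrix.mul_apply, Matrix.conjTranspose_apply]
    rw [Fintype.sum_prod_type, Finset.sum_comm]
    exact Finset.sum_congr rfl fun i _ => Finset.sum_congr rfl fun j _ => mul_comm _ _
  have ho : Orthonormal ℂ fun a => vec (B a) := by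
    rw [orthonormal_iff_ite]
    intro i j
    rw [hin, hB]
  have h := ho.sum_inner_products_le (vec W) (s := Finset.univ)
  simp only [hin] at h
  rwa [← hsNorm_eq_norm, hsNorm_sq] at h

lemma hsNorm_sum_smul_sq [DecidableEq l] {B : l → Matrix ι ι ℂ}
    (hB : ∀ i j, ((B i)ᴴ * B j).trace = if i = j then 1 else 0) (u : l → ℂ) :
    hsNorm (∑ a, u a • B a) ^ 2 = ∑ a, ‖u a‖ ^ 2 := by
  have h : ∀ M : Matrix ι ι ℂ, ((hsNorm M ^ 2 : ℝ) : ℂ) = (Mᴴ * M).trace := by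
    intro M
    rw [hsNorm_sq, Finset.sum_comm]
    push_cast
    simp only [Matrix.trace, Matrix.diag, Matrix.mul_apply, Matrix.conjTranspose_apply]
    exact Finset.sum_congr rfl fun i _ => Finset.sum_congr rfl fun j _ => by
      rw [← Complex.conj_mul']; rfl
  apply Complex.ofReal_injective
  rw [h, Matrix.conjTranspose_sum, Finset.sum_mul, Matrix.trace_sum]
  push_cast
  refine Finset.sum_congr rfl fun i _ => ?_
  rw [Finset.mul_sum, Matrix.trace_sum, Finset.sum_eq_single i]
  · rw [Matrix.conjTranspose_smul, Matrix.smul_mul, Matrix.mul_smul, Matrix.trace_smul,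
      Matrix.trace_smul, hB, if_pos rfl, smul_eq_mul, smul_eq_mul, mul_one, ← Complex.conj_mul']
    rfl
  · intro j _ hj
    rw [Matrix.conjTranspose_smul, Matrix.smul_mul, Matrix.mul_smul, Matrix.trace_smul,
      Matrix.trace_smul, hB, if_neg hj.symm, smul_zero, smul_zero]
  · simp

/-- A density matrix has a square-root factor of unit Hilbert-Schmidt norm. -/
lemma exists_factor_of_density [DecidableEq ι] {W : Matrix ι ι ℂ} (hW : W.PosSemidef)
    (ht : W.trace = 1) : ∃ B : Matrix ι ι ℂ, W = Bᴴ * B ∧ hsNorm B = 1 := by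
  obtain ⟨B, hB⟩ := CStarAlgebra.nonneg_iff_eq_star_mul_self.mp hW.nonneg
  refine ⟨B, hB, ?_⟩
  have h : ((hsNorm B ^ 2 : ℝ) : ℂ) = (Bᴴ * B).trace := by
    rw [hsNorm_sq, Finset.sum_comm]
    push_cast
    simp only [Matrix.trace, Matrix.diag, Matrix.mul_apply, Matrix.conjTranspose_apply]
    exact Finset.sum_congr rfl fun i _ => Finset.sum_congr rfl fun j _ => by
      rw [← Complex.conj_mul']; rfl
  have h2 : (Bᴴ * B).trace = 1 := by rw [← ht, hB]; rfl
  rw [h2] at h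
  have h3 : hsNorm B ^ 2 = 1 := by exact_mod_cast h
  exact (sq_eq_sq₀ (hsNorm_nonneg B) zero_le_one).mp (by rw [h3, one_pow])

lemma hsNorm_le_one_of_density {W : Matrix ι ι ℂ} (hW : W.PosSemidef)
    (ht : W.trace = 1) : hsNorm W ≤ 1 := by
  classical
  obtain ⟨B, hB, h1⟩ := exists_factor_of_density hW ht
  rw [hB]
  calc hsNorm (Bᴴ * B) ≤ ‖Bᴴ‖ * hsNorm B := hsNorm_mul_le_left Bᴴ B
    _ ≤ hsNorm Bᴴ * hsNorm B := 
      mul_le_mul_of_nonneg_right (opNorm_le_hsNorm _) (hsNorm_nonneg _)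
    _ = 1 := by rw [hsNorm_conjTranspose, h1, mul_one]

/-- Write `W = Bᴴ B` and apply Cauchy–Schwarz to `Bᴴ` and `B X`, whose Hilbert–Schmidt norms are `1`
and at most `‖X‖`. -/
lemma norm_trace_density_mul_le [DecidableEq ι] {W : Matrix ι ι ℂ} (hW : W.PosSemidef)
    (ht : W.trace = 1) (X : Matrix ι ι ℂ) : ‖(W * X).trace‖ ≤ ‖X‖ := by
  obtain ⟨B, hB, h1⟩ := exists_factor_of_density hW ht
  rw [hB, Matrix.mul_assoc]
  calc ‖(Bᴴ * (B * X)).trace‖ ≤ hsNorm Bᴴ * hsNorm (B * X) := norm_trace_mul_le _ _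
    _ ≤ hsNorm Bᴴ * (hsNorm B * ‖X‖) := 
      mul_le_mul_of_nonneg_left (hsNorm_mul_le_right _ _) (hsNorm_nonneg _)
    _ = ‖X‖ := by rw [hsNorm_conjTranspose, h1]; ring

end Norms

/-! ### Stability of matrix product functionals -/

section Stability
open scoped Matrix.Norms.L2Operator

section PartialTrace
variable {η γ : Type*} [Fintype η] [Fintype γ]

/-- The partial trace of `(1 ⊗ F) X` over the second factor. -/
def weightedPartialTrace (F : Matrix γ γ ℂ) (X : Matrix (η × γ) (η × γ) ℂ) : Matrix η η ℂ :=
  Matrix.of fun h h' => ∑ c, ∑ c', F c c' * X (h, c') (h', c)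

lemma trace_kronecker_mul (Φ : Matrix η η ℂ) (F : Matrix γ γ ℂ) (X : Matrix (η × γ) (η × γ) ℂ) :
    ((Φ ⊗ₖ F) * X).trace = (Φ * weightedPartialTrace F X).trace := by
  simp only [Matrix.trace, Matrix.diag, Matrix.mul_apply, weightedPartialTrace, Matrix.of_apply,
    Matrix.kroneckerMap_apply, Fintype.sum_prod_type, Finset.mul_sum]
  refine Finset.sum_congr rfl fun h _ => ?_
  rw [Finset.sum_comm]
  refine Finset.sum_congr rfl fun h' _ => Finset.sum_congr rfl fun c _ =>
    Finset.sum_congr rfl fun c' _ => ?_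
  ring

/-- Slicing by a functional of norm `τ` costs no dimension factor: pairing the slice with vectors
`u` and `v` evaluates the functional at the matrix `S` obtained by compressing `X` with `u` and `v`
in the first factor, and `‖S‖ ≤ ‖u‖ ‖X‖ ‖v‖`. -/
lemma opNorm_weightedPartialTrace_le [DecidableEq η] [DecidableEq γ] {F : Matrix γ γ ℂ} {τ : ℝ}
    (hτ : 0 ≤ τ) (hF : ∀ S : Matrix γ γ ℂ, ‖(F * S).trace‖ ≤ τ * ‖S‖)
    (X : Matrix (η × γ) (η × γ) ℂ) : ‖weightedPartialTrace F X‖ ≤ τ * ‖X‖ := by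
  refine opNorm_le_of_sum_sq (by positivity) fun v => ?_
  have hv : 0 ≤ ∑ j, ‖v j‖ ^ 2 := Finset.sum_nonneg fun _ _ => sq_nonneg _
  rw [← Real.sq_sqrt hv, ← mul_pow]
  refine sum_sq_le_of_forall fun u => ?_
  have hu : 0 ≤ ∑ j, ‖u j‖ ^ 2 := Finset.sum_nonneg fun _ _ => sq_nonneg _
  let S : Matrix γ γ ℂ := Matrix.of fun c' c => ∑ h, u h * ∑ h', X (h, c') (h', c) * v h'
  have hS : ∑ h, u h * (weightedPartialTrace F X *ᵥ v) h = (F * S).trace := by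
    simp only [Matrix.mulVec, dotProduct, weightedPartialTrace, Matrix.of_apply, Matrix.trace,
      Matrix.diag, Matrix.mul_apply, S, Finset.mul_sum, Finset.sum_mul]
    calc _ = ∑ h, ∑ c, ∑ h', ∑ c', u h * (F c c' * X (h, c') (h', c) * v h') :=
          Finset.sum_congr rfl fun h _ => Finset.sum_comm
      _ = ∑ c, ∑ h, ∑ h', ∑ c', u h * (F c c' * X (h, c') (h', c) * v h') := Finset.sum_comm
      _ = _ := by
        refine Finset.sum_congr rfl fun c _ => ?_
        calc _ = ∑ h, ∑ c', ∑ h', u h * (F c c' * X (h, c') (h', c) * v h') :=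
              Finset.sum_congr rfl fun h _ => Finset.sum_comm
          _ = ∑ c', ∑ h, ∑ h', u h * (F c c' * X (h, c') (h', c) * v h') := Finset.sum_comm
          _ = _ := Finset.sum_congr rfl fun c' _ => Finset.sum_congr rfl fun h _ =>
            Finset.sum_congr rfl fun h' _ => by ring
  have hSn : ‖S‖ ≤ Real.sqrt (∑ j, ‖u j‖ ^ 2) * (‖X‖ * Real.sqrt (∑ j, ‖v j‖ ^ 2)) := by
    refine opNorm_le_of_sum_sq (by positivity) fun w => ?_
    rw [mul_pow, mul_pow, Real.sq_sqrt hu, Real.sq_sqrt hv]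
    have h1 := sum_sq_mulVec_le X fun x => v x.1 * w x.2
    -- `S w` is `X` applied to the product vector `v ⊗ w`, contracted with `u`.
    have h2 : ∀ c', (S *ᵥ w) c' = ∑ h, u h * (X *ᵥ fun x => v x.1 * w x.2) (h, c') := by
      intro c'
      simp only [Matrix.mulVec, dotProduct, S, Matrix.of_apply, Fintype.sum_prod_type,
        Finset.mul_sum, Finset.sum_mul]
      rw [Finset.sum_comm]
      refine Finset.sum_congr rfl fun h _ => ?_
      rw [Finset.sum_comm]
      refine Finset.sum_congr rfl fun h _ => Finset.sum_congr rfl fun c _ => by ring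
    calc ∑ c', ‖(S *ᵥ w) c'‖ ^ 2
        ≤ ∑ c', (∑ j, ‖u j‖ ^ 2) * ∑ h, ‖(X *ᵥ fun x => v x.1 * w x.2) (h, c')‖ ^ 2 :=
          Finset.sum_le_sum fun c' _ => by rw [h2]; exact sum_mul_sq_le _ _
      _ = (∑ j, ‖u j‖ ^ 2) * ∑ y, ‖(X *ᵥ fun x => v x.1 * w x.2) y‖ ^ 2 := by
          rw [← Finset.mul_sum, Fintype.sum_prod_type_right]
      _ ≤ (∑ j, ‖u j‖ ^ 2) * (‖X‖ ^ 2 * ∑ y : η × γ, ‖v y.1 * w y.2‖ ^ 2) := by gcongr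
      _ = _ := by
          simp only [norm_mul, mul_pow, Fintype.sum_prod_type, ← Finset.mul_sum,
            ← Finset.sum_mul]
          ring
  rw [hS]
  calc ‖(F * S).trace‖ ≤ τ * ‖S‖ := hF S
    _ ≤ τ * (Real.sqrt (∑ j, ‖u j‖ ^ 2) * (‖X‖ * Real.sqrt (∑ j, ‖v j‖ ^ 2))) := by gcongr
    _ = _ := by ring

lemma trace_submatrix_mul (e : η ≃ γ) (M : Matrix γ γ ℂ) (X : Matrix η η ℂ) :
    (M.submatrix e e * X).trace = (M * X.submatrix e.symm e.symm).trace := by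
  simp only [Matrix.trace, Matrix.diag, Matrix.mul_apply, Matrix.submatrix_apply]
  rw [← e.sum_comp]
  refine Finset.sum_congr rfl fun i _ => ?_
  rw [← e.sum_comp]
  simp

end PartialTrace

variable {d : ℕ} {ζ μ : Type*} [Fintype ζ] [Fintype μ]

/-- One step of the recursion defining a matrix product functional: a site is appended on the
right. -/
def appendSite (Z : ζ → Matrix (Fin d) (Fin d) ℂ) (K : ζ → Matrix μ μ ℂ) {l : ℕ}
    (Φ : μ → Matrix (Fin l → Fin d) (Fin l → Fin d) ℂ) :
    μ → Matrix (Fin (l + 1) → Fin d) (Fin (l + 1) → Fin d) ℂ :=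
  fun j => Matrix.of fun f f' =>
    ∑ i, Φ i (Fin.init f) (Fin.init f') * ∑ k, K k i j * Z k (f (Fin.last l)) (f' (Fin.last l))

/-- The densities of the components of the row vector of functionals
`Z_{k₁} ⊗ ⋯ ⊗ Z_{kₗ} ↦ r K_{k₁} ⋯ K_{kₗ}`. -/
def rowDensity (Z : ζ → Matrix (Fin d) (Fin d) ℂ) (K : ζ → Matrix μ μ ℂ) (r : μ → ℂ) :
    (l : ℕ) → μ → Matrix (Fin l → Fin d) (Fin l → Fin d) ℂ
  | 0 => fun i => Matrix.of fun _ _ => r i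
  | l + 1 => appendSite Z K (rowDensity Z K r l)

/-- The recursion carries the error estimates, the sum over words is what the algorithm outputs; the
induction peels off the last letter. -/
lemma rowDensity_eq_sum [DecidableEq μ] (Z : ζ → Matrix (Fin d) (Fin d) ℂ) (K : ζ → Matrix μ μ ℂ)
    (r : μ → ℂ) (l : ℕ) (j : μ) :
    rowDensity Z K r l j = ∑ k : Fin l → ζ,
      (r ᵥ* (List.ofFn fun i => K (k i)).prod) j • piKron fun i => Z (k i) := by
  induction l generalizing j with
  | zero =>
    ext f f'
    simp [rowDensity, piKron]
  | succ l ih =>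
    ext f f'
    rw [← (Fin.snocEquiv fun _ => ζ).sum_comp]
    simp only [Fin.snocEquiv, Equiv.coe_fn_mk, Fintype.sum_prod_type, Matrix.sum_apply,
      Matrix.smul_apply, piKron, Matrix.of_apply, Fin.prod_univ_castSucc, Fin.snoc_castSucc,
      Fin.snoc_last, List.ofFn_succ', List.prod_concat, smul_eq_mul]
    simp only [rowDensity, appendSite, ih, Matrix.of_apply, Matrix.sum_apply, Matrix.smul_apply,
      piKron, smul_eq_mul, ← Matrix.vecMul_vecMul]
    simp only [Matrix.vecMul, dotProduct, Finset.mul_sum, Finset.sum_mul]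
    simp only [Fin.init]
    rw [Finset.sum_comm]
    refine Finset.sum_congr rfl fun k _ => ?_
    rw [Finset.sum_comm]
    refine Finset.sum_congr rfl fun k' _ => ?_
    refine Finset.sum_congr rfl fun i _ => ?_
    refine Finset.sum_congr rfl fun i _ => ?_
    ring

/-- Splitting a configuration of `l + 1` and `b` sites as `l`, `1` and `b` sites. -/
def splitLast (d l b : ℕ) :
    (Fin (l + 1) → Fin d) × (Fin b → Fin d) ≃ (Fin l → Fin d) × (Fin d × (Fin b → Fin d)) where
  toFun x := (Fin.init x.1, (x.1 (Fin.last l), x.2))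
  invFun y := (Fin.snoc y.1 y.2.1, y.2.2)
  left_inv x := by simp
  right_inv y := by simp

variable (Z : ζ → Matrix (Fin d) (Fin d) ℂ)
  (Q : (b : ℕ) → μ → Matrix (Fin b → Fin d) (Fin b → Fin d) ℂ)

/-- The functionals with densities `∑ j, Φ j ⊗ Q b j` are bounded by `c` for all `b`. -/
def JointlyBounded {l : ℕ} (Φ : μ → Matrix (Fin l → Fin d) (Fin l → Fin d) ℂ) (c : ℝ) : Prop :=
  ∀ (b : ℕ) (X : Matrix ((Fin l → Fin d) × (Fin b → Fin d)) ((Fin l → Fin d) × (Fin b → Fin d)) ℂ),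
    ‖((∑ j, Φ j ⊗ₖ Q b j) * X).trace‖ ≤ c * ‖X‖

variable {Q} in
lemma JointlyBounded.add {l : ℕ} {Φ Ψ : μ → Matrix (Fin l → Fin d) (Fin l → Fin d) ℂ} {c c' : ℝ}
    (h : JointlyBounded Q Φ c) (h' : JointlyBounded Q Ψ c') :
    JointlyBounded Q (Φ + Ψ) (c + c') := by
  intro b X
  simp only [Pi.add_apply, Matrix.add_kronecker, Finset.sum_add_distrib,
    Matrix.trace_add, add_mul]
  exact (norm_add_le _ _).trans (add_le_add (h b X) (h' b X))

/-- Regroups the new site with the `b` sites to its right, so that the step acts on the right factor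
and leaves `Φ` alone. Exact and perturbed steps both start here. -/
lemma sum_appendSite_kronecker (D : ζ → Matrix μ μ ℂ) {l : ℕ}
    (Φ : μ → Matrix (Fin l → Fin d) (Fin l → Fin d) ℂ) (b : ℕ) :
    ∑ j, appendSite Z D Φ j ⊗ₖ Q b j =
      (∑ i, Φ i ⊗ₖ ∑ k, ∑ j, D k i j • (Z k ⊗ₖ Q b j)).submatrix (splitLast d l b)
        (splitLast d l b) := by
  ext ⟨f, g⟩ ⟨f', g'⟩
  simp only [Matrix.sum_apply, Matrix.kroneckerMap_apply, appendSite, Matrix.of_apply,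
    Matrix.submatrix_apply, splitLast, Equiv.coe_fn_mk, Matrix.smul_apply, smul_eq_mul,
    Finset.sum_mul, Finset.mul_sum]
  rw [Finset.sum_comm]
  refine Finset.sum_congr rfl fun i _ => ?_
  rw [Finset.sum_comm]
  refine Finset.sum_congr rfl fun k _ => Finset.sum_congr rfl fun j _ => ?_
  ring

variable {Z Q}

/-- The operators `K` implement the shift on the functionals with densities `Q`. -/
def ImplementsShift (Z : ζ → Matrix (Fin d) (Fin d) ℂ)
    (Q : (b : ℕ) → μ → Matrix (Fin b → Fin d) (Fin b → Fin d) ℂ) (K : ζ → Matrix μ μ ℂ) : Prop :=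
  ∀ (b : ℕ) (i : μ), ∑ k, ∑ j, K k i j • (Z k ⊗ₖ Q b j) =
    (Q (b + 1) i).submatrix (fun x => Fin.cons x.1 x.2) (fun x => Fin.cons x.1 x.2)

/-- Exact operators cost nothing: by the shift relation the new functional is the old one with `b +
1` sites on the right. This is why the bound is demanded for all `b` with the same constant. -/
lemma JointlyBounded.appendSite_shift {K : ζ → Matrix μ μ ℂ} (hK : ImplementsShift Z Q K) {l : ℕ}
    {Φ : μ → Matrix (Fin l → Fin d) (Fin l → Fin d) ℂ} {c : ℝ} (h : JointlyBounded Q Φ c) :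
    JointlyBounded Q (appendSite Z K Φ) c := by
  intro b X
  let e := (splitLast d l b).trans ((Equiv.refl _).prodCongr (Fin.consEquiv fun _ => Fin d))
  have h1 : ∑ j, appendSite Z K Φ j ⊗ₖ Q b j = (∑ i, Φ i ⊗ₖ Q (b + 1) i).submatrix e e := by
    rw [sum_appendSite_kronecker]
    ext x y
    simp only [hK b, Matrix.submatrix_apply, Matrix.sum_apply, Matrix.kroneckerMap_apply]
    rfl
  rw [h1, trace_submatrix_mul, ← opNorm_submatrix_equiv e.symm X]
  exact h _ _

/-- Bound for a perturbation of the operators of a matrix product functional. -/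
lemma JointlyBounded.appendSite_le [DecidableEq μ] {s : ℕ}
    {L : μ → Matrix (Fin s → Fin d) (Fin s → Fin d) ℂ}
    (hL : ∀ i j, (Q s i * L j).trace = if i = j then 1 else 0) {a : ℝ} (ha : 0 ≤ a)
    (hF : ∀ (b : ℕ) (D : ζ → μ → ℂ) (S : Matrix (Fin d × (Fin b → Fin d))
      (Fin d × (Fin b → Fin d)) ℂ), ‖((∑ k, ∑ j, D k j • (Z k ⊗ₖ Q b j)) * S).trace‖ ≤
        a * Real.sqrt (∑ k, ∑ j, ‖D k j‖ ^ 2) * ‖S‖)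
    (D : ζ → Matrix μ μ ℂ) {l : ℕ} {Φ : μ → Matrix (Fin l → Fin d) (Fin l → Fin d) ℂ} {c : ℝ}
    (hc : 0 ≤ c) (h : JointlyBounded Q Φ c) :
    JointlyBounded Q (appendSite Z D Φ)
      (c * (a * Real.sqrt (∑ i, ∑ k, ∑ j, ‖D k i j‖ ^ 2) * Real.sqrt (∑ i, ‖L i‖ ^ 2))) := by
  intro b X
  set X' := X.submatrix (splitLast d l b).symm (splitLast d l b).symm with hX'
  have hn : ‖X'‖ = ‖X‖ := opNorm_submatrix_equiv _ _
  set F : μ → Matrix (Fin d × (Fin b → Fin d)) (Fin d × (Fin b → Fin d)) ℂ :=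
    fun i => ∑ k, ∑ j, D k i j • (Z k ⊗ₖ Q b j) with hFdef
  set τ : μ → ℝ := fun i => Real.sqrt (∑ k, ∑ j, ‖D k i j‖ ^ 2) with hτ
  have hy : ∀ i, ‖weightedPartialTrace (F i) X'‖ ≤ a * τ i * ‖X‖ := fun i => by
    rw [← hn]
    exact opNorm_weightedPartialTrace_le (by positivity) (hF b fun k => D k i) X'
  -- As `L` is dual to `Q s`, the memory index can be carried by the observable `L i` on `s` sites;
  -- only the terms `i = j` survive, and the hypothesis on `Φ` applies with `b = s`.
  have h1 : ((∑ j, appendSite Z D Φ j ⊗ₖ Q b j) * X).trace =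
      ((∑ j, Φ j ⊗ₖ Q s j) * ∑ i, weightedPartialTrace (F i) X' ⊗ₖ L i).trace := by
    rw [sum_appendSite_kronecker, trace_submatrix_mul, Finset.sum_mul, Finset.sum_mul,
      Matrix.trace_sum, Matrix.trace_sum]
    refine Finset.sum_congr rfl fun j _ => ?_
    rw [trace_kronecker_mul, Finset.mul_sum, Matrix.trace_sum, Finset.sum_eq_single j]
    · rw [← Matrix.mul_kronecker_mul, Matrix.trace_kronecker, hL, if_pos rfl, mul_one]
    · intro i _ hi
      rw [← Matrix.mul_kronecker_mul, Matrix.trace_kronecker, hL, if_neg hi.symm, mul_zero]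
    · simp
  rw [h1]
  refine (h s _).trans ?_
  rw [mul_assoc]
  refine mul_le_mul_of_nonneg_left ?_ hc
  have hT : ∑ i, τ i ^ 2 = ∑ i, ∑ k, ∑ j, ‖D k i j‖ ^ 2 := Finset.sum_congr rfl fun i _ =>
    Real.sq_sqrt (Finset.sum_nonneg fun _ _ => Finset.sum_nonneg fun _ _ => sq_nonneg _)
  calc ‖∑ i, weightedPartialTrace (F i) X' ⊗ₖ L i‖
      ≤ ∑ i, a * τ i * ‖X‖ * ‖L i‖ := by
        refine norm_sum_le_of_le _ fun i _ => (opNorm_kronecker_le _ _).trans ?_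
        exact mul_le_mul_of_nonneg_right (hy i) (norm_nonneg _)
    _ = a * ‖X‖ * ∑ i, τ i * ‖L i‖ := by
        rw [Finset.mul_sum]
        exact Finset.sum_congr rfl fun i _ => by ring
    _ ≤ a * ‖X‖ * (Real.sqrt (∑ i, τ i ^ 2) * Real.sqrt (∑ i, ‖L i‖ ^ 2)) :=
        mul_le_mul_of_nonneg_left (Real.sum_mul_le_sqrt_mul_sqrt _ _ _) (by positivity)
    _ = _ := by rw [hT]; ring

/-- The expansion involves `K'` only through `K' - K`, since only the exact `K` is known to preserve
joint bounds. -/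
lemma appendSite_sub (K K' : ζ → Matrix μ μ ℂ) {l : ℕ}
    (Φ Φ' : μ → Matrix (Fin l → Fin d) (Fin l → Fin d) ℂ) :
    appendSite Z K' Φ' - appendSite Z K Φ =
      appendSite Z K (Φ' - Φ) + (appendSite Z (K' - K) (Φ' - Φ) + appendSite Z (K' - K) Φ) := by
  ext j f f'
  simp only [appendSite, Pi.sub_apply, Pi.add_apply, Matrix.sub_apply, Matrix.add_apply,
    Matrix.of_apply, ← Finset.sum_add_distrib, ← Finset.sum_sub_distrib]
  refine Finset.sum_congr rfl fun i _ => ?_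
  simp only [sub_mul, Finset.sum_sub_distrib]
  ring

lemma jointlyBounded_rowDensity {K : ζ → Matrix μ μ ℂ} (hK : ImplementsShift Z Q K) {r : μ → ℂ}
    {c : ℝ} (hr : JointlyBounded Q (rowDensity Z K r 0) c) (l : ℕ) :
    JointlyBounded Q (rowDensity Z K r l) c := by
  induction l with
  | zero => exact hr
  | succ l ih => exact ih.appendSite_shift hK

/-- If the difference is bounded by `a`, the three terms of `appendSite_sub` contribute `a`, `a Δ`
and `Δ`, so `1 + a` is multiplied by `1 + Δ`. -/
lemma jointlyBounded_rowDensity_sub {K K' : ζ → Matrix μ μ ℂ} (hK : ImplementsShift Z Q K)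
    {r r' : μ → ℂ} {x Δ : ℝ} (hx : 0 ≤ x) (hΔ : 0 ≤ Δ)
    (hD : ∀ (l : ℕ) (Φ : μ → Matrix (Fin l → Fin d) (Fin l → Fin d) ℂ) (c : ℝ), 0 ≤ c →
      JointlyBounded Q Φ c → JointlyBounded Q (appendSite Z (K' - K) Φ) (c * Δ))
    (hr : JointlyBounded Q (rowDensity Z K r 0) 1)
    (hr' : JointlyBounded Q (rowDensity Z K' r' 0 - rowDensity Z K r 0) x) (l : ℕ) :
    JointlyBounded Q (rowDensity Z K' r' l - rowDensity Z K r l) ((1 + x) * (1 + Δ) ^ l - 1) := by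
  induction l with
  | zero => simpa using hr'
  | succ l ih =>
    have h0 : 0 ≤ (1 + x) * (1 + Δ) ^ l - 1 := by
      have h1 : 1 ≤ (1 + Δ) ^ l := one_le_pow₀ (by linarith)
      nlinarith
    have h1 := jointlyBounded_rowDensity hK hr l
    have h2 := (ih.appendSite_shift hK).add ((hD l _ _ h0 ih).add (hD l _ _ zero_le_one h1))
    rw [← appendSite_sub] at h2
    have h3 : (1 + x) * (1 + Δ) ^ (l + 1) - 1 = (1 + x) * (1 + Δ) ^ l - 1 +
      (((1 + x) * (1 + Δ) ^ l - 1) * Δ + 1 * Δ) := by ring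
    rw [h3]
    exact h2

/-- Closing a row with a column `v` is evaluation at an observable `L` with memory vector `v`, so
the price is `‖L‖`. -/
lemma JointlyBounded.norm_trace_sum_smul_le {l b : ℕ}
    {Φ : μ → Matrix (Fin l → Fin d) (Fin l → Fin d) ℂ} {c : ℝ} (hc : 0 ≤ c)
    (h : JointlyBounded Q Φ c) (v : μ → ℂ) (L : Matrix (Fin b → Fin d) (Fin b → Fin d) ℂ)
    (hL : ∀ j, (Q b j * L).trace = v j) (B : Matrix (Fin l → Fin d) (Fin l → Fin d) ℂ) :
    ‖((∑ j, v j • Φ j) * B).trace‖ ≤ c * (‖B‖ * ‖L‖) := by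
  have h1 : ((∑ j, v j • Φ j) * B).trace = ((∑ j, Φ j ⊗ₖ Q b j) * (B ⊗ₖ L)).trace := by
    rw [Finset.sum_mul, Finset.sum_mul, Matrix.trace_sum, Matrix.trace_sum]
    refine Finset.sum_congr rfl fun j _ => ?_
    rw [← Matrix.mul_kronecker_mul, Matrix.trace_kronecker, hL, Matrix.smul_mul,
      Matrix.trace_smul, smul_eq_mul, mul_comm]
  rw [h1]
  exact (h b _).trans (mul_le_mul_of_nonneg_left (opNorm_kronecker_le _ _) hc)

/-- Error bound for perturbed matrix product functionals. -/
lemma norm_trace_rowDensity_sub_le {K K' : ζ → Matrix μ μ ℂ} (hK : ImplementsShift Z Q K)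
    {r r' e e' : μ → ℂ} {x Δ y : ℝ} (hx : 0 ≤ x) (hΔ : 0 ≤ Δ)
    (hD : ∀ (l : ℕ) (Φ : μ → Matrix (Fin l → Fin d) (Fin l → Fin d) ℂ) (c : ℝ), 0 ≤ c →
      JointlyBounded Q Φ c → JointlyBounded Q (appendSite Z (K' - K) Φ) (c * Δ))
    (hr : JointlyBounded Q (rowDensity Z K r 0) 1)
    (hr' : JointlyBounded Q (rowDensity Z K' r' 0 - rowDensity Z K r 0) x)
    (he : ∀ j, Q 0 j = Matrix.of fun _ _ => e j) {s : ℕ}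
    {L : Matrix (Fin s → Fin d) (Fin s → Fin d) ℂ} (hL : ∀ j, (Q s j * L).trace = e' j - e j)
    (hy : ‖L‖ ≤ y) (t : ℕ) (B : Matrix (Fin t → Fin d) (Fin t → Fin d) ℂ) :
    ‖((∑ j, e' j • rowDensity Z K' r' t j - ∑ j, e j • rowDensity Z K r t j) * B).trace‖ ≤
      ((1 + x) * (1 + Δ) ^ t * (1 + y) - 1) * ‖B‖ := by
  set w := (1 + x) * (1 + Δ) ^ t with hw
  have hw1 : 1 ≤ w := by
    have h1 : 1 ≤ (1 + Δ) ^ t := one_le_pow₀ (by linarith)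
    nlinarith
  have h1 := jointlyBounded_rowDensity_sub hK hx hΔ hD hr hr' t
  have h2 := jointlyBounded_rowDensity hK hr t
  have h3 := h2.add h1
  rw [add_sub_cancel, ← hw, show (1 : ℝ) + (w - 1) = w by ring] at h3
  rw [← hw] at h1
  -- The exact column is the memory vector of the unit on zero sites, an observable of norm at most
  -- one.
  have h4 := h1.norm_trace_sum_smul_le (by linarith) e (b := 0) 1
    (fun j => by simp [he, Matrix.trace]) B
  have h5 := h3.norm_trace_sum_smul_le (by linarith) (fun j => e' j - e j) L hL B
  -- Row error closed with the exact column costs `w - 1`; the perturbed row, bounded by `w`, closed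
  -- with the column error costs `w y`. The sum is `w (1 + y) - 1`.
  have h6 : ∑ j, e' j • rowDensity Z K' r' t j - ∑ j, e j • rowDensity Z K r t j =
      ∑ j, e j • (rowDensity Z K' r' t - rowDensity Z K r t) j +
        ∑ j, (e' j - e j) • rowDensity Z K' r' t j := by
    simp only [Pi.sub_apply, smul_sub, sub_smul, Finset.sum_sub_distrib]
    abel
  have h7 : ‖(1 : Matrix (Fin 0 → Fin d) (Fin 0 → Fin d) ℂ)‖ ≤ 1 := by
    refine opNorm_le_of_sum_sq zero_le_one fun v => ?_
    simp
  rw [h6, Matrix.add_mul, Matrix.trace_add]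
  refine (norm_add_le _ _).trans ((add_le_add h4 h5).trans ?_)
  have h8 : (w - 1) * (‖B‖ * ‖(1 : Matrix (Fin 0 → Fin d) (Fin 0 → Fin d) ℂ)‖) ≤
      (w - 1) * (‖B‖ * 1) := by gcongr
  have h9 : w * (‖B‖ * ‖L‖) ≤ w * (‖B‖ * y) := by gcongr
  linarith

/-- The shift relation hands sites from the row to the memory one at a time. Configurations are
restrictions of functions on `ℕ`, which avoids casts between `l + 1 + b` and `l + (b + 1)` sites. -/
lemma sum_rowDensity_mul {K : ζ → Matrix μ μ ℂ} (hK : ImplementsShift Z Q K) (r : μ → ℂ)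
    (l b N : ℕ) (hN : N = l + b) (F F' : ℕ → Fin d) :
    ∑ j, rowDensity Z K r l j (fun i => F i) (fun i => F' i) *
      Q b j (fun i => F (l + i)) (fun i => F' (l + i)) =
    ∑ j, r j * Q N j (fun i => F i) (fun i => F' i) := by
  induction l generalizing b with
  | zero =>
    obtain rfl : N = b := by omega
    simp [rowDensity]
  | succ l ih =>
    rw [← ih (b + 1) (by omega)]
    have h := congrFun (congrFun (sum_appendSite_kronecker Z Q K (rowDensity Z K r l) b)
      (fun i => F i, fun i => F (l + 1 + i))) (fun i => F' i, fun i => F' (l + 1 + i))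
    simp only [Matrix.sum_apply, Matrix.kroneckerMap_apply, Matrix.submatrix_apply, hK b,
      splitLast, Equiv.coe_fn_mk] at h
    simp only [rowDensity]
    rw [h]
    have hc : ∀ F : ℕ → Fin d, (Fin.cons (F l) fun i : Fin b => F (l + 1 + i) : Fin (b + 1) → Fin d)
        = fun i : Fin (b + 1) => F (l + i) := by
      intro F
      funext i
      refine Fin.cases ?_ (fun i => ?_) i
      · simp
      · simp only [Fin.cons_succ, Fin.val_succ]
        congr 1
        omega
    refine Finset.sum_congr rfl fun j _ => ?_
    simp only [Fin.val_last, hc]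
    rfl

lemma sum_smul_rowDensity_eq {K : ζ → Matrix μ μ ℂ} (hK : ImplementsShift Z Q K) {r e : μ → ℂ}
    (he : ∀ j, Q 0 j = Matrix.of fun _ _ => e j) (t : ℕ) :
    ∑ j, e j • rowDensity Z K r t j = ∑ j, r j • Q t j := by
  -- For `d = 0` a configuration has no extension to `ℕ`, so that case is treated apart.
  rcases Nat.eq_zero_or_pos d with hd | hd
  · subst hd
    rcases t with _ | t
    · ext f f'
      simp [rowDensity, he, Matrix.sum_apply, Matrix.smul_apply, mul_comm, -Matrix.smul_of]
    · ext f
      exact (f 0).elim0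
  · ext f f'
    let F : (Fin t → Fin d) → ℕ → Fin d := fun f i => if h : i < t then f ⟨i, h⟩ else ⟨0, hd⟩
    have hF : ∀ f, (fun i : Fin t => F f i) = f := fun f => funext fun i => by simp [F]
    have h := sum_rowDensity_mul hK r t 0 t rfl (F f) (F f')
    simp only [hF, he, Matrix.of_apply] at h
    simp only [Matrix.sum_apply, Matrix.smul_apply, smul_eq_mul]
    rw [← h]
    exact Finset.sum_congr rfl fun j _ => mul_comm _ _

end Stability

/-! ### Blocks of the chain, their algebras and the marginals of a state -/

section Chain
open scoped Matrix.Norms.L2Operator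

variable {d : ℕ}

lemma join_eq_submatrix {a b : ℕ} (Y : Matrix (Fin a → Fin d) (Fin a → Fin d) ℂ)
    (X : Matrix (Fin b → Fin d) (Fin b → Fin d) ℂ) :
    join Y X = (Y ⊗ₖ X).submatrix (Fin.appendEquiv a b).symm (Fin.appendEquiv a b).symm := rfl

lemma trace_mul_join {a b : ℕ} (W : Matrix (Fin (a + b) → Fin d) (Fin (a + b) → Fin d) ℂ)
    (Y : Matrix (Fin a → Fin d) (Fin a → Fin d) ℂ)
    (X : Matrix (Fin b → Fin d) (Fin b → Fin d) ℂ) :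
    (W * join Y X).trace =
      (W.submatrix (Fin.appendEquiv a b) (Fin.appendEquiv a b) * (Y ⊗ₖ X)).trace := by
  rw [trace_submatrix_mul, join_eq_submatrix]

lemma opNorm_join_le {a b : ℕ} (Y : Matrix (Fin a → Fin d) (Fin a → Fin d) ℂ)
    (X : Matrix (Fin b → Fin d) (Fin b → Fin d) ℂ) : ‖join Y X‖ ≤ ‖Y‖ * ‖X‖ := by
  rw [join_eq_submatrix, opNorm_submatrix_equiv]
  exact opNorm_kronecker_le _ _

lemma trace_conjTranspose_join_mul_join {a b : ℕ}
    (Y Y' : Matrix (Fin a → Fin d) (Fin a → Fin d) ℂ)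
    (X X' : Matrix (Fin b → Fin d) (Fin b → Fin d) ℂ) :
    ((join Y X)ᴴ * join Y' X').trace = (Yᴴ * Y').trace * (Xᴴ * X').trace := by
  rw [trace_mul_join, ← Matrix.trace_kronecker, Matrix.mul_kronecker_mul,
    ← Matrix.conjTranspose_kronecker, join_eq_submatrix]
  congr 2
  ext i j
  simp

lemma isHermitian_join {a b : ℕ} {Y : Matrix (Fin a → Fin d) (Fin a → Fin d) ℂ}
    {X : Matrix (Fin b → Fin d) (Fin b → Fin d) ℂ} (hY : Y.IsHermitian) (hX : X.IsHermitian) :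
    (join Y X).IsHermitian := by
  ext i j
  have h1 := hY.apply (fun k => i (Fin.castAdd b k)) (fun k => j (Fin.castAdd b k))
  have h2 := hX.apply (fun k => i (Fin.natAdd a k)) (fun k => j (Fin.natAdd a k))
  simp only [join, Matrix.conjTranspose_apply, Matrix.of_apply, star_mul', h1, h2]

/-- `join` as a bilinear map. -/
def joinₗ (d a b : ℕ) : Matrix (Fin a → Fin d) (Fin a → Fin d) ℂ →ₗ[ℂ]
    Matrix (Fin b → Fin d) (Fin b → Fin d) ℂ →ₗ[ℂ]
      Matrix (Fin (a + b) → Fin d) (Fin (a + b) → Fin d) ℂ :=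
  LinearMap.mk₂ ℂ join
    (fun _ _ _ => by ext; simp [join, add_mul]) (fun _ _ _ => by ext; simp [join, mul_assoc])
    (fun _ _ _ => by ext; simp [join, mul_add]) (fun _ _ _ => by ext; simp [join]; ring)

@[simp] lemma joinₗ_apply {a b : ℕ} (Y : Matrix (Fin a → Fin d) (Fin a → Fin d) ℂ)
    (X : Matrix (Fin b → Fin d) (Fin b → Fin d) ℂ) : joinₗ d a b Y X = join Y X := rfl

lemma join_piKron {a b : ℕ} (M : Fin a → Matrix (Fin d) (Fin d) ℂ)
    (N : Fin b → Matrix (Fin d) (Fin d) ℂ) :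
    join (piKron M) (piKron N) = piKron (Fin.append M N) := by
  ext i j
  simp [join, piKron, Fin.prod_univ_add]

lemma piKron_conjTranspose {a : ℕ} (M : Fin a → Matrix (Fin d) (Fin d) ℂ) :
    (piKron M)ᴴ = piKron fun k => (M k)ᴴ := by
  ext i j
  simp [piKron]

lemma piKron_one (a : ℕ) :
    piKron (fun _ : Fin a => (1 : Matrix (Fin d) (Fin d) ℂ)) = 1 := by
  ext i j
  simp only [piKron, Matrix.of_apply, Matrix.one_apply, Finset.prod_ite_zero]
  simp [funext_iff]

variable {A : StarSubalgebra ℂ (Matrix (Fin d) (Fin d) ℂ)}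

lemma piKron_mem_blockAlg {N : ℕ} (a : Fin N → A) :
    piKron (fun k => (a k : Matrix (Fin d) (Fin d) ℂ)) ∈ blockAlg A N :=
  Submodule.subset_span ⟨a, rfl⟩

lemma one_mem_blockAlg (N : ℕ) : (1 : Matrix (Fin N → Fin d) (Fin N → Fin d) ℂ) ∈ blockAlg A N := by
  rw [← piKron_one]
  exact piKron_mem_blockAlg (A := A) fun _ => 1

lemma join_mem_blockAlg {a b : ℕ} {Y : Matrix (Fin a → Fin d) (Fin a → Fin d) ℂ}
    {X : Matrix (Fin b → Fin d) (Fin b → Fin d) ℂ} (hY : Y ∈ blockAlg A a)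
    (hX : X ∈ blockAlg A b) : join Y X ∈ blockAlg A (a + b) := by
  have h := Submodule.apply_mem_map₂ (joinₗ d a b) hY hX
  rw [blockAlg, blockAlg, Submodule.map₂_span_span] at h
  refine Submodule.span_le.2 ?_ h
  rintro _ ⟨_, ⟨M, rfl⟩, _, ⟨N, rfl⟩, rfl⟩
  refine Submodule.subset_span ⟨Fin.append M N, ?_⟩
  simp only [joinₗ_apply, join_piKron]
  congr 1
  funext k
  refine Fin.addCases (fun i => ?_) (fun i => ?_) k <;> simp

lemma conjTranspose_mem_blockAlg {N : ℕ} {X : Matrix (Fin N → Fin d) (Fin N → Fin d) ℂ}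
    (hX : X ∈ blockAlg A N) : Xᴴ ∈ blockAlg A N := by
  induction hX using Submodule.span_induction with
  | mem x h =>
    obtain ⟨a, rfl⟩ := h
    simp only [piKron_conjTranspose]
    exact piKron_mem_blockAlg fun k => star (a k)
  | zero => simp
  | add x y _ _ hx hy => rw [Matrix.conjTranspose_add]; exact Submodule.add_mem _ hx hy
  | smul c x _ hx => rw [Matrix.conjTranspose_smul]; exact Submodule.smul_mem _ _ hx

/-- The adjoint of `M - M'` is again in the block algebra, and testing on it gives the squared
Hilbert–Schmidt norm of the difference. Identities of densities therefore need checking only on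
observables of the algebra. -/
lemma eq_of_forall_trace_mul_eq {N : ℕ} {M M' : Matrix (Fin N → Fin d) (Fin N → Fin d) ℂ}
    (hM : M ∈ blockAlg A N) (hM' : M' ∈ blockAlg A N)
    (h : ∀ X ∈ blockAlg A N, (M * X).trace = (M' * X).trace) : M = M' := by
  have h1 := h _ (conjTranspose_mem_blockAlg (Submodule.sub_mem _ hM hM'))
  rw [← sub_eq_zero, ← Matrix.trace_sub, ← Matrix.sub_mul,
    Matrix.trace_mul_conjTranspose_self_eq_zero_iff] at h1
  exact sub_eq_zero.1 h1

/-- `z ⊗ X` on `b + 1` sites. -/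
def consKron {b : ℕ} (z : Matrix (Fin d) (Fin d) ℂ) (X : Matrix (Fin b → Fin d) (Fin b → Fin d) ℂ) :
    Matrix (Fin (b + 1) → Fin d) (Fin (b + 1) → Fin d) ℂ :=
  Matrix.of fun f f' => z (f 0) (f' 0) * X (Fin.tail f) (Fin.tail f')

lemma consKron_piKron {b : ℕ} (z : Matrix (Fin d) (Fin d) ℂ)
    (M : Fin b → Matrix (Fin d) (Fin d) ℂ) :
    consKron z (piKron M) = piKron (Fin.cons z M : Fin (b + 1) → Matrix (Fin d) (Fin d) ℂ) := by
  ext f f'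
  simp [consKron, piKron, Fin.prod_univ_succ, Fin.tail]

lemma blockAlg_succ_induction {b : ℕ} {P : Matrix (Fin (b + 1) → Fin d) (Fin (b + 1) → Fin d) ℂ → Prop}
    (hP : ∀ z ∈ A, ∀ X ∈ blockAlg A b, P (consKron z X)) (h0 : P 0)
    (hadd : ∀ x y, P x → P y → P (x + y)) (hsmul : ∀ (c : ℂ) x, P x → P (c • x))
    {X : Matrix (Fin (b + 1) → Fin d) (Fin (b + 1) → Fin d) ℂ} (hX : X ∈ blockAlg A (b + 1)) : P X := by
  induction hX using Submodule.span_induction with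
  | mem x h =>
    obtain ⟨a, rfl⟩ := h
    have h1 := hP (a 0) (a 0).2 _ (piKron_mem_blockAlg fun k => a k.succ)
    rw [consKron_piKron] at h1
    convert h1 using 2
    funext k
    refine Fin.cases ?_ (fun i => ?_) k <;> simp
  | zero => exact h0
  | add x y _ _ hx hy => exact hadd x y hx hy
  | smul c x _ hx => exact hsmul c x hx

lemma consKron_mem_blockAlg {b : ℕ} {z : Matrix (Fin d) (Fin d) ℂ} (hz : z ∈ A)
    {X : Matrix (Fin b → Fin d) (Fin b → Fin d) ℂ} (hX : X ∈ blockAlg A b) :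
    consKron z X ∈ blockAlg A (b + 1) := by
  induction hX using Submodule.span_induction with
  | mem x h =>
    obtain ⟨a, rfl⟩ := h
    rw [consKron_piKron]
    convert piKron_mem_blockAlg (A := A) (Fin.cons ⟨z, hz⟩ a : Fin (b + 1) → A) using 2
    funext k
    refine Fin.cases ?_ (fun i => ?_) k <;> simp
  | zero =>
    convert Submodule.zero_mem (blockAlg A (b + 1))
    ext; simp [consKron]
  | add x y _ _ hx hy =>
    convert Submodule.add_mem _ hx hy using 1
    ext; simp [consKron, mul_add]
  | smul c x _ hx =>
    convert Submodule.smul_mem _ c hx using 1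
    ext; simp [consKron]; ring

namespace TIState

variable (ω : TIState A)

lemma density_cast {N N' : ℕ} (h : N = N') (f f' : Fin N' → Fin d) :
    ω.density N (fun i => f (Fin.cast h i)) (fun i => f' (Fin.cast h i)) = ω.density N' f f' := by
  subst h
  rfl

lemma sum_density_append_right (a b : ℕ) (f f' : Fin a → Fin d) :
    ∑ g : Fin b → Fin d, ω.density (a + b) (Fin.append f g) (Fin.append f' g) =
      ω.density a f f' := by
  induction b with
  | zero =>
    simp only [Finset.univ_unique, Finset.sum_singleton]
    rw [Fin.append_right_nil _ _ rfl, Fin.append_right_nil _ _ rfl]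
    rfl
  | succ b ih =>
    rw [← ih, ← (Fin.snocEquiv fun _ => Fin d).sum_comp, Fintype.sum_prod_type, Finset.sum_comm]
    refine Finset.sum_congr rfl fun g _ => ?_
    rw [← ω.drop_right (a + b)]
    refine Finset.sum_congr rfl fun k _ => ?_
    simp only [Fin.snocEquiv, Equiv.coe_fn_mk, Fin.append_snoc]
    rfl

lemma sum_density_append_left (a b : ℕ) (f f' : Fin b → Fin d) :
    ∑ g : Fin a → Fin d, ω.density (a + b) (Fin.append g f) (Fin.append g f') =
      ω.density b f f' := by
  induction a with
  | zero =>
    simp only [Finset.univ_unique, Finset.sum_singleton]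
    rw [Fin.append_left_nil _ _ rfl, Fin.append_left_nil _ _ rfl]
    exact ω.density_cast (Nat.zero_add b) f f'
  | succ a ih =>
    rw [← ih, ← (Fin.consEquiv fun _ => Fin d).sum_comp, Fintype.sum_prod_type, Finset.sum_comm]
    refine Finset.sum_congr rfl fun g _ => ?_
    rw [← ω.drop_left (a + b)]
    refine Finset.sum_congr rfl fun k _ => ?_
    simp only [Fin.consEquiv, Equiv.coe_fn_mk, Fin.append_cons]
    exact ω.density_cast (Nat.succ_add a b) _ _

lemma eval_join {a b : ℕ} (Y : Matrix (Fin a → Fin d) (Fin a → Fin d) ℂ)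
    (X : Matrix (Fin b → Fin d) (Fin b → Fin d) ℂ) :
    ω.eval (join Y X) = ∑ f, ∑ g, ∑ f', ∑ g',
      ω.density (a + b) (Fin.append f g) (Fin.append f' g') * (Y f' f * X g' g) := by
  rw [eval, trace_mul_join]
  simp only [Matrix.trace, Matrix.diag, Matrix.mul_apply, Fintype.sum_prod_type,
    Matrix.kroneckerMap_apply, Matrix.submatrix_apply]
  rfl

lemma eval_join_one_right {a b : ℕ} (Y : Matrix (Fin a → Fin d) (Fin a → Fin d) ℂ) :
    ω.eval (join Y (1 : Matrix (Fin b → Fin d) (Fin b → Fin d) ℂ)) = ω.eval Y := by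
  rw [eval_join, eval]
  simp only [Matrix.trace, Matrix.diag, Matrix.mul_apply, ← ω.sum_density_append_right a b,
    Finset.sum_mul]
  refine Finset.sum_congr rfl fun f _ => ?_
  rw [Finset.sum_comm]
  refine Finset.sum_congr rfl fun f' _ => Finset.sum_congr rfl fun g _ => ?_
  rw [Finset.sum_eq_single g]
  · simp
  · intro g' _ h; simp [h]
  · simp

lemma eval_join_one_left {a b : ℕ} (X : Matrix (Fin b → Fin d) (Fin b → Fin d) ℂ) :
    ω.eval (join (1 : Matrix (Fin a → Fin d) (Fin a → Fin d) ℂ) X) = ω.eval X := by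
  rw [eval_join, eval]
  simp only [Matrix.trace, Matrix.diag, Matrix.mul_apply, ← ω.sum_density_append_left a b,
    Finset.sum_mul]
  rw [Finset.sum_comm]
  refine Finset.sum_congr rfl fun g _ => ?_
  calc _ = ∑ f, ∑ g', ω.density (a + b) (Fin.append f g) (Fin.append f g') * X g' g := by
        refine Finset.sum_congr rfl fun f _ => ?_
        rw [Finset.sum_eq_single f]
        · simp
        · intro g' _ h; simp [h]
        · simp
    _ = _ := Finset.sum_comm

lemma eval_submatrix_cast {N N' : ℕ} (h : N = N') (X : Matrix (Fin N → Fin d) (Fin N → Fin d) ℂ) :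
    ω.eval (X.submatrix (fun f : Fin N' → Fin d => fun i => f (Fin.cast h i))
      (fun f : Fin N' → Fin d => fun i => f (Fin.cast h i))) = ω.eval X := by
  subst h
  rfl

lemma eval_join_assoc {a b c : ℕ} (Y : Matrix (Fin a → Fin d) (Fin a → Fin d) ℂ)
    (X : Matrix (Fin b → Fin d) (Fin b → Fin d) ℂ) (V : Matrix (Fin c → Fin d) (Fin c → Fin d) ℂ) :
    ω.eval (join (join Y X) V) = ω.eval (join Y (join X V)) := by
  rw [← ω.eval_submatrix_cast (Nat.add_assoc a b c).symm (join Y (join X V))]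
  congr 1
  ext f f'
  simp only [join, Matrix.of_apply, Matrix.submatrix_apply, mul_assoc]
  have h1 : ∀ i : Fin c, Fin.natAdd (a + b) i =
      Fin.cast (Nat.add_assoc a b c).symm (Fin.natAdd a (Fin.natAdd b i)) := fun i => by
    ext; simp; omega
  simp only [h1]
  rfl

lemma eval_join_site {a b : ℕ} (Y : Matrix (Fin a → Fin d) (Fin a → Fin d) ℂ)
    (z : Matrix (Fin d) (Fin d) ℂ) (X : Matrix (Fin b → Fin d) (Fin b → Fin d) ℂ) :
    ω.eval (join (join Y (piKron fun _ : Fin 1 => z)) X) = ω.eval (join Y (consKron z X)) := by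
  have h : a + (b + 1) = a + 1 + b := by omega
  rw [← ω.eval_submatrix_cast h (join Y (consKron z X))]
  congr 1
  ext f f'
  simp only [join, consKron, piKron, Matrix.of_apply, Matrix.submatrix_apply, mul_assoc,
    Fin.prod_univ_one]
  have h1 : ∀ i : Fin b, Fin.natAdd (a + 1) i = Fin.cast h (Fin.natAdd a i.succ) := fun i => by
    ext; simp; omega
  simp only [h1]
  rfl

/-- The density on `b` sites of the functional `X ↦ ω(Y ⊗ X)`. -/
def leftDensity {a : ℕ} (Y : Matrix (Fin a → Fin d) (Fin a → Fin d) ℂ) (b : ℕ) :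
    Matrix (Fin b → Fin d) (Fin b → Fin d) ℂ :=
  Matrix.of fun g g' => ∑ f, ∑ f', ω.density (a + b) (Fin.append f g) (Fin.append f' g') * Y f' f

lemma trace_leftDensity_mul {a b : ℕ} (Y : Matrix (Fin a → Fin d) (Fin a → Fin d) ℂ)
    (X : Matrix (Fin b → Fin d) (Fin b → Fin d) ℂ) :
    (ω.leftDensity Y b * X).trace = ω.eval (join Y X) := by
  rw [eval_join]
  simp only [Matrix.trace, Matrix.diag, Matrix.mul_apply, leftDensity, Matrix.of_apply,
    Finset.sum_mul]
  calc _ = ∑ g, ∑ f, ∑ g', ∑ f',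
        ω.density (a + b) (Fin.append f g) (Fin.append f' g') * Y f' f * X g' g :=
        Finset.sum_congr rfl fun g _ => Finset.sum_comm
    _ = ∑ f, ∑ g, ∑ g', ∑ f',
        ω.density (a + b) (Fin.append f g) (Fin.append f' g') * Y f' f * X g' g := Finset.sum_comm
    _ = _ := Finset.sum_congr rfl fun f _ => Finset.sum_congr rfl fun g _ => by
        rw [Finset.sum_comm]
        exact Finset.sum_congr rfl fun f _ => Finset.sum_congr rfl fun g _ => by ring

/-- A slice of a product element is a multiple of the product of its right factors. Membership is
what makes `eq_of_forall_trace_mul_eq` applicable to memory densities. -/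
lemma leftDensity_mem {a b : ℕ} (Y : Matrix (Fin a → Fin d) (Fin a → Fin d) ℂ) :
    ω.leftDensity Y b ∈ blockAlg A b := by
  suffices h : ∀ W ∈ blockAlg A (a + b), (Matrix.of fun g g' => ∑ f : Fin a → Fin d,
      ∑ f' : Fin a → Fin d, W (Fin.append f g) (Fin.append f' g') * Y f' f) ∈ blockAlg A b from
    h _ (ω.mem _)
  intro W hW
  induction hW using Submodule.span_induction with
  | mem x h =>
    obtain ⟨c, rfl⟩ := h
    convert Submodule.smul_mem _
      (∑ f : Fin a → Fin d, ∑ f' : Fin a → Fin d,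
        (∏ k, (c (Fin.castAdd b k) : Matrix (Fin d) (Fin d) ℂ) (f k) (f' k)) * Y f' f)
      (piKron_mem_blockAlg (A := A) fun k => c (Fin.natAdd a k)) using 1
    ext g g'
    simp only [piKron, Fin.prod_univ_add, Matrix.of_apply, Fin.append_left, Fin.append_right,
      Matrix.smul_apply, smul_eq_mul, Finset.sum_mul]
    exact Finset.sum_congr rfl fun f _ => Finset.sum_congr rfl fun g _ => by ring
  | zero =>
    convert Submodule.zero_mem (blockAlg A b)
    ext; simp
  | add x y _ _ hx hy =>
    convert Submodule.add_mem _ hx hy using 1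
    ext; simp [add_mul, Finset.sum_add_distrib]
  | smul c x _ hx =>
    convert Submodule.smul_mem _ c hx using 1
    ext; simp [Finset.mul_sum, mul_assoc]

end TIState

end Chain
-- The rank of Ω and of its restrictions
section Rank

variable {d : ℕ} {A : StarSubalgebra ℂ (Matrix (Fin d) (Fin d) ℂ)}

namespace TIState

variable (ω : TIState A)

lemma eval_add {N : ℕ} (X X' : Matrix (Fin N → Fin d) (Fin N → Fin d) ℂ) :
    ω.eval (X + X') = ω.eval X + ω.eval X' := by
  rw [eval, Matrix.mul_add, Matrix.trace_add]; rfl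

lemma eval_smul {N : ℕ} (c : ℂ) (X : Matrix (Fin N → Fin d) (Fin N → Fin d) ℂ) :
    ω.eval (c • X) = c * ω.eval X := by
  rw [eval, Matrix.mul_smul, Matrix.trace_smul]; rfl

/-- `(Y, X) ↦ ω(Y ⊗ X)` as a bilinear form. -/
def pairing (a b : ℕ) : Matrix (Fin a → Fin d) (Fin a → Fin d) ℂ →ₗ[ℂ]
    Matrix (Fin b → Fin d) (Fin b → Fin d) ℂ →ₗ[ℂ] ℂ :=
  (joinₗ d a b).compr₂
    { toFun := ω.eval, map_add' := ω.eval_add, map_smul' := ω.eval_smul }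

@[simp] lemma pairing_apply {a b : ℕ} (Y : Matrix (Fin a → Fin d) (Fin a → Fin d) ℂ)
    (X : Matrix (Fin b → Fin d) (Fin b → Fin d) ℂ) : ω.pairing a b Y X = ω.eval (join Y X) := rfl

/-- The functional `Y ↦ ω(Y ⊗ X)` on the left half chain. -/
def leftFunctional (b : ℕ) : blockAlg A b →ₗ[ℂ] ((a : ℕ) → blockAlg A a → ℂ) where
  toFun X := fun a Y => ω.pairing a b Y.1 X.1
  map_add' X X' := by funext a Y; exact (ω.pairing a b Y.1).map_add X.1 X'.1
  map_smul' c X := by funext a Y; exact (ω.pairing a b Y.1).map_smul c X.1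

/-- The space generated by the functionals `Y ↦ ω(Y ⊗ X)`. -/
def hankelSpace : Submodule ℂ ((a : ℕ) → blockAlg A a → ℂ) :=
  Submodule.span ℂ {Ψ | ∃ (b : ℕ) (X : blockAlg A b), Ψ = fun _ Y => ω.eval (join Y.1 X.1)}

lemma rank_eq : ω.rank = Module.finrank ℂ ω.hankelSpace := rfl

lemma leftFunctional_mem {b : ℕ} (X : blockAlg A b) : ω.leftFunctional b X ∈ ω.hankelSpace :=
  Submodule.subset_span ⟨b, X, rfl⟩

/-- The restriction of `Ω` to finite blocks. -/
def blockMap (a b : ℕ) : blockAlg A b →ₗ[ℂ] (blockAlg A a → ℂ) where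
  toFun X := fun Y => ω.pairing a b Y.1 X.1
  map_add' X X' := by funext Y; exact (ω.pairing a b Y.1).map_add X.1 X'.1
  map_smul' c X := by funext Y; exact (ω.pairing a b Y.1).map_smul c X.1

lemma blockRank_eq (a b : ℕ) :
    ω.blockRank a b = Module.finrank ℂ (LinearMap.range (ω.blockMap a b)) := by
  have h : Set.range (fun (X : blockAlg A b) (Y : blockAlg A a) => ω.eval (join Y.1 X.1)) =
      (LinearMap.range (ω.blockMap a b) : Set _) := rfl
  rw [blockRank, h, Submodule.span_eq]

/-- Padding with units away from the cut changes no correlation, by consistency of the marginals. -/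
lemma blockRank_le_right (a b e : ℕ) : ω.blockRank a b ≤ ω.blockRank a (b + e) := by
  rw [blockRank_eq, blockRank_eq]
  refine Submodule.finrank_mono ?_
  rintro _ ⟨X, rfl⟩
  refine ⟨⟨join X.1 1, join_mem_blockAlg X.2 (one_mem_blockAlg e)⟩, ?_⟩
  funext Y
  simp only [blockMap, LinearMap.coe_mk, AddHom.coe_mk, pairing_apply]
  rw [← eval_join_assoc, eval_join_one_right]

lemma blockRank_le_left (a b c : ℕ) : ω.blockRank a b ≤ ω.blockRank (c + a) b := by
  rw [blockRank_eq, blockRank_eq]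
  let T : (blockAlg A (c + a) → ℂ) →ₗ[ℂ] (blockAlg A a → ℂ) := LinearMap.funLeft ℂ ℂ
    fun Y => ⟨join 1 Y.1, join_mem_blockAlg (one_mem_blockAlg c) Y.2⟩
  have h : T ∘ₗ ω.blockMap (c + a) b = ω.blockMap a b := by
    ext X Y
    simp only [T, LinearMap.comp_apply, LinearMap.funLeft_apply, blockMap, LinearMap.coe_mk,
      AddHom.coe_mk, pairing_apply]
    rw [eval_join_assoc, eval_join_one_left]
  rw [← h, LinearMap.range_comp]
  exact Submodule.finrank_map_le _ _

lemma blockRank_mono {a b s : ℕ} (ha : a ≤ s) (hb : b ≤ s) : ω.blockRank a b ≤ ω.blockRank s s := by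
  obtain ⟨e, rfl⟩ := Nat.exists_eq_add_of_le hb
  refine (ω.blockRank_le_right a b e).trans ?_
  have h := ω.blockRank_le_left a (b + e) (b + e - a)
  rwa [Nat.sub_add_cancel ha] at h

end TIState

/-! ### Dimension bound from a realization -/

section Realization

variable {ω : TIState A} {D : ℕ}

/-- The map `b ↦ E(a ⊗ b)`. -/
def CStarRealization.slice (R : CStarRealization ω D) (a : A) :
    Matrix (Fin D) (Fin D) ℂ →ₗ[ℂ] Matrix (Fin D) (Fin D) ℂ where
  toFun b := R.E (memTmul a b)
  map_add' b b' := by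
    rw [← map_add]; congr 1
    exact Subtype.ext (Matrix.kronecker_add _ _ _)
  map_smul' c b := by
    rw [RingHom.id_apply, ← map_smul]; congr 1
    exact Subtype.ext (Matrix.kronecker_smul _ _ _)

lemma CStarRealization.foldr_eq (R : CStarRealization ω D) (l : List A)
    (b : Matrix (Fin D) (Fin D) ℂ) :
    l.foldr (fun x b => R.E (memTmul x b)) b = (l.map R.slice).prod b := by
  induction l with
  | nil => simp
  | cons x l ih =>
    rw [List.foldr_cons, ih, List.map_cons, List.prod_cons]
    rfl

/-- The space of left functionals is at most `D²`-dimensional. -/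
lemma CStarRealization.finite_and_rank_le (R : CStarRealization ω D) :
    Module.Finite ℂ ω.hankelSpace ∧ ω.rank ≤ D ^ 2 := by
  -- `L` sends a memory element `b` to its correlations `ρ(E_{c₁} ⋯ E_{cₙ}(b))`. Its domain has
  -- dimension `D²`, and the values of any left functional on product observables (the map `Θ`) lie
  -- in its range.
  let L : Matrix (Fin D) (Fin D) ℂ →ₗ[ℂ] ((n : ℕ) → (Fin n → A) → ℂ) :=
    LinearMap.pi fun n => LinearMap.pi fun c => Matrix.traceLinearMap (Fin D) ℂ ℂ ∘ₗ
      LinearMap.mulLeft ℂ R.ρ ∘ₗ ((List.ofFn c).map R.slice).prod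
  let Θ : ((a : ℕ) → blockAlg A a → ℂ) →ₗ[ℂ] ((n : ℕ) → (Fin n → A) → ℂ) :=
    LinearMap.pi fun n => LinearMap.funLeft ℂ ℂ
      (fun c : Fin n → A => (⟨_, piKron_mem_blockAlg c⟩ : blockAlg A n)) ∘ₗ LinearMap.proj n
  have hrange : ∀ Ψ ∈ ω.hankelSpace, Θ Ψ ∈ LinearMap.range L := by
    intro Ψ hΨ
    suffices h : ω.hankelSpace ≤ (LinearMap.range L).comap Θ from h hΨ
    refine Submodule.span_le.2 ?_
    rintro _ ⟨b, ⟨X, hX⟩, rfl⟩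
    change Θ (ω.leftFunctional b ⟨X, hX⟩) ∈ LinearMap.range L
    induction hX using Submodule.span_induction with
    | mem x h =>
      obtain ⟨c', rfl⟩ := h
      refine ⟨((List.ofFn c').map R.slice).prod 1, ?_⟩
      funext n c
      change (R.ρ * ((List.ofFn c).map R.slice).prod (((List.ofFn c').map R.slice).prod 1)).trace =
        ω.eval (join (piKron _) (piKron _))
      rw [join_piKron]
      have h := R.realizes (n + b) (Fin.append c c')
      rw [List.ofFn_fin_append, List.foldr_append, R.foldr_eq, R.foldr_eq] at h
      rw [← h]
      congr 2
      funext k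
      refine Fin.addCases (fun i => ?_) (fun i => ?_) k <;> simp
    | zero =>
      have : Θ (ω.leftFunctional b 0) ∈ LinearMap.range L := by
        rw [map_zero, map_zero]; exact Submodule.zero_mem _
      exact this
    | add x y hx0 hy0 hx hy =>
      have : Θ (ω.leftFunctional b (⟨x, hx0⟩ + ⟨y, hy0⟩)) ∈ LinearMap.range L := by
        rw [map_add, map_add]; exact Submodule.add_mem _ hx hy
      exact this
    | smul c x hx0 hx =>
      have : Θ (ω.leftFunctional b (c • ⟨x, hx0⟩)) ∈ LinearMap.range L := by
        rw [map_smul, map_smul]; exact Submodule.smul_mem _ _ hx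
      exact this
  -- Elements of the space are bare functions; their linearity is what makes one that vanishes on
  -- product observables vanish altogether.
  have hlin : ∀ Ψ ∈ ω.hankelSpace, ∀ a, IsLinearMap ℂ (Ψ a) := by
    intro Ψ hΨ
    induction hΨ using Submodule.span_induction with
    | mem x h =>
      obtain ⟨b, X, rfl⟩ := h
      exact fun a => ⟨fun Y Y' => LinearMap.map_add₂ (ω.pairing a b) _ _ _,
        fun c Y => LinearMap.map_smul₂ (ω.pairing a b) _ _ _⟩
    | zero => exact fun a => ⟨fun _ _ => by simp, fun _ _ => by simp⟩
    | add x y _ _ hx hy =>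
      exact fun a => ⟨fun Y Y' => by simp only [Pi.add_apply, (hx a).map_add, (hy a).map_add]; ring,
        fun c Y => by simp only [Pi.add_apply, (hx a).map_smul, (hy a).map_smul, smul_add]⟩
    | smul c x _ hx =>
      exact fun a => ⟨fun Y Y' => by simp only [Pi.smul_apply, (hx a).map_add, smul_add],
        fun c' Y => by simp only [Pi.smul_apply, (hx a).map_smul]; rw [smul_comm]⟩
  let f : ω.hankelSpace →ₗ[ℂ] LinearMap.range L :=
    (Θ ∘ₗ ω.hankelSpace.subtype).codRestrict _ fun Ψ => hrange Ψ.1 Ψ.2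
  have hf : Function.Injective f := by
    rw [injective_iff_map_eq_zero]
    rintro ⟨Ψ, hΨ⟩ h
    have h0 : Θ Ψ = 0 := congrArg Subtype.val h
    refine Subtype.ext ?_
    funext a Y
    obtain ⟨Y, hY⟩ := Y
    change Ψ a ⟨Y, hY⟩ = 0
    induction hY using Submodule.span_induction with
    | mem x h =>
      obtain ⟨c, rfl⟩ := h
      exact congrFun (congrFun h0 a) c
    | zero => exact (hlin Ψ hΨ a).map_zero
    | add x y hx0 hy0 hx hy =>
      have := (hlin Ψ hΨ a).map_add ⟨x, hx0⟩ ⟨y, hy0⟩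
      rw [hx, hy, add_zero] at this
      exact this
    | smul c x hx0 hx =>
      have := (hlin Ψ hΨ a).map_smul c ⟨x, hx0⟩
      rw [hx, smul_zero] at this
      exact this
  refine ⟨Module.Finite.of_injective f hf, ?_⟩
  rw [TIState.rank_eq]
  refine (LinearMap.finrank_le_finrank_of_injective hf).trans ((LinearMap.finrank_range_le L).trans ?_)
  rw [Module.finrank_matrix]
  simp [sq]

end Realization

/-! ### The matrix of Ω in bases of the blocks -/

section Bases

variable (ω : TIState A) {s : ℕ} {κ ι : Type} [Fintype ι]
  {Y : κ → Matrix (Fin s → Fin d) (Fin s → Fin d) ℂ}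
  {X : ι → Matrix (Fin s → Fin d) (Fin s → Fin d) ℂ}

lemma omegaMat_mulVec (u : ι → ℂ) (j : κ) :
    (omegaMat Y X (ω.density (s + s)) *ᵥ u) j = ω.eval (join (Y j) (∑ i, u i • X i)) := by
  rw [← TIState.pairing_apply, map_sum]
  simp only [map_smul, smul_eq_mul, Matrix.mulVec, dotProduct]
  exact Finset.sum_congr rfl fun i _ => mul_comm _ _

variable {ω} in
-- Reading a functional on the spanning family `Y` loses nothing, whence the kernel inclusion; as
-- `X` spans, all readings lie in the range of the matrix. Rank–nullity compares the dimensions.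
lemma blockRank_le_rank_omegaMat (hY : Submodule.span ℂ (Set.range Y) = blockAlg A s)
    (hX : Submodule.span ℂ (Set.range X) = blockAlg A s) :
    ω.blockRank s s ≤ (omegaMat Y X (ω.density (s + s))).rank := by
  rw [TIState.blockRank_eq]
  have hYm : ∀ j, Y j ∈ blockAlg A s := fun j => hY ▸ Submodule.subset_span ⟨j, rfl⟩
  let T : (blockAlg A s → ℂ) →ₗ[ℂ] (κ → ℂ) := LinearMap.funLeft ℂ ℂ fun j => ⟨Y j, hYm j⟩
  have hker : LinearMap.ker (T ∘ₗ ω.blockMap s s) ≤ LinearMap.ker (ω.blockMap s s) := by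
    intro V hV
    rw [LinearMap.mem_ker] at hV ⊢
    funext ⟨W, hW⟩
    change ω.pairing s s W V.1 = 0
    have h1 : Submodule.span ℂ (Set.range Y) ≤ LinearMap.ker ((ω.pairing s s).flip V.1) := by
      rw [Submodule.span_le]
      rintro _ ⟨j, rfl⟩
      exact congrFun hV j
    exact h1 (hY ▸ hW)
  have hrange : LinearMap.range (T ∘ₗ ω.blockMap s s) ≤
      LinearMap.range (omegaMat Y X (ω.density (s + s))).mulVecLin := by
    rintro _ ⟨⟨V, hV⟩, rfl⟩
    rw [← hX, Submodule.mem_span_range_iff_exists_fun] at hV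
    obtain ⟨u, rfl⟩ := hV
    refine ⟨u, ?_⟩
    funext j
    rw [Matrix.mulVecLin_apply, omegaMat_mulVec]
    rfl
  have h1 := LinearMap.finrank_range_add_finrank_ker (ω.blockMap s s)
  have h2 := LinearMap.finrank_range_add_finrank_ker (T ∘ₗ ω.blockMap s s)
  have h3 := Submodule.finrank_mono hker
  have h4 := Submodule.finrank_mono hrange
  rw [Matrix.rank]
  omega

/-- The range of the matrix lies in the image of the space of left functionals under evaluation on
`Y`. -/
lemma rank_omegaMat_le_rank [Module.Finite ℂ ω.hankelSpace] (hY : ∀ j, Y j ∈ blockAlg A s)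
    (hX : ∀ i, X i ∈ blockAlg A s) :
    (omegaMat Y X (ω.density (s + s))).rank ≤ ω.rank := by
  let T : ((a : ℕ) → blockAlg A a → ℂ) →ₗ[ℂ] (κ → ℂ) :=
    LinearMap.funLeft ℂ ℂ (fun j => (⟨Y j, hY j⟩ : blockAlg A s)) ∘ₗ LinearMap.proj s
  have h : LinearMap.range (omegaMat Y X (ω.density (s + s))).mulVecLin ≤
      ω.hankelSpace.map T := by
    rintro _ ⟨u, rfl⟩
    refine ⟨_, ω.leftFunctional_mem ⟨∑ i, u i • X i,
      Submodule.sum_mem _ fun i _ => Submodule.smul_mem _ _ (hX i)⟩, ?_⟩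
    funext j
    rw [Matrix.mulVecLin_apply, omegaMat_mulVec]
    rfl
  exact (Submodule.finrank_mono h).trans (Submodule.finrank_map_le _ _)

variable {ω} in
/-- Observables with the same memory vector induce the same functional on the left half chain. -/
lemma eval_join_congr [Module.Finite ℂ ω.hankelSpace] [Fintype κ] {μ : Type*} [Fintype μ]
    [DecidableEq μ] (hY : ∀ j, Y j ∈ blockAlg A s) (hX : ∀ i, X i ∈ blockAlg A s) {U : Matrix κ μ ℂ}
    {R : Matrix ι μ ℂ} (hR : Uᴴ * omegaMat Y X (ω.density (s + s)) * R = 1)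
    (hμ : Fintype.card μ = ω.rank) {b c : ℕ} {V : Matrix (Fin b → Fin d) (Fin b → Fin d) ℂ}
    {W : Matrix (Fin c → Fin d) (Fin c → Fin d) ℂ} (hV : V ∈ blockAlg A b) (hW : W ∈ blockAlg A c)
    (hVW : (Uᴴ *ᵥ fun j => ω.eval (join (Y j) V)) = Uᴴ *ᵥ fun j => ω.eval (join (Y j) W))
    {a : ℕ} {S : Matrix (Fin a → Fin d) (Fin a → Fin d) ℂ} (hS : S ∈ blockAlg A a) :
    ω.eval (join S V) = ω.eval (join S W) := by
  -- Memory coordinates of a left functional: surjective because `R` is a right inverse, hence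
  -- injective because both dimensions equal `ω.rank`.
  let T : ω.hankelSpace →ₗ[ℂ] (μ → ℂ) := Uᴴ.mulVecLin ∘ₗ
    LinearMap.funLeft ℂ ℂ (fun j => (⟨Y j, hY j⟩ : blockAlg A s)) ∘ₗ LinearMap.proj s ∘ₗ
      ω.hankelSpace.subtype
  have hsurj : Function.Surjective T := by
    intro v
    refine ⟨⟨_, ω.leftFunctional_mem ⟨∑ i, (R *ᵥ v) i • X i,
      Submodule.sum_mem _ fun i _ => Submodule.smul_mem _ _ (hX i)⟩⟩, ?_⟩
    change (Uᴴ *ᵥ fun j => ω.eval (join (Y j) (∑ i, (R *ᵥ v) i • X i))) = v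
    simp only [← omegaMat_mulVec]
    change Uᴴ *ᵥ (omegaMat Y X (ω.density (s + s)) *ᵥ (R *ᵥ v)) = v
    rw [Matrix.mulVec_mulVec, Matrix.mulVec_mulVec, hR, Matrix.one_mulVec]
  have hinj : Function.Injective T := by
    rw [LinearMap.injective_iff_surjective_of_finrank_eq_finrank]
    · exact hsurj
    · rw [← TIState.rank_eq, ← hμ, Module.finrank_pi]
  have h := hinj (a₁ := ⟨_, ω.leftFunctional_mem ⟨V, hV⟩⟩) (a₂ := ⟨_, ω.leftFunctional_mem ⟨W, hW⟩⟩)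
    hVW
  exact congrFun (congrFun (congrArg Subtype.val h) a) ⟨S, hS⟩

end Bases
end Rank

/-! ### Singular vectors and pseudoinverses under perturbation -/

section SingularVectors
open scoped Matrix.Norms.L2Operator

/-- The Euclidean norm of a vector of complex numbers. -/
def vecNorm {ι : Type*} [Fintype ι] (v : ι → ℂ) : ℝ := ‖(WithLp.toLp 2 v : EuclideanSpace ℂ ι)‖

variable {ι κ : Type*} [Fintype ι] [Fintype κ]

lemma vecNorm_nonneg (v : ι → ℂ) : 0 ≤ vecNorm v := norm_nonneg _

lemma vecNorm_sq (v : ι → ℂ) : vecNorm v ^ 2 = ∑ i, ‖v i‖ ^ 2 := EuclideanSpace.norm_sq_eq _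

lemma vecNorm_eq_sqrt (v : ι → ℂ) : vecNorm v = Real.sqrt (∑ i, ‖v i‖ ^ 2) :=
  EuclideanSpace.norm_eq _

lemma vecNorm_add_le (v w : ι → ℂ) : vecNorm (v + w) ≤ vecNorm v + vecNorm w :=
  norm_add_le (WithLp.toLp 2 v : EuclideanSpace ℂ ι) (WithLp.toLp 2 w)

lemma vecNorm_eq_zero {v : ι → ℂ} : vecNorm v = 0 ↔ v = 0 := by
  rw [vecNorm, norm_eq_zero]
  exact WithLp.toLp_eq_zero 2

lemma vecNorm_mulVec_le [DecidableEq κ] (A : Matrix ι κ ℂ) (v : κ → ℂ) :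
    vecNorm (A *ᵥ v) ≤ ‖A‖ * vecNorm v :=
  A.l2_opNorm_mulVec (WithLp.toLp 2 v)

/-- Serves for isometries (`l = 1`) and for `Mᴴ` restricted to left singular vectors, where `l`
holds the squared singular values. -/
lemma vecNorm_sq_mulVec_eq [DecidableEq κ] {B : Matrix ι κ ℂ} {l : κ → ℝ}
    (hB : Bᴴ * B = Matrix.diagonal fun j => (l j : ℂ)) (w : κ → ℂ) :
    vecNorm (B *ᵥ w) ^ 2 = ∑ j, l j * ‖w j‖ ^ 2 := by
  have key : ∀ {α : Type _} [Fintype α] (v : α → ℂ), ((vecNorm v ^ 2 : ℝ) : ℂ) = star v ⬝ᵥ v := by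
    intro α _ v
    rw [vecNorm_sq, dotProduct]
    push_cast
    exact Finset.sum_congr rfl fun i _ => by rw [← Complex.conj_mul']; rfl
  apply Complex.ofReal_injective
  rw [key, Matrix.star_mulVec, ← Matrix.dotProduct_mulVec, Matrix.mulVec_mulVec, hB, dotProduct]
  push_cast
  refine Finset.sum_congr rfl fun i _ => ?_
  rw [Matrix.mulVec_diagonal, Pi.star_apply, ← Complex.conj_mul']
  change star (w i) * (_ * w i) = _ * (star (w i) * w i)
  ring

/-- On the range of `T`, its adjoint is bounded below by the smallest nonzero singular value. -/
lemma singularValue_mul_norm_le {E F : Type*} [NormedAddCommGroup E] [InnerProductSpace ℂ E]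
    [FiniteDimensional ℂ E] [NormedAddCommGroup F] [InnerProductSpace ℂ F] [FiniteDimensional ℂ F]
    (T : E →ₗ[ℂ] F) (x : E) :
    T.singularValues (Module.finrank ℂ (LinearMap.range T) - 1) * ‖T x‖ ≤
      ‖LinearMap.adjoint T (T x)‖ := by
  set σ := T.singularValues (Module.finrank ℂ (LinearMap.range T) - 1) with hσ
  have hσ0 : 0 ≤ σ := T.singularValues_nonneg _
  set b := T.isSymmetric_adjoint_comp_self.eigenvectorBasis rfl with hb
  set l := T.isSymmetric_adjoint_comp_self.eigenvalues rfl with hl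
  have hl0 : ∀ i, 0 ≤ l i := T.isPositive_adjoint_comp_self.nonneg_eigenvalues rfl
  -- Singular values decrease: indices below the rank give at least `σ`, all others zero. At rank
  -- zero the truncated index does no harm, since only the first alternative occurs.
  have hlσ : ∀ i, l i = 0 ∨ σ ^ 2 ≤ l i := by
    intro i
    rw [hl, ← T.sq_singularValues_fin rfl]
    by_cases hi : (i : ℕ) < Module.finrank ℂ (LinearMap.range T)
    · right
      exact pow_le_pow_left₀ hσ0 (T.singularValues_antitone (by omega)) 2
    · left
      rw [T.singularValues_eq_zero_iff_le_finrank_range.2 (not_lt.1 hi)]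
      norm_num
  have hcoord : ∀ i, b.repr (LinearMap.adjoint T (T x)) i = (l i : ℂ) * b.repr x i := fun i =>
    T.isSymmetric_adjoint_comp_self.eigenvectorBasis_apply_self_apply rfl x i
  have h1 : ‖LinearMap.adjoint T (T x)‖ ^ 2 = ∑ i, l i ^ 2 * ‖b.repr x i‖ ^ 2 := by
    rw [← b.repr.norm_map, EuclideanSpace.norm_sq_eq]
    refine Finset.sum_congr rfl fun i _ => ?_
    rw [hcoord, norm_mul, Complex.norm_real, mul_pow, Real.norm_eq_abs, sq_abs]
  have h2 : ‖T x‖ ^ 2 = ∑ i, l i * ‖b.repr x i‖ ^ 2 := by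
    apply Complex.ofReal_injective
    push_cast
    rw [← RCLike.ofReal_eq_complex_ofReal, ← inner_self_eq_norm_sq_to_K (𝕜 := ℂ), ← LinearMap.adjoint_inner_right,
      ← b.repr.inner_map_map, PiLp.inner_apply]
    refine Finset.sum_congr rfl fun i _ => ?_
    rw [hcoord, RCLike.inner_apply, mul_assoc]
    exact congrArg _ (Complex.mul_conj' _)
  refine le_of_sq_le_sq ?_ (norm_nonneg _)
  rw [mul_pow, h1, h2, Finset.mul_sum]
  refine Finset.sum_le_sum fun i _ => ?_
  rcases hlσ i with h | h
  · simp [h]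
  · rw [← mul_assoc, sq (l i)]
    exact mul_le_mul_of_nonneg_right (mul_le_mul_of_nonneg_right h (hl0 i)) (sq_nonneg _)

lemma rank_eq_finrank_range_toEuclideanLin [DecidableEq ι] (M : Matrix κ ι ℂ) :
    M.rank = Module.finrank ℂ (LinearMap.range (Matrix.toEuclideanLin M)) := by
  classical
  rw [Matrix.toEuclideanLin_eq_toLin_orthonormal]
  exact Matrix.rank_eq_finrank_range_toLin _ _ _

lemma singularValue_mul_vecNorm_le [DecidableEq ι] (M : Matrix κ ι ℂ) (x : ι → ℂ) :
    (Matrix.toEuclideanLin M).singularValues (M.rank - 1) * vecNorm (M *ᵥ x) ≤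
      vecNorm (Mᴴ *ᵥ (M *ᵥ x)) := by
  classical
  have h := singularValue_mul_norm_le (Matrix.toEuclideanLin M) (WithLp.toLp 2 x)
  rw [← Matrix.toEuclideanLin_conjTranspose_eq_adjoint] at h
  rw [rank_eq_finrank_range_toEuclideanLin]
  exact h

variable [DecidableEq κ]

/-- The eigenvalues of `M Mᴴ`. -/
abbrev sqSV (M : Matrix κ ι ℂ) : κ → ℝ := (Matrix.isHermitian_mul_conjTranspose_self M).eigenvalues

/-- The left singular vectors of `M`. -/
abbrev leftSV (M : Matrix κ ι ℂ) : Matrix κ κ ℂ :=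
  ((Matrix.isHermitian_mul_conjTranspose_self M).eigenvectorUnitary : Matrix κ κ ℂ)

lemma leftSV_conjTranspose_mul (M : Matrix κ ι ℂ) : (leftSV M)ᴴ * leftSV M = 1 :=
  Unitary.coe_star_mul_self _

lemma leftSV_mul_conjTranspose (M : Matrix κ ι ℂ) : leftSV M * (leftSV M)ᴴ = 1 :=
  Unitary.coe_mul_star_self _

lemma leftSV_diagonalizes (M : Matrix κ ι ℂ) :
    (Mᴴ * leftSV M)ᴴ * (Mᴴ * leftSV M) = Matrix.diagonal fun j => (sqSV M j : ℂ) := by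
  have h := (Matrix.isHermitian_mul_conjTranspose_self M).conjStarAlgAut_star_eigenvectorUnitary
  rw [Unitary.conjStarAlgAut_star_apply] at h
  rw [Matrix.conjTranspose_mul, Matrix.conjTranspose_conjTranspose, ← Matrix.mul_assoc,
    Matrix.mul_assoc _ M]
  exact h

lemma sqSV_nonneg (M : Matrix κ ι ℂ) (j : κ) : 0 ≤ sqSV M j :=
  (Matrix.posSemidef_self_mul_conjTranspose M).eigenvalues_nonneg j

lemma truncU_conjTranspose_mul (M : Matrix κ ι ℂ) (η : ℝ) : (truncU M η)ᴴ * truncU M η = 1 := by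
  have h : (truncU M η)ᴴ * truncU M η = ((leftSV M)ᴴ * leftSV M).submatrix (fun j => j.1) fun j => j.1 := by
    ext i j
    simp [Matrix.mul_apply, truncU]
  rw [h, leftSV_conjTranspose_mul]
  exact Matrix.submatrix_one _ Subtype.val_injective

lemma truncU_diagonalizes (M : Matrix κ ι ℂ) (η : ℝ) :
    (Mᴴ * truncU M η)ᴴ * (Mᴴ * truncU M η) = Matrix.diagonal fun j => (sqSV M j.1 : ℂ) := by
  have h : (Mᴴ * truncU M η)ᴴ * (Mᴴ * truncU M η) =
      ((Mᴴ * leftSV M)ᴴ * (Mᴴ * leftSV M)).submatrix (fun j => j.1) fun j => j.1 := by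
    ext i j
    simp [Matrix.mul_apply, truncU]
  rw [h, leftSV_diagonalizes]
  exact Matrix.submatrix_diagonal _ _ Subtype.val_injective

/-- At least `rank M` singular values of `M'` are at least `c`, if `c` is less than the smallest
nonzero singular value of `M` by more than the distance of `M` and `M'`. -/
lemma rank_le_card_largeSV [DecidableEq ι] {M M' : Matrix κ ι ℂ} {c p : ℝ} (hc : 0 ≤ c)
    (hp : ‖(M' - M)ᴴ‖ ≤ p)
    (h : c + p < (Matrix.toEuclideanLin M).singularValues (M.rank - 1)) :
    M.rank ≤ Fintype.card (LargeSV M' c) := by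
  by_contra! hlt
  -- With fewer large singular vectors than `M.rank`, some nonzero `u` in the range of `M` is
  -- orthogonal to all of them. Then `‖M'ᴴ u‖ ≤ c ‖u‖`, against the lower bound for `Mᴴ` on that
  -- range.
  let f : LinearMap.range M.mulVecLin →ₗ[ℂ] (LargeSV M' c → ℂ) :=
    LinearMap.funLeft ℂ ℂ (fun j => j.1) ∘ₗ ((leftSV M')ᴴ).mulVecLin ∘ₗ
      (LinearMap.range M.mulVecLin).subtype
  have hf : Module.finrank ℂ (LargeSV M' c → ℂ) <
      Module.finrank ℂ (LinearMap.range M.mulVecLin) := by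
    rw [Module.finrank_pi]; exact hlt
  obtain ⟨⟨_, x, rfl⟩, hu, hu0⟩ := Submodule.exists_mem_ne_zero_of_ne_bot
    (LinearMap.ker_ne_bot_of_finrank_lt hf (f := f))
  set u := M *ᵥ x with hu_def
  have hu1 : u ≠ 0 := fun h0 => hu0 (Subtype.ext h0)
  have hpos : 0 < vecNorm u := (vecNorm_nonneg u).lt_of_ne' fun h0 => hu1 (vecNorm_eq_zero.1 h0)
  set w := (leftSV M')ᴴ *ᵥ u with hw
  have hw0 : ∀ j : LargeSV M' c, w j.1 = 0 := fun j => congrFun (LinearMap.mem_ker.1 hu) j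
  have huw : u = leftSV M' *ᵥ w := by
    rw [hw, Matrix.mulVec_mulVec, leftSV_mul_conjTranspose, Matrix.one_mulVec]
  have h1 : vecNorm u ^ 2 = ∑ j, ‖w j‖ ^ 2 := by
    rw [huw, vecNorm_sq_mulVec_eq (l := fun _ => 1)]
    · simp
    · rw [leftSV_conjTranspose_mul]; simp
  have h2 : vecNorm (M'ᴴ *ᵥ u) ^ 2 = ∑ j, sqSV M' j * ‖w j‖ ^ 2 := by
    rw [huw, Matrix.mulVec_mulVec, vecNorm_sq_mulVec_eq (leftSV_diagonalizes M')]
  have h3 : vecNorm (M'ᴴ *ᵥ u) ≤ c * vecNorm u := by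
    refine le_of_sq_le_sq ?_ (mul_nonneg hc hpos.le)
    rw [mul_pow, h1, h2, Finset.mul_sum]
    refine Finset.sum_le_sum fun j _ => ?_
    by_cases hj : c ≤ Real.sqrt (sqSV M' j)
    · simp [hw0 ⟨j, hj⟩]
    · refine mul_le_mul_of_nonneg_right ?_ (sq_nonneg _)
      rw [← Real.sq_sqrt (sqSV_nonneg M' j)]
      exact pow_le_pow_left₀ (Real.sqrt_nonneg _) (not_le.1 hj).le 2
  have h4 := singularValue_mul_vecNorm_le M x
  have h5 : vecNorm (Mᴴ *ᵥ u) ≤ vecNorm (M'ᴴ *ᵥ u) + p * vecNorm u := by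
    have h6 : Mᴴ *ᵥ u = M'ᴴ *ᵥ u + (-(M' - M)ᴴ) *ᵥ u := by
      rw [← Matrix.add_mulVec, Matrix.conjTranspose_sub]; congr 1; abel
    rw [h6]
    refine (vecNorm_add_le _ _).trans (add_le_add_right ((vecNorm_mulVec_le _ _).trans ?_) _)
    rw [norm_neg]
    exact mul_le_mul_of_nonneg_right hp hpos.le
  have h7 := mul_lt_mul_of_pos_right h hpos
  rw [← hu_def] at h4
  linarith

/-- On the span of the retained vectors `M'ᴴ` is bounded below by `η`, more than the perturbation
can account for, so `Mᴴ` is injective there. -/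
lemma card_largeSV_le_rank {M M' : Matrix κ ι ℂ} {η p : ℝ}
    (hp : ‖(M' - M)ᴴ‖ ≤ p) (hη : p < η) : Fintype.card (LargeSV M' η) ≤ M.rank := by
  have hη0 : 0 ≤ η := ((norm_nonneg _).trans hp).trans hη.le
  have hinj : Function.Injective (Mᴴ * truncU M' η).mulVecLin := by
    rw [injective_iff_map_eq_zero]
    intro v hv
    rw [Matrix.mulVecLin_apply, ← Matrix.mulVec_mulVec] at hv
    set u := truncU M' η *ᵥ v with hu
    have h1 : vecNorm u = vecNorm v := by
      rw [← sq_eq_sq₀ (vecNorm_nonneg _) (vecNorm_nonneg _), hu,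
        vecNorm_sq_mulVec_eq (l := fun _ => 1), vecNorm_sq]
      · simp
      · rw [truncU_conjTranspose_mul]; simp
    have h2 : η * vecNorm v ≤ vecNorm (M'ᴴ *ᵥ u) := by
      refine le_of_sq_le_sq ?_ (vecNorm_nonneg _)
      rw [hu, Matrix.mulVec_mulVec, vecNorm_sq_mulVec_eq (truncU_diagonalizes M' η), mul_pow,
        vecNorm_sq, Finset.mul_sum]
      refine Finset.sum_le_sum fun j _ => mul_le_mul_of_nonneg_right ?_ (sq_nonneg _)
      rw [← Real.sq_sqrt (sqSV_nonneg M' j.1)]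
      exact pow_le_pow_left₀ hη0 j.2 2
    have h3 : M'ᴴ *ᵥ u = (M' - M)ᴴ *ᵥ u := by
      rw [Matrix.conjTranspose_sub, Matrix.sub_mulVec, hv, sub_zero]
    rw [h3] at h2
    have h4 := h2.trans ((vecNorm_mulVec_le _ _).trans
      (mul_le_mul_of_nonneg_right hp (vecNorm_nonneg _)))
    rw [h1] at h4
    have h5 := vecNorm_nonneg v
    refine vecNorm_eq_zero.1 (le_antisymm ?_ h5)
    nlinarith
  have h := LinearMap.finrank_range_of_inj hinj
  rw [Module.finrank_pi] at h
  rw [← h, ← Matrix.rank_conjTranspose M]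
  exact Matrix.rank_mul_le_left _ _

lemma isPseudoinverse_pinv {μ ν : Type*} [Fintype μ] [Fintype ν] {G : Matrix μ ν ℂ}
    {P : Matrix ν μ ℂ} (h : IsPseudoinverse G P) : IsPseudoinverse G (pinv G) :=
  Classical.epsilon_spec (p := IsPseudoinverse G) ⟨P, h⟩

/-- The pseudoinverse of a matrix with orthogonal rows bounded below. -/
lemma mul_pinv_eq_one {μ ν : Type*} [Fintype μ] [Fintype ν] [DecidableEq μ] [DecidableEq ν]
    {G : Matrix μ ν ℂ} {l : μ → ℝ} (hG : G * Gᴴ = Matrix.diagonal fun j => (l j : ℂ)) {c : ℝ}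
    (hc : 0 < c) (hl : ∀ j, c ^ 2 ≤ l j) : G * pinv G = 1 ∧ ‖pinv G‖ ≤ 1 / c := by
  have hl0 : ∀ j, (l j : ℂ) ≠ 0 := fun j => by
    have := (pow_pos hc 2).trans_le (hl j)
    exact_mod_cast this.ne'
  set E : Matrix μ μ ℂ := Matrix.diagonal fun j => ((l j : ℂ))⁻¹ with hE
  have hGE : G * Gᴴ * E = 1 := by
    rw [hG, hE, Matrix.diagonal_mul_diagonal, ← Matrix.diagonal_one]
    congr 1
    funext j
    exact mul_inv_cancel₀ (hl0 j)
  have hEG : E * (G * Gᴴ) = 1 := mul_eq_one_comm.1 hGE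
  have hEh : Eᴴ = E := by
    rw [hE, Matrix.diagonal_conjTranspose]
    congr 1
    funext j
    simp
  -- `pinv` is a choice, so it satisfies the Penrose equations only once some pseudoinverse is
  -- exhibited.
  have hps : IsPseudoinverse G (Gᴴ * E) := by
    refine ⟨?_, ?_, ?_, ?_⟩
    · rw [← Matrix.mul_assoc, hGE, Matrix.one_mul]
    · rw [Matrix.mul_assoc _ G, ← Matrix.mul_assoc G, hGE, Matrix.mul_one]
    · rw [← Matrix.mul_assoc, hGE]; exact Matrix.isHermitian_one
    · rw [Matrix.IsHermitian, Matrix.conjTranspose_mul, Matrix.conjTranspose_mul, hEh,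
        Matrix.conjTranspose_conjTranspose, Matrix.mul_assoc]
  obtain ⟨h1, h2, -, h4⟩ := isPseudoinverse_pinv hps
  set P := pinv G with hP
  have hGP : G * P = 1 := by
    have h := congrArg (fun T => T * (Gᴴ * E)) h1
    simp only [Matrix.mul_assoc] at h
    simpa only [← Matrix.mul_assoc, hGE, Matrix.mul_one] using h
  refine ⟨hGP, ?_⟩
  -- The Penrose equations give `Pᴴ P = (G Gᴴ)⁻¹ = E`, and the `C*`-identity turns this into the
  -- norm of `P`.
  have h5 : P = Gᴴ * (Pᴴ * P) := by
    rw [← Matrix.mul_assoc, ← Matrix.conjTranspose_mul, h4.eq, h2]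
  have h6 : Pᴴ * P = E := by
    have h7 : G * Gᴴ * (Pᴴ * P) = 1 := by rw [Matrix.mul_assoc, ← h5, hGP]
    rw [← Matrix.one_mul (Pᴴ * P), ← hEG, Matrix.mul_assoc, h7, Matrix.mul_one]
  have h7 : ‖P‖ * ‖P‖ ≤ (1 / c) ^ 2 := by
    rw [← Matrix.l2_opNorm_conjTranspose_mul_self, h6, hE, Matrix.l2_opNorm_diagonal]
    refine (pi_norm_le_iff_of_nonneg (by positivity)).2 fun j => ?_
    have hlj := (pow_pos hc 2).trans_le (hl j)
    rw [norm_inv, Complex.norm_real, Real.norm_of_nonneg hlj.le, one_div, inv_pow]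
    exact inv_anti₀ (pow_pos hc 2) (hl j)
  rw [← sq] at h7
  exact le_of_sq_le_sq h7 (by positivity)

/-- A right inverse of a small perturbation. -/
lemma exists_right_inverse {μ ν : Type*} [Fintype μ] [Fintype ν] [DecidableEq μ] [DecidableEq ν]
    {G G' : Matrix μ ν ℂ} {P : Matrix ν μ ℂ} (hP : G' * P = 1) {p σ : ℝ} (hσ : 0 < σ)
    (hGG : ‖G' - G‖ ≤ p) (hPn : ‖P‖ ≤ 4 / (3 * σ)) (hp : p ≤ σ / 4) :
    ∃ R : Matrix ν μ ℂ, G * R = 1 ∧ ‖R‖ ≤ 2 / σ ∧ ‖P - R‖ ≤ 8 * p / (3 * σ ^ 2) := by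
  have hp0 : 0 ≤ p := (norm_nonneg _).trans hGG
  set N := (G' - G) * P with hN
  -- So `R = P (1 - N)⁻¹` is a right inverse of `G`; `‖N‖ ≤ 1/3` gives `‖R‖ ≤ (3/2) ‖P‖ ≤ 2/σ`.
  have hGP : G * P = 1 - N := by rw [hN, Matrix.sub_mul, hP]; abel
  have hNn : ‖N‖ ≤ p * (4 / (3 * σ)) :=
    (Matrix.l2_opNorm_mul _ _).trans (mul_le_mul hGG hPn (norm_nonneg _) hp0)
  have hN3 : ‖N‖ ≤ 1 / 3 := by
    refine hNn.trans ?_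
    calc p * (4 / (3 * σ)) ≤ σ / 4 * (4 / (3 * σ)) := by gcongr
      _ = 1 / 3 := by field_simp
  have : CompleteSpace (Matrix μ μ ℂ) := FiniteDimensional.complete ℂ _
  obtain ⟨V, hV⟩ := isUnit_one_sub_of_norm_lt_one (lt_of_le_of_lt hN3 (by norm_num))
  have hVi : (1 - N) * (↑V⁻¹ : Matrix μ μ ℂ) = 1 := by rw [← hV]; exact V.mul_inv
  have hVi' : (↑V⁻¹ : Matrix μ μ ℂ) * (1 - N) = 1 := by rw [← hV]; exact V.inv_mul
  set R := P * (↑V⁻¹ : Matrix μ μ ℂ) with hR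
  have hRN : P - R = -(R * N) := by
    have h1 : R * (1 - N) = P := by rw [hR, Matrix.mul_assoc, hVi', Matrix.mul_one]
    rw [Matrix.mul_sub, Matrix.mul_one] at h1
    rw [← h1]; abel
  have hPR : ‖P - R‖ ≤ ‖R‖ * ‖N‖ := by
    rw [hRN, norm_neg]; exact Matrix.l2_opNorm_mul _ _
  have hRn : ‖R‖ ≤ 2 / σ := by
    have h1 : ‖R‖ ≤ ‖P‖ + ‖P - R‖ := by
      calc ‖R‖ = ‖P - (P - R)‖ := by congr 1; abel
        _ ≤ _ := norm_sub_le _ _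
    have h2 : ‖R‖ * ‖N‖ ≤ ‖R‖ * (1 / 3) := mul_le_mul_of_nonneg_left hN3 (norm_nonneg _)
    have h3 : 2 / σ = 3 / 2 * (4 / (3 * σ)) := by field_simp; norm_num
    rw [h3]
    linarith
  refine ⟨R, by rw [hR, ← Matrix.mul_assoc, hGP, hVi], hRn, hPR.trans ?_⟩
  calc ‖R‖ * ‖N‖ ≤ 2 / σ * (p * (4 / (3 * σ))) :=
        mul_le_mul hRn hNn (norm_nonneg _) (by positivity)
    _ = 8 * p / (3 * σ ^ 2) := by field_simp; ring

lemma opNorm_truncU_le (M : Matrix κ ι ℂ) (η : ℝ) : ‖truncU M η‖ ≤ 1 := by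
  refine opNorm_le_of_sum_sq zero_le_one fun v => le_of_eq ?_
  rw [← vecNorm_sq, vecNorm_sq_mulVec_eq (l := fun _ => 1)]
  · simp
  · rw [truncU_conjTranspose_mul]; simp

/-- Truncated singular vectors of a perturbation of a matrix `M` of known rank. -/
lemma truncU_spec [DecidableEq ι] {M M' : Matrix κ ι ℂ} {σ η p : ℝ}
    (hσ : σ = (Matrix.toEuclideanLin M).singularValues (M.rank - 1)) (hσ0 : 0 < σ)
    (hM : ‖M' - M‖ ≤ p) (hp : p < σ / 4) (hpη : p < η) (hη : η ≤ σ / 2) :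
    Fintype.card (LargeSV M' η) = M.rank ∧
      ‖pinv ((truncU M' η)ᴴ * M')‖ ≤ 4 / (3 * σ) ∧
      ∃ R : Matrix ι (LargeSV M' η) ℂ, (truncU M' η)ᴴ * M * R = 1 ∧ ‖R‖ ≤ 2 / σ ∧
        ‖pinv ((truncU M' η)ᴴ * M') - R‖ ≤ 8 * p / (3 * σ ^ 2) := by
  have hM' : ‖(M' - M)ᴴ‖ ≤ p := by rwa [Matrix.l2_opNorm_conjTranspose]
  have hle := card_largeSV_le_rank hM' hpη
  -- At `c = 3σ/4` the gap `c + p < σ` remains. With `hle`, every singular value retained at `η` is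
  -- then at least `3σ/4`, so the bound on the pseudoinverse does not depend on `η`.
  have hge := rank_le_card_largeSV (c := 3 * σ / 4) (by positivity) hM' (by rw [← hσ]; linarith)
  have hsub : ∀ j, 3 * σ / 4 ≤ Real.sqrt (sqSV M' j) → η ≤ Real.sqrt (sqSV M' j) := fun j h => by
    linarith
  let emb : LargeSV M' (3 * σ / 4) → LargeSV M' η := fun j => ⟨j.1, hsub j.1 j.2⟩
  have hemb : Function.Injective emb := fun i j h => Subtype.ext (congrArg (fun x => x.1) h)
  have hcard := Fintype.card_le_of_injective emb hemb
  have hsurj : Function.Surjective emb :=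
    ((Fintype.bijective_iff_injective_and_card emb).2 ⟨hemb, by omega⟩).2
  have hlarge : ∀ j : LargeSV M' η, (3 * σ / 4) ^ 2 ≤ sqSV M' j.1 := by
    intro j
    obtain ⟨i, rfl⟩ := hsurj j
    rw [← Real.sq_sqrt (sqSV_nonneg M' i.1)]
    exact pow_le_pow_left₀ (by positivity) i.2 2
  have hdiag := truncU_diagonalizes M' η
  rw [Matrix.conjTranspose_mul, Matrix.conjTranspose_conjTranspose] at hdiag
  obtain ⟨h1, h2⟩ := mul_pinv_eq_one (G := (truncU M' η)ᴴ * M') (l := fun j => sqSV M' j.1)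
    (by rw [Matrix.conjTranspose_mul, Matrix.conjTranspose_conjTranspose]; exact hdiag)
    (c := 3 * σ / 4) (by positivity) hlarge
  have h3 : 1 / (3 * σ / 4) = 4 / (3 * σ) := by field_simp
  rw [h3] at h2
  refine ⟨by omega, h2, exists_right_inverse h1 hσ0 ?_ h2 hp.le⟩
  rw [← Matrix.mul_sub]
  refine (Matrix.l2_opNorm_mul _ _).trans ?_
  rw [Matrix.l2_opNorm_conjTranspose]
  calc ‖truncU M' η‖ * ‖M' - M‖ ≤ 1 * p :=
        mul_le_mul (opNorm_truncU_le _ _) hM (norm_nonneg _) zero_le_one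
    _ = p := one_mul p

end SingularVectors
-- Memory vectors, their densities and one-site contractions
section Memory
open scoped Matrix.Norms.L2Operator

lemma vecNorm_star {ι : Type*} [Fintype ι] (v : ι → ℂ) : vecNorm (star v) = vecNorm v := by
  simp [vecNorm_eq_sqrt]

lemma vecNorm_vecMul_le {ι κ : Type*} [Fintype ι] [Fintype κ] [DecidableEq ι] [DecidableEq κ]
    (v : κ → ℂ) (M : Matrix κ ι ℂ) : vecNorm (v ᵥ* M) ≤ vecNorm v * ‖M‖ := by
  rw [← vecNorm_star, Matrix.star_vecMul, ← vecNorm_star v, mul_comm,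
    ← Matrix.l2_opNorm_conjTranspose M]
  exact vecNorm_mulVec_le _ _

lemma IsSelfAdjointONB.trace_conjTranspose_mul {ι κ : Type*} [Fintype ι] [DecidableEq κ]
    {S : Submodule ℂ (Matrix ι ι ℂ)} {X : κ → Matrix ι ι ℂ} (h : IsSelfAdjointONB S X) (i j : κ) :
    ((X i)ᴴ * X j).trace = if i = j then 1 else 0 := by
  rw [(h.selfAdjoint i).eq, h.orthonormal]

lemma IsSelfAdjointONB.mem {ι κ : Type*} [Fintype ι] [DecidableEq κ]
    {S : Submodule ℂ (Matrix ι ι ℂ)} {X : κ → Matrix ι ι ℂ} (h : IsSelfAdjointONB S X) (i : κ) :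
    X i ∈ S := h.span ▸ Submodule.subset_span ⟨i, rfl⟩

section SiteContract
variable {δ γ : Type*} [Fintype δ] [Fintype γ]

/-- The partial trace of `(z ⊗ 1) S` over the first factor. -/
def siteContract (z : Matrix δ δ ℂ) (S : Matrix (δ × γ) (δ × γ) ℂ) : Matrix γ γ ℂ :=
  Matrix.of fun g' g => ∑ x', ∑ x, z x x' * S (x', g') (x, g)

lemma trace_kronecker_mul_eq_siteContract (z : Matrix δ δ ℂ) (Q : Matrix γ γ ℂ)
    (S : Matrix (δ × γ) (δ × γ) ℂ) : ((z ⊗ₖ Q) * S).trace = (Q * siteContract z S).trace := by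
  simp only [Matrix.trace, Matrix.diag, Matrix.mul_apply, siteContract, Matrix.of_apply,
    Matrix.kroneckerMap_apply, Fintype.sum_prod_type, Finset.mul_sum]
  calc _ = ∑ g, ∑ x, ∑ x', ∑ g', z x x' * Q g g' * S (x', g') (x, g) := Finset.sum_comm
    _ = _ := by
      refine Finset.sum_congr rfl fun g _ => ?_
      calc _ = ∑ x, ∑ g', ∑ x', z x x' * Q g g' * S (x', g') (x, g) :=
            Finset.sum_congr rfl fun x _ => Finset.sum_comm
        _ = ∑ g', ∑ x, ∑ x', z x x' * Q g g' * S (x', g') (x, g) := Finset.sum_comm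
        _ = _ := Finset.sum_congr rfl fun g' _ => by
            rw [Finset.sum_comm]
            exact Finset.sum_congr rfl fun x _ => Finset.sum_congr rfl fun x' _ => by ring

/-- Bessel's inequality for the contraction of one site with an orthonormal family. -/
lemma sum_hsNorm_siteContract_sq_le [DecidableEq δ] [DecidableEq γ] {ζ α β : Type*} [Fintype ζ]
    [DecidableEq ζ] [Fintype α] [DecidableEq α] [Fintype β] {Z : ζ → Matrix δ δ ℂ}
    (hZ : ∀ i j, ((Z i)ᴴ * Z j).trace = if i = j then 1 else 0) (hZs : ∀ i, (Z i).IsHermitian)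
    (S : Matrix (δ × γ) (δ × γ) ℂ) (B : Matrix (α × γ) β ℂ) :
    ∑ k, hsNorm (((1 : Matrix α α ℂ) ⊗ₖ siteContract (Z k) S) * B) ^ 2 ≤
      Fintype.card δ * ‖S‖ ^ 2 * hsNorm B ^ 2 := by
  -- `w f y x` is the part of column `y` of `B` with first index `f`, placed at site value `x`. The
  -- images under `S` form the site matrices `N f g' y`, to which Bessel's inequality applies.
  let w : α → β → δ → δ × γ → ℂ := fun f y x p => if p.1 = x then B (f, p.2) y else 0
  let N : α → γ → β → Matrix δ δ ℂ := fun f g' y => Matrix.of fun x' x =>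
    (S *ᵥ w f y x) (x', g')
  have hent : ∀ k f g' y, (((1 : Matrix α α ℂ) ⊗ₖ siteContract (Z k) S) * B) (f, g') y =
      ((Z k)ᴴ * N f g' y).trace := by
    intro k f g' y
    rw [(hZs k).eq]
    simp only [Matrix.mul_apply, Fintype.sum_prod_type, Matrix.kroneckerMap_apply,
      Matrix.one_apply, siteContract, Matrix.of_apply, Matrix.trace, Matrix.diag, N, w,
      Matrix.mulVec, dotProduct, mul_ite, mul_zero]
    simp only [ite_mul, one_mul, zero_mul]
    rw [Finset.sum_eq_single f]
    · simp only [if_true, Finset.sum_mul]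
      have h1 : ∀ x x' : δ, (∑ x'' : δ, ∑ g : γ, if x'' = x then S (x', g') (x'', g) * B (f, g) y
          else 0) = ∑ g, S (x', g') (x, g) * B (f, g) y := by
        intro x x'
        rw [Finset.sum_comm]
        simp
      simp only [h1, Finset.mul_sum]
      calc _ = ∑ x', ∑ g, ∑ x, Z k x x' * S (x', g') (x, g) * B (f, g) y := Finset.sum_comm
        _ = ∑ x', ∑ x, ∑ g, Z k x x' * S (x', g') (x, g) * B (f, g) y :=
          Finset.sum_congr rfl fun x' _ => Finset.sum_comm
        _ = ∑ x, ∑ x', ∑ g, Z k x x' * S (x', g') (x, g) * B (f, g) y := Finset.sum_comm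
        _ = _ := Finset.sum_congr rfl fun x _ => Finset.sum_congr rfl fun x' _ =>
          Finset.sum_congr rfl fun g _ => by ring
    · intro f' _ hf'
      simp [hf'.symm]
    · simp
  have hw : ∀ f y x, ∑ p, ‖w f y x p‖ ^ 2 = ∑ g, ‖B (f, g) y‖ ^ 2 := by
    intro f y x
    simp only [w, Fintype.sum_prod_type_right]
    simp [apply_ite]
  calc ∑ k, hsNorm (((1 : Matrix α α ℂ) ⊗ₖ siteContract (Z k) S) * B) ^ 2
      = ∑ f, ∑ g', ∑ y, ∑ k, ‖((Z k)ᴴ * N f g' y).trace‖ ^ 2 := by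
        simp only [hsNorm_sq, Fintype.sum_prod_type, hent]
        rw [Finset.sum_comm]
        refine Finset.sum_congr rfl fun f _ => ?_
        rw [Finset.sum_comm]
        exact Finset.sum_congr rfl fun g' _ => Finset.sum_comm
    _ ≤ ∑ f, ∑ g', ∑ y, ∑ x', ∑ x, ‖N f g' y x' x‖ ^ 2 :=
        Finset.sum_le_sum fun f _ => Finset.sum_le_sum fun g' _ => Finset.sum_le_sum fun y _ =>
          sum_sq_trace_le hZ _
    _ = ∑ f, ∑ y, ∑ x, ∑ p, ‖(S *ᵥ w f y x) p‖ ^ 2 := by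
        refine Finset.sum_congr rfl fun f _ => ?_
        rw [Finset.sum_comm]
        refine Finset.sum_congr rfl fun y _ => ?_
        simp only [N, Matrix.of_apply, Fintype.sum_prod_type_right]
        calc _ = ∑ g' : γ, ∑ x : δ, ∑ x' : δ, ‖(S *ᵥ w f y x) (x', g')‖ ^ 2 :=
              Finset.sum_congr rfl fun g' _ => Finset.sum_comm
          _ = _ := Finset.sum_comm
    -- The bound does not depend on the site value `x`; summing over `x` gives the factor `card δ`.
    _ ≤ ∑ f, ∑ y, ∑ _x : δ, ‖S‖ ^ 2 * ∑ g, ‖B (f, g) y‖ ^ 2 :=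
        Finset.sum_le_sum fun f _ => Finset.sum_le_sum fun y _ => Finset.sum_le_sum fun x _ => by
          rw [← hw f y x]; exact sum_sq_mulVec_le _ _
    _ = Fintype.card δ * ‖S‖ ^ 2 * hsNorm B ^ 2 := by
        simp only [Finset.sum_const, Finset.card_univ, nsmul_eq_mul, hsNorm_sq,
          Fintype.sum_prod_type, ← Finset.mul_sum]
        rw [mul_assoc]
        congr 2
        exact Finset.sum_congr rfl fun f _ => Finset.sum_comm

end SiteContract

variable {d : ℕ} {A : StarSubalgebra ℂ (Matrix (Fin d) (Fin d) ℂ)} (ω : TIState A)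

lemma TIState.norm_eval_le {N : ℕ} (X : Matrix (Fin N → Fin d) (Fin N → Fin d) ℂ) :
    ‖ω.eval X‖ ≤ ‖X‖ :=
  norm_trace_density_mul_le (ω.posSemidef N) (ω.trace_one N) X

/-- With the density written as `Bᴴ B`, cyclicity gives `Tr (B (Y ⊗ 1) (1 ⊗ X) Bᴴ)`, and
Cauchy–Schwarz separates `Y` from `X`. Keeping a Hilbert–Schmidt norm on the side of `X` allows
Bessel's inequality over the letters later. -/
lemma TIState.exists_factor (a b : ℕ) :
    ∃ B : Matrix ((Fin a → Fin d) × (Fin b → Fin d)) ((Fin a → Fin d) × (Fin b → Fin d)) ℂ,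
      hsNorm B = 1 ∧ ∀ (Y : Matrix (Fin a → Fin d) (Fin a → Fin d) ℂ)
        (X : Matrix (Fin b → Fin d) (Fin b → Fin d) ℂ), ‖ω.eval (join Y X)‖ ≤
          ‖Y‖ * hsNorm (((1 : Matrix (Fin a → Fin d) (Fin a → Fin d) ℂ) ⊗ₖ X) * Bᴴ) := by
  obtain ⟨B, hB, hB1⟩ := exists_factor_of_density
    ((ω.posSemidef (a + b)).submatrix (Fin.appendEquiv a b)) (by
      have h := trace_submatrix_mul (Fin.appendEquiv a b) (ω.density (a + b)) 1
      rwa [Matrix.mul_one, Matrix.submatrix_one_equiv, Matrix.mul_one, ω.trace_one] at h)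
  refine ⟨B, hB1, fun Y X => ?_⟩
  have h1 : ω.eval (join Y X) = ((B * (Y ⊗ₖ 1)) * ((1 ⊗ₖ X) * Bᴴ)).trace := by
    rw [TIState.eval, trace_mul_join, hB, Matrix.mul_assoc, Matrix.mul_assoc, ← Matrix.mul_assoc _ _ Bᴴ,
      ← Matrix.mul_kronecker_mul, Matrix.mul_one, Matrix.one_mul, Matrix.trace_mul_comm,
      Matrix.mul_assoc]
  rw [h1]
  refine (norm_trace_mul_le _ _).trans (mul_le_mul_of_nonneg_right ?_ (hsNorm_nonneg _))
  calc hsNorm (B * (Y ⊗ₖ 1)) ≤ hsNorm B * ‖Y ⊗ₖ (1 : Matrix (Fin b → Fin d) (Fin b → Fin d) ℂ)‖ :=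
        hsNorm_mul_le_right _ _
    _ ≤ 1 * ‖Y‖ := by
        rw [hB1, one_mul, one_mul]; exact opNorm_kronecker_one_le Y
    _ = ‖Y‖ := one_mul _

variable {s : ℕ} {κ μ : Type*} [Fintype κ] [Fintype μ]
  (Y : κ → Matrix (Fin s → Fin d) (Fin s → Fin d) ℂ) (U : Matrix κ μ ℂ)

/-- The densities on `b` sites of the coordinates of the memory vector
`X ↦ Uᴴ (ω(Y j ⊗ X))_j`. -/
def memDensity (b : ℕ) (i : μ) : Matrix (Fin b → Fin d) (Fin b → Fin d) ℂ :=
  ∑ j, star (U j i) • ω.leftDensity (Y j) b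

omit [Fintype μ] in
lemma trace_memDensity_mul {b : ℕ} (i : μ) (V : Matrix (Fin b → Fin d) (Fin b → Fin d) ℂ) :
    (memDensity ω Y U b i * V).trace = (Uᴴ *ᵥ fun j => ω.eval (join (Y j) V)) i := by
  simp only [memDensity, Finset.sum_mul, Matrix.trace_sum, Matrix.smul_mul, Matrix.trace_smul,
    TIState.trace_leftDensity_mul, smul_eq_mul]
  rfl

omit [Fintype μ] in
lemma memDensity_mem {b : ℕ} (i : μ) : memDensity ω Y U b i ∈ blockAlg A b :=
  Submodule.sum_mem _ fun j _ => Submodule.smul_mem _ _ (ω.leftDensity_mem (Y j))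

omit [Fintype μ] in
lemma memDensity_zero (i : μ) : memDensity ω Y U 0 i =
    Matrix.of fun _ _ => (Uᴴ *ᵥ fun j => (ω.density s * Y j).trace) i := by
  have h := trace_memDensity_mul ω Y U i (1 : Matrix (Fin 0 → Fin d) (Fin 0 → Fin d) ℂ)
  simp only [TIState.eval_join_one_right] at h
  ext f g
  rw [Matrix.of_apply]
  refine Eq.trans ?_ h
  rw [Matrix.mul_one, Matrix.trace, Subsingleton.elim f g]
  simp only [Finset.univ_unique, Finset.sum_singleton, Matrix.diag]
  rw [Subsingleton.elim g default]

variable {Y U}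

/-- A combination of memory coordinates is the pairing with one left observable, so a bound on `v`
becomes a bound on that observable. -/
lemma sum_mul_trace_memDensity {b : ℕ} (v : μ → ℂ)
    (V : Matrix (Fin b → Fin d) (Fin b → Fin d) ℂ) :
    ∑ i, v i * (memDensity ω Y U b i * V).trace =
      ω.eval (join (∑ j, star (U *ᵥ star v) j • Y j) V) := by
  rw [← TIState.pairing_apply, map_sum, LinearMap.sum_apply]
  simp only [map_smul, LinearMap.smul_apply, TIState.pairing_apply, smul_eq_mul,
    trace_memDensity_mul, Matrix.mulVec, dotProduct, Finset.mul_sum, Pi.star_apply,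
    Matrix.conjTranspose_apply, star_sum, star_mul', star_star, Finset.sum_mul]
  rw [Finset.sum_comm]
  exact Finset.sum_congr rfl fun j _ => Finset.sum_congr rfl fun i _ => by ring

lemma vecNorm_star_mulVec_le [DecidableEq μ] (hU : ‖U‖ ≤ 1) (v : μ → ℂ) :
    vecNorm (star (U *ᵥ star v)) ≤ vecNorm v := by
  rw [vecNorm_star]
  refine (vecNorm_mulVec_le _ _).trans ?_
  rw [vecNorm_star]
  exact mul_le_of_le_one_left (vecNorm_nonneg _) hU

variable [DecidableEq κ] (hY : IsSelfAdjointONB (blockAlg A s) Y)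
include hY

lemma opNorm_sum_smul_le (w : κ → ℂ) : ‖∑ j, w j • Y j‖ ≤ vecNorm w := by
  refine (opNorm_le_hsNorm _).trans (le_of_sq_le_sq (le_of_eq ?_) (vecNorm_nonneg _))
  rw [hsNorm_sum_smul_sq hY.trace_conjTranspose_mul, vecNorm_sq]

lemma norm_sum_mul_trace_memDensity_le [DecidableEq μ] (hU : ‖U‖ ≤ 1) {b : ℕ} (v : μ → ℂ)
    (V : Matrix (Fin b → Fin d) (Fin b → Fin d) ℂ) :
    ‖∑ i, v i * (memDensity ω Y U b i * V).trace‖ ≤ vecNorm v * ‖V‖ := by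
  rw [sum_mul_trace_memDensity]
  refine (ω.norm_eval_le _).trans ((opNorm_join_le _ _).trans ?_)
  exact mul_le_mul_of_nonneg_right
    ((opNorm_sum_smul_le hY _).trans (vecNorm_star_mulVec_le hU v)) (norm_nonneg _)

/-- Each letter `k` pairs a left observable of norm at most `‖D k‖` with the contraction of `S` by
`Z k`. Cauchy–Schwarz over the letters and Bessel's inequality for the contractions leave only `√d`.
-/
lemma norm_trace_site_memDensity_le [DecidableEq μ] (hU : ‖U‖ ≤ 1) {ζ : Type*} [Fintype ζ]
    [DecidableEq ζ] {S₁ : Submodule ℂ (Matrix (Fin d) (Fin d) ℂ)}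
    {Z : ζ → Matrix (Fin d) (Fin d) ℂ} (hZ : IsSelfAdjointONB S₁ Z) (b : ℕ)
    (D : ζ → μ → ℂ) (S : Matrix (Fin d × (Fin b → Fin d)) (Fin d × (Fin b → Fin d)) ℂ) :
    ‖((∑ k, ∑ j, D k j • (Z k ⊗ₖ memDensity ω Y U b j)) * S).trace‖ ≤
      Real.sqrt d * Real.sqrt (∑ k, ∑ j, ‖D k j‖ ^ 2) * ‖S‖ := by
  obtain ⟨B, hB1, hB⟩ := ω.exists_factor s b
  have h1 : ((∑ k, ∑ j, D k j • (Z k ⊗ₖ memDensity ω Y U b j)) * S).trace =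
      ∑ k, ω.eval (join (∑ j, star (U *ᵥ star (D k)) j • Y j) (siteContract (Z k) S)) := by
    simp only [Finset.sum_mul, Matrix.trace_sum, Matrix.smul_mul, Matrix.trace_smul, smul_eq_mul,
      trace_kronecker_mul_eq_siteContract, ← sum_mul_trace_memDensity]
  have h2 := sum_hsNorm_siteContract_sq_le hZ.trace_conjTranspose_mul hZ.selfAdjoint S Bᴴ
  rw [hsNorm_conjTranspose, hB1, one_pow, mul_one, Fintype.card_fin] at h2
  rw [h1]
  calc _ ≤ ∑ k, vecNorm (D k) * hsNorm (((1 : Matrix (Fin s → Fin d) (Fin s → Fin d) ℂ) ⊗ₖ siteContract (Z k) S) * Bᴴ) := by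
        refine norm_sum_le_of_le _ fun k _ => (hB _ _).trans ?_
        exact mul_le_mul_of_nonneg_right
          ((opNorm_sum_smul_le hY _).trans (vecNorm_star_mulVec_le hU _)) (hsNorm_nonneg _)
    _ ≤ Real.sqrt (∑ k, vecNorm (D k) ^ 2) *
        Real.sqrt (∑ k, hsNorm (((1 : Matrix (Fin s → Fin d) (Fin s → Fin d) ℂ) ⊗ₖ siteContract (Z k) S) * Bᴴ) ^ 2) :=
        Real.sum_mul_le_sqrt_mul_sqrt _ _ _
    _ ≤ Real.sqrt (∑ k, ∑ j, ‖D k j‖ ^ 2) * Real.sqrt (d * ‖S‖ ^ 2) := by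
        simp only [vecNorm_sq]
        exact mul_le_mul_of_nonneg_left (Real.sqrt_le_sqrt h2) (Real.sqrt_nonneg _)
    _ = _ := by
        rw [Real.sqrt_mul (Nat.cast_nonneg d), Real.sqrt_sq (norm_nonneg _)]
        ring

omit hY [DecidableEq κ] in
lemma jointlyBounded_zero_of_forall {ζ : Type*} [Fintype ζ] {Z : ζ → Matrix (Fin d) (Fin d) ℂ}
    {K : ζ → Matrix μ μ ℂ} {v : μ → ℂ} {c : ℝ}
    (h : ∀ (b : ℕ) (V : Matrix (Fin b → Fin d) (Fin b → Fin d) ℂ),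
      ‖∑ i, v i * (memDensity ω Y U b i * V).trace‖ ≤ c * ‖V‖) :
    JointlyBounded (memDensity ω Y U) (rowDensity Z K v 0) c := by
  intro b V
  let e : (Fin 0 → Fin d) × (Fin b → Fin d) ≃ (Fin b → Fin d) := Equiv.uniqueProd _ _
  have h1 : ∑ i, rowDensity Z K v 0 i ⊗ₖ memDensity ω Y U b i =
      (∑ i, v i • memDensity ω Y U b i).submatrix e e := by
    ext x y
    simp only [rowDensity, Matrix.sum_apply, Matrix.kroneckerMap_apply, Matrix.of_apply,
      Matrix.submatrix_apply, Matrix.smul_apply, smul_eq_mul]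
    rfl
  rw [h1, trace_submatrix_mul, ← opNorm_submatrix_equiv e.symm V]
  have h2 := h b (V.submatrix e.symm e.symm)
  simpa only [Finset.sum_mul, Matrix.trace_sum, Matrix.smul_mul, Matrix.trace_smul,
    smul_eq_mul] using h2

end Memory
-- The exact realization in memory coordinates
section Reconstruction
open scoped Matrix.Norms.L2Operator

variable {d : ℕ} {A : StarSubalgebra ℂ (Matrix (Fin d) (Fin d) ℂ)}

lemma consKron_eq_submatrix {b : ℕ} (z : Matrix (Fin d) (Fin d) ℂ)
    (X : Matrix (Fin b → Fin d) (Fin b → Fin d) ℂ) :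
    consKron z X = (z ⊗ₖ X).submatrix (Fin.consEquiv fun _ => Fin d).symm
      (Fin.consEquiv fun _ => Fin d).symm := rfl

lemma trace_consKron_mul_consKron {b : ℕ} (z z' : Matrix (Fin d) (Fin d) ℂ)
    (X X' : Matrix (Fin b → Fin d) (Fin b → Fin d) ℂ) :
    (consKron z X * consKron z' X').trace = (z * z').trace * (X * X').trace := by
  rw [consKron_eq_submatrix, trace_submatrix_mul, consKron_eq_submatrix,
    Matrix.submatrix_submatrix, ← Matrix.trace_kronecker, Matrix.mul_kronecker_mul]
  simp

variable (ω : TIState A) {s : ℕ} {ζ κ ι μ : Type} [Fintype ζ] [DecidableEq ζ] [Fintype κ]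
  [DecidableEq κ] [Fintype ι] [DecidableEq ι] [Fintype μ] [DecidableEq μ]
  {Z : ζ → Matrix (Fin d) (Fin d) ℂ} {Y : κ → Matrix (Fin s → Fin d) (Fin s → Fin d) ℂ}
  {X : ι → Matrix (Fin s → Fin d) (Fin s → Fin d) ℂ} {U : Matrix κ μ ℂ} {R : Matrix ι μ ℂ}

/-- The observable on the right block with coordinates `R v`. -/
def liftObs (X : ι → Matrix (Fin s → Fin d) (Fin s → Fin d) ℂ) (R : Matrix ι μ ℂ) (v : μ → ℂ) :
    Matrix (Fin s → Fin d) (Fin s → Fin d) ℂ := ∑ i, (R *ᵥ v) i • X i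

omit [Fintype κ] [DecidableEq κ] [DecidableEq ι] [DecidableEq μ] in
lemma eval_join_liftObs (v : μ → ℂ) :
    (fun j => ω.eval (join (Y j) (liftObs X R v))) =
      omegaMat Y X (ω.density (s + s)) *ᵥ (R *ᵥ v) := by
  funext j
  rw [liftObs, omegaMat_mulVec]

omit [DecidableEq κ] [DecidableEq ι] in
lemma mulVec_eval_join_liftObs (hR : Uᴴ * omegaMat Y X (ω.density (s + s)) * R = 1) (v : μ → ℂ) :
    (Uᴴ *ᵥ fun j => ω.eval (join (Y j) (liftObs X R v))) = v := by
  rw [eval_join_liftObs, Matrix.mulVec_mulVec, Matrix.mulVec_mulVec, hR, Matrix.one_mulVec]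

lemma opNorm_liftObs_le (hX : IsSelfAdjointONB (blockAlg A s) X) (v : μ → ℂ) :
    ‖liftObs X R v‖ ≤ ‖R‖ * vecNorm v :=
  (opNorm_sum_smul_le hX _).trans (vecNorm_mulVec_le _ _)

section Shift
variable [Module.Finite ℂ ω.hankelSpace]
  (hZ : IsSelfAdjointONB (Subalgebra.toSubmodule A.toSubalgebra) Z)
  (hY : IsSelfAdjointONB (blockAlg A s) Y) (hX : IsSelfAdjointONB (blockAlg A s) X)
  (hR : Uᴴ * omegaMat Y X (ω.density (s + s)) * R = 1) (hμ : Fintype.card μ = ω.rank)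
include hY hX hR hμ

/-- An observable may be replaced by the one with the same memory vector on the right block. -/
lemma eval_join_eq_liftObs {a b : ℕ} {S : Matrix (Fin a → Fin d) (Fin a → Fin d) ℂ}
    (hS : S ∈ blockAlg A a) {V : Matrix (Fin b → Fin d) (Fin b → Fin d) ℂ}
    (hV : V ∈ blockAlg A b) : ω.eval (join S V) =
      ω.eval (join S (liftObs X R (Uᴴ *ᵥ fun j => ω.eval (join (Y j) V)))) := by
  refine eval_join_congr hY.mem hX.mem hR hμ hV
    (Submodule.sum_mem _ fun i _ => Submodule.smul_mem _ _ (hX.mem i)) ?_ hS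
  exact (mulVec_eval_join_liftObs ω hR _).symm

/-- `V` may be replaced by its lift to the right block, where `ω` is read off from the numbers
`ω(X_i)`. -/
lemma sum_smul_memDensity_eq (b : ℕ) :
    ∑ i, ((fun i => (ω.density s * X i).trace) ᵥ* R) i • memDensity ω Y U b i = ω.density b := by
  refine eq_of_forall_trace_mul_eq (A := A)
    (Submodule.sum_mem _ fun i _ => Submodule.smul_mem _ _ (memDensity_mem ω Y U i)) (ω.mem b)
    fun V hV => ?_
  -- The left observable is the unit on zero sites.
  have h1 := eval_join_eq_liftObs ω hY hX hR hμ (one_mem_blockAlg 0) hV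
  rw [TIState.eval_join_one_left, TIState.eval_join_one_left] at h1
  change _ = ω.eval V
  rw [h1]
  simp only [Finset.sum_mul, Matrix.trace_sum, Matrix.smul_mul, Matrix.trace_smul, smul_eq_mul,
    trace_memDensity_mul]
  change ((fun i => (ω.density s * X i).trace) ᵥ* R) ⬝ᵥ _ = _
  rw [← Matrix.dotProduct_mulVec, TIState.eval, liftObs, Finset.mul_sum, Matrix.trace_sum]
  simp only [Matrix.mul_smul, Matrix.trace_smul, smul_eq_mul, dotProduct]
  exact Finset.sum_congr rfl fun i _ => mul_comm _ _

include hZ in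
-- `Y_j ⊗ Z_k` is itself a left observable, so in `ω(Y_j ⊗ Z_k ⊗ V)` the observable `V` may be
-- replaced by its lift, with coordinates `R q(V)`. This gives `q(Z_k ⊗ V) = K_k q(V)`, which is
-- then dualized to densities.
lemma implementsShift_memDensity :
    ImplementsShift Z (memDensity ω Y U)
      (fun k => Uᴴ * omegaMatAt Y X (ω.density (s + 1 + s)) (Z k) * R) := by
  set K : ζ → Matrix μ μ ℂ := fun k => Uᴴ * omegaMatAt Y X (ω.density (s + 1 + s)) (Z k) * R with hK
  have hZA : ∀ k, Z k ∈ A := fun k => hZ.mem k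
  have hKq : ∀ (k : ζ) (b : ℕ) (V : Matrix (Fin b → Fin d) (Fin b → Fin d) ℂ), V ∈ blockAlg A b →
      (Uᴴ *ᵥ fun j => ω.eval (join (Y j) (consKron (Z k) V))) =
        K k *ᵥ (Uᴴ *ᵥ fun j => ω.eval (join (Y j) V)) := by
    intro k b V hV
    rw [hK, ← Matrix.mulVec_mulVec, ← Matrix.mulVec_mulVec]
    congr 1
    funext j
    have hS : join (Y j) (piKron fun _ : Fin 1 => Z k) ∈ blockAlg A (s + 1) :=
      join_mem_blockAlg (hY.mem j) (piKron_mem_blockAlg (A := A) fun _ => ⟨Z k, hZA k⟩)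
    rw [← TIState.eval_join_site, eval_join_eq_liftObs ω hY hX hR hμ hS hV, liftObs,
      ← TIState.pairing_apply, map_sum]
    simp only [map_smul, smul_eq_mul]
    exact Finset.sum_congr rfl fun i _ => mul_comm _ _
  intro b i
  have key : ∑ k, ∑ j, K k i j • consKron (Z k) (memDensity ω Y U b j) =
      memDensity ω Y U (b + 1) i := by
    refine eq_of_forall_trace_mul_eq (A := A) (Submodule.sum_mem _ fun k _ =>
      Submodule.sum_mem _ fun j _ => Submodule.smul_mem _ _
        (consKron_mem_blockAlg (hZA k) (memDensity_mem ω Y U j))) (memDensity_mem ω Y U i) ?_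
    intro V hV
    refine blockAlg_succ_induction (A := A) (P := fun V =>
      ((∑ k, ∑ j, K k i j • consKron (Z k) (memDensity ω Y U b j)) * V).trace =
        (memDensity ω Y U (b + 1) i * V).trace) ?_ ?_ ?_ ?_ hV
    · intro z hz V hV
      have hz' : z ∈ Submodule.span ℂ (Set.range Z) := by rw [hZ.span]; exact hz
      rw [Submodule.mem_span_range_iff_exists_fun] at hz'
      obtain ⟨c, rfl⟩ := hz'
      -- A self-adjoint orthonormal basis is its own dual under the trace pairing.
      have hc : ∀ k, (Z k * ∑ l, c l • Z l).trace = c k := by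
        intro k
        simp [Finset.mul_sum, Matrix.trace_sum, Matrix.trace_smul, hZ.orthonormal]
      have hcons : consKron (∑ l, c l • Z l) V = ∑ l, c l • consKron (Z l) V := by
        ext f f'
        simp only [consKron, Matrix.sum_apply, Matrix.smul_apply, Matrix.of_apply, smul_eq_mul,
          Finset.sum_mul, mul_assoc]
      have hL : ∀ k j, (consKron (Z k) (memDensity ω Y U b j) *
          consKron (∑ l, c l • Z l) V).trace =
            c k * (Uᴴ *ᵥ fun j => ω.eval (join (Y j) V)) j := fun k j => by
        rw [trace_consKron_mul_consKron, hc, trace_memDensity_mul]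
      simp only [Finset.sum_mul, Matrix.trace_sum, Matrix.smul_mul, Matrix.trace_smul, hL,
        smul_eq_mul]
      rw [hcons, Finset.mul_sum, Matrix.trace_sum]
      refine Finset.sum_congr rfl fun k _ => ?_
      rw [Matrix.mul_smul, Matrix.trace_smul, trace_memDensity_mul, hKq k b V hV, smul_eq_mul,
        Matrix.mulVec, dotProduct, Finset.mul_sum]
      exact Finset.sum_congr rfl fun j _ => by ring
    · simp
    · intro x y hx hy
      rw [Matrix.mul_add, Matrix.mul_add, Matrix.trace_add, Matrix.trace_add, hx, hy]
    · intro c x hx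
      rw [Matrix.mul_smul, Matrix.mul_smul, Matrix.trace_smul, Matrix.trace_smul, hx]
  rw [← key]
  ext x y
  simp [Matrix.sum_apply, consKron]

end Shift

/-! ### From precision of the marginals to precision of coordinates -/

section Perturbation

/-- Bessel's inequality: errors pass from densities to coordinates without loss. -/
lemma vecNorm_trace_le {l η : Type*} [Fintype l] [DecidableEq l] [Fintype η] {B : l → Matrix η η ℂ}
    (hB : ∀ i j, ((B i)ᴴ * B j).trace = if i = j then 1 else 0) (hBs : ∀ i, (B i).IsHermitian)
    (W : Matrix η η ℂ) : vecNorm (fun a => (W * B a).trace) ≤ hsNorm W := by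
  refine le_of_sq_le_sq ?_ (hsNorm_nonneg _)
  rw [vecNorm_sq, hsNorm_sq]
  refine le_trans (le_of_eq ?_) (sum_sq_trace_le hB W)
  exact Finset.sum_congr rfl fun a _ => by rw [(hBs a).eq, Matrix.trace_mul_comm]

omit [Fintype μ] [DecidableEq μ] [DecidableEq ζ] [DecidableEq κ] [DecidableEq ι] in
lemma sqrt_sum_hsNorm_sq_add_le (M N : ζ → Matrix κ ι ℂ) :
    Real.sqrt (∑ k, hsNorm (M k + N k) ^ 2) ≤
      Real.sqrt (∑ k, hsNorm (M k) ^ 2) + Real.sqrt (∑ k, hsNorm (N k) ^ 2) := by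
  have h : ∀ M : ζ → Matrix κ ι ℂ, Real.sqrt (∑ k, hsNorm (M k) ^ 2) =
      hsNorm (Matrix.of fun (x : ζ × κ) i => M x.1 x.2 i) := fun M => by
    rw [hsNorm, Fintype.sum_prod_type]
    simp only [hsNorm_sq]
    rfl
  rw [h, h, h]
  exact hsNorm_add_le _ _

omit [DecidableEq ζ] in
lemma sqrt_sum_hsNorm_mul_mul_le (hU : ‖U‖ ≤ 1) (M : ζ → Matrix κ ι ℂ) (P : Matrix ι μ ℂ) {c x : ℝ}
    (hM : ∑ k, hsNorm (M k) ^ 2 ≤ c ^ 2) (hc : 0 ≤ c) (hP : ‖P‖ ≤ x) :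
    Real.sqrt (∑ k, hsNorm (Uᴴ * M k * P) ^ 2) ≤ c * x := by
  have hx : 0 ≤ x := (norm_nonneg _).trans hP
  refine Real.sqrt_le_iff.2 ⟨mul_nonneg hc hx, ?_⟩
  calc ∑ k, hsNorm (Uᴴ * M k * P) ^ 2 ≤ ∑ k, hsNorm (M k) ^ 2 * x ^ 2 := by
        refine Finset.sum_le_sum fun k _ => ?_
        rw [← mul_pow]
        refine pow_le_pow_left₀ (hsNorm_nonneg _) ?_ 2
        refine (hsNorm_mul_le_right _ _).trans (mul_le_mul ?_ hP (norm_nonneg _) (hsNorm_nonneg _))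
        refine (hsNorm_mul_le_left _ _).trans ?_
        rw [Matrix.l2_opNorm_conjTranspose]
        exact mul_le_of_le_one_left (hsNorm_nonneg _) hU
    _ = (∑ k, hsNorm (M k) ^ 2) * x ^ 2 := by rw [Finset.sum_mul]
    _ ≤ (c * x) ^ 2 := by
        rw [mul_pow]; exact mul_le_mul_of_nonneg_right hM (sq_nonneg _)

lemma hsNorm_omegaMat_le (hY : IsSelfAdjointONB (blockAlg A s) Y)
    (hX : IsSelfAdjointONB (blockAlg A s) X)
    (W : Matrix (Fin (s + s) → Fin d) (Fin (s + s) → Fin d) ℂ) :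
    hsNorm (omegaMat Y X W) ≤ hsNorm W := by
  have h := vecNorm_trace_le (B := fun x : κ × ι => join (Y x.1) (X x.2))
    (fun x y => by
      rw [trace_conjTranspose_join_mul_join, hY.trace_conjTranspose_mul,
        hX.trace_conjTranspose_mul]
      simp only [Prod.ext_iff, ite_and, mul_ite, mul_one, mul_zero]
      split_ifs <;> rfl)
    (fun x => isHermitian_join (hY.selfAdjoint _) (hX.selfAdjoint _)) W
  refine le_trans (le_of_eq ?_) h
  rw [vecNorm_eq_sqrt, Fintype.sum_prod_type]
  rfl

lemma trace_piKron_fin_one_mul (z z' : Matrix (Fin d) (Fin d) ℂ) :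
    ((piKron fun _ : Fin 1 => z)ᴴ * (piKron fun _ : Fin 1 => z')).trace = (zᴴ * z').trace := by
  simp only [Matrix.trace, Matrix.diag, Matrix.mul_apply, piKron, Matrix.conjTranspose_apply,
    Matrix.of_apply, Fin.prod_univ_one]
  rw [← (Equiv.funUnique (Fin 1) (Fin d)).symm.sum_comp]
  refine Finset.sum_congr rfl fun x _ => ?_
  rw [← (Equiv.funUnique (Fin 1) (Fin d)).symm.sum_comp]
  rfl

/-- The family `Y_j ⊗ Z_k ⊗ X_i` is orthonormal in all three indices jointly, so all letters are
controlled at once with no factor for their number. -/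
lemma sum_hsNorm_omegaMatAt_sq_le {S₁ : Submodule ℂ (Matrix (Fin d) (Fin d) ℂ)}
    (hZ : IsSelfAdjointONB S₁ Z) (hY : IsSelfAdjointONB (blockAlg A s) Y)
    (hX : IsSelfAdjointONB (blockAlg A s) X)
    (W : Matrix (Fin (s + 1 + s) → Fin d) (Fin (s + 1 + s) → Fin d) ℂ) :
    ∑ k, hsNorm (omegaMatAt Y X W (Z k)) ^ 2 ≤ hsNorm W ^ 2 := by
  have h := vecNorm_trace_le
    (B := fun x : ζ × κ × ι => join (join (Y x.2.1) (piKron fun _ : Fin 1 => Z x.1)) (X x.2.2))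
    (fun x y => by
      rw [trace_conjTranspose_join_mul_join, trace_conjTranspose_join_mul_join,
        trace_piKron_fin_one_mul, hY.trace_conjTranspose_mul, hZ.trace_conjTranspose_mul,
        hX.trace_conjTranspose_mul]
      simp only [Prod.ext_iff, ite_and, mul_ite, mul_one, mul_zero]
      split_ifs <;> rfl)
    (fun x => isHermitian_join (isHermitian_join (hY.selfAdjoint _)
      (by rw [Matrix.IsHermitian, piKron_conjTranspose]; simp only [(hZ.selfAdjoint _).eq]))
      (hX.selfAdjoint _)) W
  refine le_trans (le_of_eq ?_) (pow_le_pow_left₀ (vecNorm_nonneg _) h 2)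
  rw [vecNorm_sq, Fintype.sum_prod_type]
  simp only [hsNorm_sq, Fintype.sum_prod_type]
  rfl

omit [DecidableEq ζ] [DecidableEq ι] in
lemma reconstruct_eq_sum_rowDensity {η : ℝ} {t : ℕ} (W : Estimates d s) :
    reconstruct Z Y X η t W = ∑ j,
      ((truncU (omegaMat Y X W.est2) η)ᴴ *ᵥ fun j => (W.est1 * Y j).trace) j •
        rowDensity Z (fun k => (truncU (omegaMat Y X W.est2) η)ᴴ * omegaMatAt Y X W.est3 (Z k) *
          pinv ((truncU (omegaMat Y X W.est2) η)ᴴ * omegaMat Y X W.est2))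
          ((fun i => (W.est1 * X i).trace) ᵥ*
            pinv ((truncU (omegaMat Y X W.est2) η)ᴴ * omegaMat Y X W.est2)) t j := by
  simp only [rowDensity_eq_sum, Finset.smul_sum]
  rw [Finset.sum_comm]
  refine Finset.sum_congr rfl fun k _ => ?_
  simp only [smul_smul, ← Finset.sum_smul]
  congr 1
  rw [Matrix.dotProduct_mulVec, dotProduct]
  exact Finset.sum_congr rfl fun j _ => mul_comm _ _

end Perturbation

end Reconstruction
-- Error budget and the guarantee
section Guarantee
open scoped Matrix.Norms.L2Operator

variable {d : ℕ} {A : StarSubalgebra ℂ (Matrix (Fin d) (Fin d) ℂ)}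

lemma JointlyBounded.mono {μ : Type*} [Fintype μ] {l : ℕ}
    {Q : (b : ℕ) → μ → Matrix (Fin b → Fin d) (Fin b → Fin d) ℂ}
    {Φ : μ → Matrix (Fin l → Fin d) (Fin l → Fin d) ℂ} {c c' : ℝ} (h : JointlyBounded Q Φ c)
    (hc : c ≤ c') : JointlyBounded Q Φ c' := fun b X =>
  (h b X).trans (mul_le_mul_of_nonneg_right hc (norm_nonneg _))

lemma TIState.dim_pos (ω : TIState A) : 0 < d := by
  rcases Nat.eq_zero_or_pos d with rfl | h
  · have h := ω.trace_one 1
    simp [Matrix.trace] at h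
  · exact h

/-- The unit on zero sites gives a nonzero functional. Positivity keeps `ω.rank - 1` from
truncating. -/
lemma TIState.rank_pos (ω : TIState A) [Module.Finite ℂ ω.hankelSpace] : 0 < ω.rank := by
  have h1 : ω.leftFunctional 0 ⟨1, one_mem_blockAlg 0⟩ ≠ 0 := by
    intro h0
    have h2 := congrFun (congrFun h0 0) ⟨1, one_mem_blockAlg 0⟩
    change ω.eval (join (1 : Matrix (Fin 0 → Fin d) (Fin 0 → Fin d) ℂ)
      (1 : Matrix (Fin 0 → Fin d) (Fin 0 → Fin d) ℂ)) = 0 at h2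
    rw [eval_join_one_right, eval, Matrix.mul_one, ω.trace_one] at h2
    exact one_ne_zero h2
  rw [rank_eq]
  have : Nontrivial ω.hankelSpace :=
    ⟨⟨_, ω.leftFunctional_mem _⟩, 0, fun h => h1 (congrArg Subtype.val h)⟩
  exact Module.finrank_pos

/-- A product of perturbation factors whose exponents sum to at most `7ε/10`. -/
lemma prod_one_add_le {x Δ y ε : ℝ} {t : ℕ} (hΔ : 0 ≤ Δ) (hy : 0 ≤ y)
    (hε₀ : 0 ≤ ε) (hε₁ : ε ≤ 1) (h : x + t * Δ + y ≤ 7 / 10 * ε) :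
    (1 + x) * (1 + Δ) ^ t * (1 + y) - 1 ≤ 2 * ε := by
  have h1 : ∀ z : ℝ, 1 + z ≤ Real.exp z := fun z => by linarith [Real.add_one_le_exp z]
  have h2 : (1 + x) * (1 + Δ) ^ t * (1 + y) ≤ Real.exp (7 / 10 * ε) := by
    calc (1 + x) * (1 + Δ) ^ t * (1 + y)
        ≤ Real.exp x * Real.exp Δ ^ t * Real.exp y := by
          have := h1 x
          have := h1 y
          have := h1 Δ
          gcongr
      _ = Real.exp (x + t * Δ + y) := by rw [← Real.exp_nat_mul, Real.exp_add, Real.exp_add]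
      _ ≤ _ := Real.exp_le_exp.2 h
  -- `exp u - 1 - u ≤ u²` at `u = 7ε/10` gives at most `0.7 ε + 0.49 ε²`, below `2 ε`.
  have h3 := Real.abs_exp_sub_one_sub_id_le (x := 7 / 10 * ε)
    (by rw [abs_of_nonneg (by positivity)]; linarith)
  have h4 := (abs_le.1 h3).2
  nlinarith

variable (ω : TIState A) {s : ℕ} {ζ κ ι : Type} [Fintype ζ] [DecidableEq ζ] [Fintype κ]
  [DecidableEq κ] [Fintype ι] [DecidableEq ι]
  {Z : ζ → Matrix (Fin d) (Fin d) ℂ} {Y : κ → Matrix (Fin s → Fin d) (Fin s → Fin d) ℂ}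
  {X : ι → Matrix (Fin s → Fin d) (Fin s → Fin d) ℂ}

lemma sqrt_sum_opNorm_liftObs_sq_le {μ : Type} [Fintype μ] [DecidableEq μ]
    (hX : IsSelfAdjointONB (blockAlg A s) X) (R : Matrix ι μ ℂ) :
    Real.sqrt (∑ i, ‖liftObs X R (Pi.single i 1)‖ ^ 2) ≤ Real.sqrt (Fintype.card μ) * ‖R‖ := by
  refine le_trans ?_ (hsNorm_le_sqrt_card R)
  rw [hsNorm, Finset.sum_comm]
  refine Real.sqrt_le_sqrt (Finset.sum_le_sum fun i _ => ?_)
  refine (pow_le_pow_left₀ (norm_nonneg _) (opNorm_sum_smul_le hX _) 2).trans (le_of_eq ?_)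
  rw [vecNorm_sq]
  simp

/-- For the upper bound, `Ω` has operator norm at most the Hilbert–Schmidt norm of a density, hence
at most one. -/
lemma sigmaMin_pos_and_le_one [Module.Finite ℂ ω.hankelSpace]
    (hY : IsSelfAdjointONB (blockAlg A s) Y) (hX : IsSelfAdjointONB (blockAlg A s) X)
    (hr : (omegaMat Y X (ω.density (s + s))).rank = ω.rank) :
    0 < sigmaMin Y X ω ∧ sigmaMin Y X ω ≤ 1 := by
  set M := omegaMat Y X (ω.density (s + s)) with hM
  have hpos := ω.rank_pos
  refine ⟨?_, ?_⟩
  · rw [sigmaMin, LinearMap.singularValues_pos_iff_lt_finrank_range,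
      ← rank_eq_finrank_range_toEuclideanLin, ← hM, hr]
    omega
  · have hM1 : ‖Mᴴ‖ ≤ 1 := by
      rw [Matrix.l2_opNorm_conjTranspose]
      exact (opNorm_le_hsNorm _).trans ((hsNorm_omegaMat_le hY hX _).trans
        (hsNorm_le_one_of_density (ω.posSemidef _) (ω.trace_one _)))
    obtain ⟨x, hx⟩ : ∃ x, M *ᵥ x ≠ 0 := by
      by_contra! h
      have h0 : M = 0 := by
        ext i j
        have := congrFun (h (Pi.single j 1)) i
        simpa using this
      rw [h0, Matrix.rank_zero] at hr
      omega
    have hx0 : 0 < vecNorm (M *ᵥ x) :=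
      (vecNorm_nonneg _).lt_of_ne' fun h0 => hx (vecNorm_eq_zero.1 h0)
    have h1 := singularValue_mul_vecNorm_le M x
    rw [hr] at h1
    have h2 : vecNorm (Mᴴ *ᵥ (M *ᵥ x)) ≤ 1 * vecNorm (M *ᵥ x) :=
      (vecNorm_mulVec_le _ _).trans (mul_le_mul_of_nonneg_right hM1 hx0.le)
    exact le_of_mul_le_mul_right (h1.trans h2) hx0

omit [DecidableEq κ] [Fintype κ] [DecidableEq ι] [Fintype ι] in
lemma omegaMat_sub (W W' : Matrix (Fin (s + s) → Fin d) (Fin (s + s) → Fin d) ℂ) :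
    omegaMat Y X (W - W') = omegaMat Y X W - omegaMat Y X W' := by
  ext i j
  simp only [omegaMat, Matrix.of_apply, Matrix.sub_apply, Matrix.sub_mul, Matrix.trace_sub]

omit [DecidableEq κ] [Fintype κ] [DecidableEq ι] [Fintype ι] in
lemma omegaMatAt_sub (W W' : Matrix (Fin (s + 1 + s) → Fin d) (Fin (s + 1 + s) → Fin d) ℂ)
    (z : Matrix (Fin d) (Fin d) ℂ) :
    omegaMatAt Y X (W - W') z = omegaMatAt Y X W z - omegaMatAt Y X W' z := by
  ext i j
  simp only [omegaMatAt, Matrix.of_apply, Matrix.sub_apply, Matrix.sub_mul, Matrix.trace_sub]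

lemma trace_sub_mul_eq {l η : Type*} [Fintype η] (W W' : Matrix η η ℂ) (B : l → Matrix η η ℂ) :
    (fun a => ((W - W') * B a).trace) = (fun a => (W * B a).trace) - fun a => (W' * B a).trace := by
  funext a
  simp only [Pi.sub_apply, Matrix.sub_mul, Matrix.trace_sub]

section Memory
variable {μ : Type} [Fintype μ] [DecidableEq μ] {U : Matrix κ μ ℂ} {R P : Matrix ι μ ℂ}
  {p x y : ℝ} {W : Estimates d s}

/-- Splits the error as (estimation error)·`P` plus (exact row)·`(P - R)`; the exact row has norm at
most one. -/
lemma vecNorm_rowVector_sub_le (hX : IsSelfAdjointONB (blockAlg A s) X) (hW : W.Within ω p)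
    (hp : 0 ≤ p) (hP : ‖P‖ ≤ x) (hPR : ‖P - R‖ ≤ y) :
    vecNorm (((fun i => (W.est1 * X i).trace) ᵥ* P) - (fun i => (ω.density s * X i).trace) ᵥ* R) ≤
      p * x + 1 * y := by
  have hτ : ∀ V : Matrix (Fin s → Fin d) (Fin s → Fin d) ℂ,
      vecNorm (fun i => (V * X i).trace) ≤ hsNorm V :=
    vecNorm_trace_le hX.trace_conjTranspose_mul hX.selfAdjoint
  have h1 : ((fun i => (W.est1 * X i).trace) ᵥ* P) - (fun i => (ω.density s * X i).trace) ᵥ* R =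
      (fun i => ((W.est1 - ω.density s) * X i).trace) ᵥ* P +
        (fun i => (ω.density s * X i).trace) ᵥ* (P - R) := by
    rw [trace_sub_mul_eq, Matrix.sub_vecMul, Matrix.vecMul_sub]
    abel
  rw [h1]
  refine (vecNorm_add_le _ _).trans (add_le_add ?_ ?_)
  · exact (vecNorm_vecMul_le _ _).trans
      (mul_le_mul ((hτ _).trans hW.1) hP (norm_nonneg _) hp)
  · exact (vecNorm_vecMul_le _ _).trans (mul_le_mul ((hτ _).trans
      (hsNorm_le_one_of_density (ω.posSemidef _) (ω.trace_one _))) hPR (norm_nonneg _)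
        zero_le_one)

lemma vecNorm_columnVector_sub_le (hY : IsSelfAdjointONB (blockAlg A s) Y) (hW : W.Within ω p)
    (hU : ‖U‖ ≤ 1) :
    vecNorm ((Uᴴ *ᵥ fun j => (W.est1 * Y j).trace) - Uᴴ *ᵥ fun j => (ω.density s * Y j).trace) ≤
      p := by
  rw [← Matrix.mulVec_sub, ← trace_sub_mul_eq]
  refine (vecNorm_mulVec_le _ _).trans ((mul_le_mul ?_ ((vecNorm_trace_le
    hY.trace_conjTranspose_mul hY.selfAdjoint _).trans hW.1) (vecNorm_nonneg _)
      zero_le_one).trans (one_mul p).le)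
  rwa [Matrix.l2_opNorm_conjTranspose]

lemma sqrt_sum_sq_transfer_sub_le {S₁ : Submodule ℂ (Matrix (Fin d) (Fin d) ℂ)}
    (hZ : IsSelfAdjointONB S₁ Z) (hY : IsSelfAdjointONB (blockAlg A s) Y)
    (hX : IsSelfAdjointONB (blockAlg A s) X) (hW : W.Within ω p) (hp : 0 ≤ p) (hU : ‖U‖ ≤ 1)
    (hP : ‖P‖ ≤ x) (hPR : ‖P - R‖ ≤ y) :
    Real.sqrt (∑ i, ∑ k, ∑ j, ‖((fun k => Uᴴ * omegaMatAt Y X W.est3 (Z k) * P) -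
      fun k => Uᴴ * omegaMatAt Y X (ω.density (s + 1 + s)) (Z k) * R) k i j‖ ^ 2) ≤
        p * x + 1 * y := by
  have h1 : ∑ i, ∑ k, ∑ j, ‖((fun k => Uᴴ * omegaMatAt Y X W.est3 (Z k) * P) -
      fun k => Uᴴ * omegaMatAt Y X (ω.density (s + 1 + s)) (Z k) * R) k i j‖ ^ 2 = ∑ k, hsNorm
      (Uᴴ * (omegaMatAt Y X (W.est3 - ω.density (s + 1 + s)) (Z k)) * P +
        Uᴴ * omegaMatAt Y X (ω.density (s + 1 + s)) (Z k) * (P - R)) ^ 2 := by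
    rw [Finset.sum_comm]
    refine Finset.sum_congr rfl fun k _ => ?_
    rw [← hsNorm_sq]
    congr 2
    rw [omegaMatAt_sub, Matrix.mul_sub, Matrix.sub_mul, Matrix.mul_sub, Pi.sub_apply]
    abel
  rw [h1]
  refine (sqrt_sum_hsNorm_sq_add_le _ _).trans (add_le_add ?_ ?_)
  · exact sqrt_sum_hsNorm_mul_mul_le hU _ _ ((sum_hsNorm_omegaMatAt_sq_le hZ hY hX _).trans
      (pow_le_pow_left₀ (hsNorm_nonneg _) hW.2.2 2)) hp hP
  · exact sqrt_sum_hsNorm_mul_mul_le hU _ _ ((sum_hsNorm_omegaMatAt_sq_le hZ hY hX _).trans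
      (pow_le_pow_left₀ (hsNorm_nonneg _)
        (hsNorm_le_one_of_density (ω.posSemidef _) (ω.trace_one _)) 2)) zero_le_one hPR

/-- Stability of the reconstruction for given memory coordinates `U` and approximate lift `P`. -/
lemma norm_trace_sum_rowDensity_sub_mul_le [Module.Finite ℂ ω.hankelSpace]
    (hZ : IsSelfAdjointONB (Subalgebra.toSubmodule A.toSubalgebra) Z)
    (hY : IsSelfAdjointONB (blockAlg A s) Y) (hX : IsSelfAdjointONB (blockAlg A s) X)
    (hcard : Fintype.card μ = ω.rank) (hR : Uᴴ * omegaMat Y X (ω.density (s + s)) * R = 1)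
    (hU : ‖U‖ ≤ 1) (hW : W.Within ω p) (hp : 0 ≤ p) (hP : ‖P‖ ≤ x) (hPR : ‖P - R‖ ≤ y)
    {w q : ℝ} (hw : ‖R‖ ≤ w) (hq : p * x + 1 * y ≤ q) (t : ℕ)
    (B : Matrix (Fin t → Fin d) (Fin t → Fin d) ℂ) :
    ‖((∑ j, (Uᴴ *ᵥ fun j => (W.est1 * Y j).trace) j •
        rowDensity Z (fun k => Uᴴ * omegaMatAt Y X W.est3 (Z k) * P)
          ((fun i => (W.est1 * X i).trace) ᵥ* P) t j - ω.density t) * B).trace‖ ≤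
      ((1 + q) * (1 + Real.sqrt d * q * (Real.sqrt ω.rank * w)) ^ t * (1 + w * p) - 1) * ‖B‖ := by
  have hq0 : 0 ≤ q := (Real.sqrt_nonneg _).trans
    ((sqrt_sum_sq_transfer_sub_le ω hZ hY hX hW hp hU hP hPR).trans hq)
  have hw0 : 0 ≤ w := (norm_nonneg _).trans hw
  have hshift := implementsShift_memDensity ω hZ hY hX hR hcard
  have hsum := sum_smul_memDensity_eq ω hY hX hR hcard
  have htrue := (sum_smul_rowDensity_eq hshift (memDensity_zero ω Y U) t
    (r := (fun i => (ω.density s * X i).trace) ᵥ* R)).trans (hsum t)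
  have hlift : ∀ (v : μ → ℂ) j, (memDensity ω Y U s j * liftObs X R v).trace = v j := fun v j => by
    rw [trace_memDensity_mul, mulVec_eval_join_liftObs ω hR]
  rw [← htrue]
  refine norm_trace_rowDensity_sub_le hshift hq0 (by positivity) ?_ ?_ ?_
    (memDensity_zero ω Y U) (fun j => hlift _ j) ((opNorm_liftObs_le hX _).trans
      (mul_le_mul hw (vecNorm_columnVector_sub_le ω hY hW hU) (vecNorm_nonneg _) hw0)) t B
  · intro l Φ c hc hΦ
    -- Lifts of the standard basis vectors are dual to the memory coordinates on `s` sites.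
    have h1 := hΦ.appendSite_le (L := fun i => liftObs X R (Pi.single i 1))
      (D := (fun k => Uᴴ * omegaMatAt Y X W.est3 (Z k) * P) -
        fun k => Uᴴ * omegaMatAt Y X (ω.density (s + 1 + s)) (Z k) * R)
      (fun i j => by rw [hlift]; simp [Pi.single_apply]) (Real.sqrt_nonneg d)
      (norm_trace_site_memDensity_le ω hY hU hZ) hc
    refine h1.mono (mul_le_mul_of_nonneg_left ?_ hc)
    refine mul_le_mul (mul_le_mul_of_nonneg_left
      ((sqrt_sum_sq_transfer_sub_le ω hZ hY hX hW hp hU hP hPR).trans hq) (Real.sqrt_nonneg _))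
      ?_ (Real.sqrt_nonneg _) (by positivity)
    refine (sqrt_sum_opNorm_liftObs_sq_le hX R).trans ?_
    rw [hcard]
    exact mul_le_mul_of_nonneg_left hw (Real.sqrt_nonneg _)
  · refine jointlyBounded_zero_of_forall ω fun b V => ?_
    have h := ω.norm_eval_le V
    rw [TIState.eval, ← hsum b, Finset.sum_mul, Matrix.trace_sum] at h
    simpa only [Matrix.smul_mul, Matrix.trace_smul, smul_eq_mul, one_mul] using h
  -- At length zero the operators play no role, so the difference of two rows is the row of the
  -- difference, with any `K`.
  · refine jointlyBounded_zero_of_forall ω (Z := Z) (K := fun _ => 0)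
      (v := ((fun i => (W.est1 * X i).trace) ᵥ* P) - (fun i => (ω.density s * X i).trace) ᵥ* R)
      fun b V => ?_
    exact (norm_sum_mul_trace_memDensity_le ω hY hU _ V).trans (mul_le_mul_of_nonneg_right
      ((vecNorm_rowVector_sub_le ω hX hW hp hP hPR).trans hq) (norm_nonneg _))

end Memory

/-- The spectral reconstruction from marginals known within precision `p`. -/
lemma norm_trace_reconstruct_sub_mul_le [Module.Finite ℂ ω.hankelSpace]
    (hZ : IsSelfAdjointONB (Subalgebra.toSubmodule A.toSubalgebra) Z)
    (hY : IsSelfAdjointONB (blockAlg A s) Y) (hX : IsSelfAdjointONB (blockAlg A s) X)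
    (hr : (omegaMat Y X (ω.density (s + s))).rank = ω.rank) {η p : ℝ} (hp0 : 0 < p)
    (hη₁ : η ≤ sigmaMin Y X ω / 2) (hη₂ : 2 * p ≤ η) (hpσ : p < sigmaMin Y X ω / 4)
    {W : Estimates d s} (hW : W.Within ω p) (t : ℕ)
    (B : Matrix (Fin t → Fin d) (Fin t → Fin d) ℂ) :
    ‖((reconstruct Z Y X η t W - ω.density t) * B).trace‖ ≤
      ((1 + 4 * p / sigmaMin Y X ω ^ 2) *
        (1 + 8 * p * Real.sqrt d * Real.sqrt ω.rank / sigmaMin Y X ω ^ 3) ^ t *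
          (1 + 2 * p / sigmaMin Y X ω) - 1) * ‖B‖ := by
  obtain ⟨hσ0, hσ1⟩ := sigmaMin_pos_and_le_one ω hY hX hr
  have hMM : ‖omegaMat Y X W.est2 - omegaMat Y X (ω.density (s + s))‖ ≤ p := by
    rw [← omegaMat_sub]
    exact (opNorm_le_hsNorm _).trans ((hsNorm_omegaMat_le hY hX _).trans hW.2.1)
  obtain ⟨hcard, hP, R, hR, hRn, hPR⟩ := truncU_spec (σ := sigmaMin Y X ω) (η := η) (p := p)
    (by rw [sigmaMin, hr]) hσ0 hMM hpσ (by linarith) hη₁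
  rw [hr] at hcard
  rw [reconstruct_eq_sum_rowDensity]
  generalize sigmaMin Y X ω = σ at *
  -- `σ ≤ 1` absorbs the term of order `p/σ` into the order `p/σ²`.
  have herr : p * (4 / (3 * σ)) + 1 * (8 * p / (3 * σ ^ 2)) ≤ 4 * p / σ ^ 2 := by
    have h1 : 4 * p / σ ^ 2 - (p * (4 / (3 * σ)) + 1 * (8 * p / (3 * σ ^ 2))) =
        4 * p * (1 - σ) / (3 * σ ^ 2) := by field_simp; ring
    have h2 : 0 ≤ 4 * p * (1 - σ) / (3 * σ ^ 2) :=
      div_nonneg (mul_nonneg (by positivity) (by linarith)) (by positivity)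
    linarith
  have h := norm_trace_sum_rowDensity_sub_mul_le ω hZ hY hX hcard hR (opNorm_truncU_le _ _) hW
    hp0.le hP hPR hRn herr t B
  have h1 : Real.sqrt d * (4 * p / σ ^ 2) * (Real.sqrt ω.rank * (2 / σ)) =
      8 * p * Real.sqrt d * Real.sqrt ω.rank / σ ^ 3 := by field_simp; ring
  rwa [h1, div_mul_eq_mul_div] at h

end Guarantee
end FCS
end

/-- Learning guarantee for `C*`-finitely correlated states with memory algebra `M_{dB}`. -/
theorem theorem2 {d : ℕ} (A : StarSubalgebra ℂ (Matrix (Fin d) (Fin d) ℂ)) {s n t : ℕ}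
    {ζ κ ι : Type} [Fintype ζ] [DecidableEq ζ] [Fintype κ] [DecidableEq κ]
    [Fintype ι] [DecidableEq ι]
    -- self-adjoint orthonormal bases of the algebras of one site, the left and the right block
    (Z : ζ → Matrix (Fin d) (Fin d) ℂ)
    (hZ : FCS.IsSelfAdjointONB (Subalgebra.toSubmodule A.toSubalgebra) Z)
    (Y : κ → Matrix (Fin s → Fin d) (Fin s → Fin d) ℂ)
    (hY : FCS.IsSelfAdjointONB (FCS.blockAlg A s) Y)
    (X : ι → Matrix (Fin s → Fin d) (Fin s → Fin d) ℂ)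
    (hX : FCS.IsSelfAdjointONB (FCS.blockAlg A s) X)
    -- the tomography subroutine on n copies, and the threshold
    (T : FCS.Procedure d (s + 1 + s) n (FCS.Estimates d s)) (η : ℝ)
    -- the state, with memory algebra of dB × dB matrices
    (ω : FCS.TIState A) (dB : ℕ) (hω : Nonempty (FCS.CStarRealization ω dB))
    -- the restriction of Ω to the sites from -t₁ to t₂ determines Ω
    (t₁ t₂ : ℕ) (hdet : ω.blockRank (t₁ + 1) t₂ = ω.rank) (hs : max t₂ (t₁ + 1) ≤ s)
    (ht : 1 ≤ t) (ε δ p : ℝ) (hε₀ : 0 < ε) (hε₁ : ε < 1)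
    (hp : p = ε * FCS.sigmaMin Y X ω ^ 3 / (20 * t * dB * Real.sqrt d))
    (hη₁ : η ≤ FCS.sigmaMin Y X ω / 2) (hη₂ : 2 * p ≤ η)
    -- n copies are enough for learning the marginals at precision p
    (hT : T.Succeeds ω δ fun W => W.Within ω p) :
    (FCS.learnFCS Z Y X T η t).Succeeds ω δ fun M =>
      FCS.traceDist A M (ω.density t) ≤ ε := by
  obtain ⟨S, hS, hgood, hprob⟩ := hT
  refine ⟨S, hS, fun o ho => ?_, hprob⟩
  obtain ⟨hfin, hrank⟩ := hω.some.finite_and_rank_le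
  -- Blocks of `s` sites contain the determining blocks, so the finite matrix already has the full
  -- rank of `Ω`.
  have hr : (FCS.omegaMat Y X (ω.density (s + s))).rank = ω.rank :=
    le_antisymm (FCS.rank_omegaMat_le_rank ω hY.mem hX.mem) (hdet.symm.le.trans
      ((ω.blockRank_mono ((le_max_right _ _).trans hs) ((le_max_left _ _).trans hs)).trans
        (FCS.blockRank_le_rank_omegaMat hY.span hX.span)))
  obtain ⟨hσ0, hσ1⟩ := FCS.sigmaMin_pos_and_le_one ω hY hX hr
  set σ := FCS.sigmaMin Y X ω
  have hd1 : 1 ≤ Real.sqrt d := Real.one_le_sqrt.2 (by exact_mod_cast ω.dim_pos)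
  have ht1 : (1 : ℝ) ≤ t := by exact_mod_cast ht
  have hdB : (1 : ℝ) ≤ dB := by
    have h1 : dB ≠ 0 := by
      rintro rfl
      have := ω.rank_pos
      omega
    exact_mod_cast Nat.one_le_iff_ne_zero.2 h1
  have hsq : Real.sqrt ω.rank ≤ dB := by
    refine Real.sqrt_le_iff.2 ⟨by linarith, ?_⟩
    exact_mod_cast hrank
  have hden : (1 : ℝ) ≤ t * dB * Real.sqrt d :=
    one_le_mul_of_one_le_of_one_le (one_le_mul_of_one_le_of_one_le ht1 hdB) hd1
  have hpeq : 20 * p * (t * dB * Real.sqrt d) = ε * σ ^ 3 := by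
    rw [hp]; field_simp
  have hp0 : 0 < p := by rw [hp]; positivity
  have hp20 : 20 * p ≤ ε * σ ^ 3 := by
    rw [← hpeq]
    exact le_mul_of_one_le_right (by positivity) hden
  have hσ2 : σ ^ 2 ≤ 1 := pow_le_one₀ hσ0.le hσ1
  have hpσ : p < σ / 4 := by
    have h1 : ε * σ ^ 3 ≤ 1 * σ := by
      have : ε * σ ^ 3 = (ε * σ ^ 2) * σ := by ring
      rw [this]
      exact mul_le_mul_of_nonneg_right (mul_le_one₀ hε₁.le (sq_nonneg _) hσ2) hσ0.le
    linarith
  -- The budget: `ε/5` for the row, `ε/10` for the column and `2ε/5` for the `t` operators, in total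
  -- `7ε/10`.
  have hx : 4 * p / σ ^ 2 ≤ 1 / 5 * ε := by
    rw [div_le_iff₀ (by positivity)]
    have : ε * σ ^ 3 ≤ ε * σ ^ 2 :=
      mul_le_mul_of_nonneg_left (pow_le_pow_of_le_one hσ0.le hσ1 (by norm_num)) hε₀.le
    linarith
  have hy : 2 * p / σ ≤ 1 / 10 * ε := by
    rw [div_le_iff₀ hσ0]
    have : ε * σ ^ 3 ≤ ε * σ :=
      mul_le_mul_of_nonneg_left (pow_le_of_le_one hσ0.le hσ1 (by norm_num)) hε₀.le
    linarith
  -- Here the whole denominator `t dB √d` of `p` is spent, through `√m ≤ dB`.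
  have hΔ : t * (8 * p * Real.sqrt d * Real.sqrt ω.rank / σ ^ 3) ≤ 2 / 5 * ε := by
    rw [← mul_div_assoc, div_le_iff₀ (by positivity)]
    calc t * (8 * p * Real.sqrt d * Real.sqrt ω.rank) ≤ t * (8 * p * Real.sqrt d * dB) := by gcongr
      _ = 2 / 5 * (20 * p * (t * dB * Real.sqrt d)) := by ring
      _ = 2 / 5 * ε * σ ^ 3 := by rw [hpeq]; ring
  have hfinal := FCS.prod_one_add_le (x := 4 * p / σ ^ 2)
    (Δ := 8 * p * Real.sqrt d * Real.sqrt ω.rank / σ ^ 3) (y := 2 * p / σ) (t := t)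
    (by positivity) (by positivity) hε₀.le hε₁.le (by linarith)
  have hbound : ∀ B : Matrix (Fin t → Fin d) (Fin t → Fin d) ℂ,
      ‖Matrix.toEuclideanCLM (𝕜 := ℂ) B‖ ≤ 1 →
      ‖((FCS.reconstruct Z Y X η t (T.result o) - ω.density t) * B).trace‖ ≤ 2 * ε := by
    intro B hB
    refine (FCS.norm_trace_reconstruct_sub_mul_le ω hZ hY hX hr hp0 hη₁ hη₂ hpσ (hgood o ho) t
      B).trans ?_
    exact (mul_le_mul hfinal hB (norm_nonneg _) (by positivity)).trans (mul_one _).le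
  change 1 / 2 * sSup _ ≤ ε
  have hsup : sSup {r : ℝ | ∃ B ∈ FCS.blockAlg A t, ‖Matrix.toEuclideanCLM (𝕜 := ℂ) B‖ ≤ 1 ∧
      r = ‖((FCS.reconstruct Z Y X η t (T.result o) - ω.density t) * B).trace‖} ≤ 2 * ε := by
    refine Real.sSup_le ?_ (by positivity)
    rintro _ ⟨B, -, hB, rfl⟩
    exact hbound B hB
  -- The factor `1/2` in the trace distance is why `2 ε` suffices for the dual norm.
  calc _ ≤ 1 / 2 * (2 * ε) := mul_le_mul_of_nonneg_left hsup (by norm_num)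
    _ = ε := by ring
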